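/- Let $S$ be a compact connected smooth surface without boundary (Hausdorff, not necessarily orientable), and let $D=\{c_1,\dots,c_n\}$ be a star divisor on $S$: a finite (possibly empty) collection of smooth closed curves, i.e. closed connected embedded one-dimensional submanifolds, which are pairwise transverse and such that around every $p\in S$ there is a smooth chart centred at $p$ in which the curves of $D$ through $p$ are distinct lines through the origin. Let ${}^bTS$ be the $b$-tangent bundle of $(S,D)$, the Lie algebroid whose sections are the smooth vector fields on $S$ tangent to every $c_i$, with the usual Lie bracket and the inclusion as anchor; let ${}^b\Omega^k(S)$ be the sections of $\wedge^k({}^bTS)^*$, with the Lie algebroid differential $d$. A log-symplectic form on $(S,D)$ is a form $\omega\in{}^b\Omega^2(S)$ with $d\omega=0$ for which $\omega^\flat:{}^bTS\to({}^bTS)^*$ is an isomorphism. Two log-symplectic forms $\omega_0,\omega_1$ on $(S,D)$ are called $b$-symplectomorphic if there is a smooth isotopy $\gamma_t:S\to S$, with $\gamma_0=\mathrm{id}$, of diffeomorphisms satisfying $\gamma_t(c_i)=c_i$ for all $t$ and $i$, such that $\gamma_1^*\omega_1=\omega_0$. Then $\omega_0$ and $\omega_1$ are $b$-symplectomorphic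 if and only if both of the following hold: 1. they are cohomologous in the degree-2 Lie algebroid cohomology of ${}^bTS$, i.e. $\omega_1-\omega_0=d\alpha$ for some $\alpha\in{}^b\Omega^1(S)$; 2. they induce the same orientation of ${}^bTS$, i.e. $\omega_0=f\omega_1$ for a positive function $f\in C^\infty(S)$. -/

import Mathlib

open scoped Manifold ContDiff
open VectorField

namespace StarLog

/-- The model plane of a surface. -/
abbrev Plane : Type := EuclideanSpace ℝ (Fin 2)

section Basic

variable (S : Type*) [TopologicalSpace S] [ChartedSpace Plane S]

/-- The ring of smooth real functions on the surface. -/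
abbrev SmoothFn : Type _ := C^∞⟮𝓡 2, S; 𝓘(ℝ, ℝ), ℝ⟯

/-- A star divisor: a finite collection of smooth closed curves (closed connected subsets that are
locally lines in smooth charts) which are pairwise transverse and such that around every point the
curves through that point are, in one smooth chart centred there, distinct lines through the
origin. -/
structure StarDivisor where
  card : ℕ
  curve : Fin card → Set S
  isClosed : ∀ i, IsClosed (curve i)
  isConnected : ∀ i, IsConnected (curve i)
  star_chart : ∀ p : S, ∃ φ ∈ IsManifold.maximalAtlas (𝓡 2) ∞ S, p ∈ φ.source ∧ φ p = 0 ∧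
    ∃ l : Fin card → (Plane →L[ℝ] ℝ),
      (∀ i, p ∈ curve i → l i ≠ 0 ∧ ∀ q ∈ φ.source, q ∈ curve i ↔ l i (φ q) = 0) ∧
      ∀ i j, i ≠ j → p ∈ curve i → p ∈ curve j → LinearIndependent ℝ ![l i, l j]

variable {S}

/-- The tangent space at `p` of a closed submanifold `c`: the tangent vectors that annihilate all
smooth functions vanishing on `c`. -/
def tangentAlong (c : Set S) (p : S) : Set (TangentSpace (𝓡 2) p) :=
  {v | ∀ f : SmoothFn S, (∀ q ∈ c, f q = 0) → mvfderiv (𝓡 2) f p v = 0}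

end Basic

section BTangent

variable {S : Type*} [TopologicalSpace S] [ChartedSpace Plane S] [IsManifold (𝓡 2) ∞ S]

variable (S) in
/-- Smooth vector fields on the surface. -/
abbrev VField : Type _ := Cₛ^∞⟮𝓡 2; Plane, (TangentSpace (𝓡 2) : S → Type _)⟯

/-- Product of a smooth function and a smooth vector field. -/
noncomputable def fsmul (f : SmoothFn S) (X : VField S) : VField S :=
  ⟨fun p => f p • X p, f.contMDiff.smul_section X.contMDiff⟩

/-- The derivative `X f` of a smooth function along a smooth vector field. -/
noncomputable def act (X : VField S) (f : SmoothFn S) : SmoothFn S :=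
  ⟨fun p => mvfderiv (𝓡 2) f p (X p), by
    have h1 : ContMDiff (𝓡 2).tangent (𝓘(ℝ, ℝ)).tangent ∞ (tangentMap (𝓡 2) 𝓘(ℝ, ℝ) f) :=
      f.contMDiff.contMDiff_tangentMap (by simp)
    exact ((contMDiff_snd_tangentBundle_modelSpace ℝ 𝓘(ℝ, ℝ)).comp h1).comp X.contMDiff⟩

lemma act_apply (X : VField S) (f : SmoothFn S) (p : S) :
    act X f p = mvfderiv (𝓡 2) f p (X p) := rfl

lemma isManifold_three : IsManifold (𝓡 2) (minSmoothness ℝ 3) S := by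
  have h : (3 : WithTop ℕ∞) ≤ ∞ := by
    rw [show (3 : WithTop ℕ∞) = ((3 : ℕ∞) : WithTop ℕ∞) from rfl]
    exact WithTop.coe_le_coe.mpr le_top
  simpa using (IsManifold.of_le h : IsManifold (𝓡 2) 3 S)

/-- The Lie bracket of smooth vector fields. -/
noncomputable def vbracket (X Y : VField S) : VField S :=
  ⟨mlieBracket (𝓡 2) X Y, by
    have : IsManifold (𝓡 2) (minSmoothness ℝ 3) S := isManifold_three
    have : IsManifold (𝓡 2) (((⊤ : ℕ∞) : WithTop ℕ∞) + 1) S := by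
      simpa using (inferInstance : IsManifold (𝓡 2) ∞ S)
    exact ContDiff.mlieBracket_vectorField (m := ⊤) (n := ⊤) X.contMDiff Y.contMDiff (by simp)⟩

/-- The bracket acts on functions as the commutator. -/
lemma act_vbracket (X Y : VField S) (f : SmoothFn S) (p : S) :
    act (vbracket X Y) f p = act X (act Y f) p - act Y (act X f) p := by
  have : IsManifold (𝓡 2) (minSmoothness ℝ 3) S := isManifold_three
  have : IsManifold (𝓡 2) (((⊤ : ℕ∞) : WithTop ℕ∞) + 1) S := by
    simpa using (inferInstance : IsManifold (𝓡 2) ∞ S)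
  have h2 : minSmoothness ℝ 2 ≤ ∞ := by
    rw [minSmoothness_of_isRCLikeNormedField,
      show (2 : WithTop ℕ∞) = ((2 : ℕ∞) : WithTop ℕ∞) from rfl]
    exact WithTop.coe_le_coe.mpr le_top
  let CM : (∀ q : S, TangentSpace (𝓡 2) q) → S → Prop := fun Z q =>
    ContMDiffAt (𝓡 2) (𝓡 2).tangent ∞ (fun x => (⟨x, Z x⟩ : TangentBundle (𝓡 2) S)) q
  obtain ⟨v, hv⟩ := exists_ne (0 : Plane)
  let v' : TangentSpace (𝓡 2) p := v
  obtain ⟨s, hs, hW⟩ := FiberBundle.exists_contMDiffOn_extend (k := ∞) (𝓡 2) Plane v'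
  set W := FiberBundle.extend Plane v' with hWdef
  have hWp : W p ≠ 0 := by
    rw [hWdef, FiberBundle.extend_apply_self]; exact hv
  have hev : ∀ᶠ q in nhds p, CM W q := by
    filter_upwards [eventually_mem_nhds_iff.mpr hs] with q hq
    exact (hW q (mem_of_mem_nhds hq)).contMDiffAt hq
  have hWs : CM W p := hev.self_of_nhds
  have hbr : ∀ Z : VField S, CM (mlieBracket (𝓡 2) Z W) p := fun Z =>
    ContMDiffAt.mlieBracket_vectorField (m := ⊤) (n := ⊤) Z.contMDiff.contMDiffAt hWs (by simp)
  have md : ∀ {Z : ∀ q : S, TangentSpace (𝓡 2) q}, CM Z p → MDifferentiableAt (𝓡 2) (𝓡 2).tangent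
        (fun x => (⟨x, Z x⟩ : TangentBundle (𝓡 2) S)) p :=
    fun h => ContMDiffAt.mdifferentiableAt h (by simp)
  have sm : ∀ (g : SmoothFn S) {Z : ∀ q : S, TangentSpace (𝓡 2) q}, CM Z p →
      CM (⇑g • Z) p :=
    fun g Z h => g.contMDiff.contMDiffAt.smul_section h
  have key : ∀ U V : VField S, mlieBracket (𝓡 2) U (mlieBracket (𝓡 2) V (⇑f • W)) p =
      act U (act V f) p • W p + act V f p • mlieBracket (𝓡 2) U W p +
        (act U f p • mlieBracket (𝓡 2) V W p +
          f p • mlieBracket (𝓡 2) U (mlieBracket (𝓡 2) V W) p) := by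
    intro U V
    have e : mlieBracket (𝓡 2) V (⇑f • W) =ᶠ[nhds p]
        (⇑(act V f) • W + ⇑f • mlieBracket (𝓡 2) V W) := by
      filter_upwards [hev] with q hq
      exact mlieBracket_smul_right f.mdifferentiableAt (ContMDiffAt.mdifferentiableAt hq (by simp))
    rw [Filter.EventuallyEq.mlieBracket_vectorField_eq (Filter.EventuallyEq.refl _ (⇑U)) e,
      mlieBracket_add_right (md (sm _ hWs)) (md (sm _ (hbr V))),
      mlieBracket_smul_right (act V f).mdifferentiableAt (md hWs),
      mlieBracket_smul_right f.mdifferentiableAt (md (hbr V))]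
    rfl
  have c2 : ∀ {Z : ∀ q : S, TangentSpace (𝓡 2) q}, CM Z p →
      ContMDiffAt (𝓡 2) (𝓡 2).tangent (minSmoothness ℝ 2)
        (fun x => (⟨x, Z x⟩ : TangentBundle (𝓡 2) S)) p := fun h => ContMDiffAt.of_le h h2
  have J1 := leibniz_identity_mlieBracket_apply (c2 X.contMDiff.contMDiffAt)
    (c2 Y.contMDiff.contMDiffAt) (c2 hWs)
  have J2 := leibniz_identity_mlieBracket_apply (c2 X.contMDiff.contMDiffAt)
    (c2 Y.contMDiff.contMDiffAt) (c2 (sm f hWs))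
  have e3 : mlieBracket (𝓡 2) (mlieBracket (𝓡 2) X Y) (⇑f • W) p =
      act (vbracket X Y) f p • W p +
        f p • mlieBracket (𝓡 2) (mlieBracket (𝓡 2) X Y) W p :=
    mlieBracket_smul_right f.mdifferentiableAt (md hWs)
  rw [key X Y, key Y X, e3, J1] at J2
  have : (act (vbracket X Y) f p - (act X (act Y f) p - act Y (act X f) p)) • W p = 0 := by
    rw [sub_smul, sub_smul]
    rw [smul_add] at J2
    rw [← sub_eq_zero] at J2
    rw [← neg_eq_zero, ← J2]
    abel
  rcases smul_eq_zero.mp this with h | h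
  · exact sub_eq_zero.mp h
  · exact absurd h hWp

variable (D : StarDivisor S)

/-- Sections of the `b`-tangent bundle: the smooth vector fields tangent to every curve of the
divisor. -/
noncomputable def BField : Submodule ℝ (VField S) where
  carrier := {X | ∀ i, ∀ p ∈ D.curve i, X p ∈ tangentAlong (D.curve i) p}
  add_mem' := by
    intro X Y hX hY i p hp f hf
    have h1 := hX i p hp f hf
    have h2 := hY i p hp f hf
    simp [h1, h2]
  zero_mem' := by
    intro i p hp f hf
    simp
  smul_mem' := by
    intro c X hX i p hp f hf
    have h1 := hX i p hp f hf
    simp [h1]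

variable {D}

/-- The sections of the `b`-tangent bundle form a module over the smooth functions. -/
noncomputable instance : Module (SmoothFn S) (BField D) where
  smul f X := ⟨fsmul f X.1, fun i p hp g hg => by
    have h1 := X.2 i p hp g hg
    change mvfderiv (𝓡 2) g p (f p • X.1 p) = 0
    rw [map_smul, h1, smul_zero]⟩
  one_smul X := by
    ext p : 2
    exact one_smul ℝ (X.1 p)
  mul_smul f g X := by
    ext p : 2
    exact mul_smul (f p) (g p) (X.1 p)
  smul_zero f := by
    ext p : 2
    exact smul_zero (f p)
  smul_add f X Y := by
    ext p : 2
    exact smul_add (f p) (X.1 p) (Y.1 p)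
  add_smul f g X := by
    ext p : 2
    exact add_smul (f p) (g p) (X.1 p)
  zero_smul X := by
    ext p : 2
    exact zero_smul ℝ (X.1 p)

/-- The Lie algebroid bracket on sections of the `b`-tangent bundle. -/
noncomputable def bbracket (X Y : BField D) : BField D :=
  ⟨vbracket X.1 Y.1, fun i p hp f hf => by
    have h := act_vbracket X.1 Y.1 f p
    have hX : act X.1 (act Y.1 f) p = 0 :=
      X.2 i p hp (act Y.1 f) fun q hq => Y.2 i q hq f hf
    have hY : act Y.1 (act X.1 f) p = 0 :=
      Y.2 i p hp (act X.1 f) fun q hq => X.2 i q hq f hf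
    rw [hX, hY, sub_zero] at h
    exact h⟩

variable (D)

/-- Smooth sections of the dual of the `b`-tangent bundle. -/
abbrev BOneForm : Type _ := BField D →ₗ[SmoothFn S] SmoothFn S

/-- Smooth sections of the second tensor power of the dual of the `b`-tangent bundle; the
`b`-forms of degree two are those that are alternating. -/
abbrev BBilin : Type _ := BField D →ₗ[SmoothFn S] BField D →ₗ[SmoothFn S] SmoothFn S

variable {D}

/-- The Lie algebroid differential of a `b`-form of degree one. -/
noncomputable def bdOne (α : BOneForm D) (X Y : BField D) : SmoothFn S :=
  act X.1 (α Y) - act Y.1 (α X) - α (bbracket X Y)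

/-- The Lie algebroid differential of a `b`-form of degree two. -/
noncomputable def bdTwo (η : BBilin D) (X Y Z : BField D) : SmoothFn S :=
  act X.1 (η Y Z) - act Y.1 (η X Z) + act Z.1 (η X Y)
    - η (bbracket X Y) Z + η (bbracket X Z) Y - η (bbracket Y Z) X

variable (D) in
/-- A star log symplectic form: a closed `b`-form of degree two that is nondegenerate, i.e. the
induced map from the `b`-tangent bundle to its dual is an isomorphism. -/
structure LogSymplecticForm where
  form : BBilin D
  alt : ∀ X, form X X = 0
  closed : ∀ X Y Z, bdTwo form X Y Z = 0
  nondegenerate : Function.Bijective form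

/-- Equality of classes in the Lie algebroid cohomology of degree two. -/
def Cohomologous (ω₀ ω₁ : LogSymplecticForm D) : Prop :=
  ∃ α : BOneForm D, ∀ X Y, ω₁.form X Y - ω₀.form X Y = bdOne α X Y

/-- The two forms induce the same orientation of the `b`-tangent bundle. -/
def SameOrientation (ω₀ ω₁ : LogSymplecticForm D) : Prop :=
  ∃ f : SmoothFn S, (∀ p, 0 < f p) ∧ ω₀.form = f • ω₁.form

variable (D) in
/-- A `b`-diffeomorphism: a diffeomorphism of the surface mapping each curve of the divisor onto
itself. -/
structure BDiffeo where
  toDiffeo : S ≃ₘ⟮𝓡 2, 𝓡 2⟯ S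
  image_curve : ∀ i, toDiffeo '' D.curve i = D.curve i

/-- Push-forward of a section of the `b`-tangent bundle by a `b`-diffeomorphism `φ`; its value at
`q` is the image of `X (φ⁻¹ q)` under the derivative of `φ`. -/
noncomputable def BDiffeo.push (φ : BDiffeo D) (X : BField D) : BField D :=
  ⟨⟨fun q => mfderiv (𝓡 2) (𝓡 2) φ.toDiffeo (φ.toDiffeo.symm q) (X.1 (φ.toDiffeo.symm q)), by
    have h1 : ContMDiff (𝓡 2).tangent (𝓡 2).tangent ∞ (tangentMap (𝓡 2) (𝓡 2) φ.toDiffeo) :=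
      φ.toDiffeo.contMDiff.contMDiff_tangentMap (by simp)
    have h2 := (h1.comp X.1.contMDiff).comp φ.toDiffeo.symm.contMDiff
    refine h2.congr fun q => ?_
    have e : φ.toDiffeo (φ.toDiffeo.symm q) = q := φ.toDiffeo.apply_symm_apply q
    exact Bundle.TotalSpace.ext e.symm HEq.rfl⟩, by
    intro i q hq f hf
    have hp : φ.toDiffeo.symm q ∈ D.curve i := by
      obtain ⟨r, hr, rfl⟩ := (φ.image_curve i).symm ▸ hq
      simpa using hr
    have h := X.2 i _ hp (f.comp ⟨φ.toDiffeo, φ.toDiffeo.contMDiff⟩) fun r hr =>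
      hf _ ((φ.image_curve i) ▸ Set.mem_image_of_mem _ hr)
    have e : φ.toDiffeo (φ.toDiffeo.symm q) = q := φ.toDiffeo.apply_symm_apply q
    have hc := mvfderiv_comp_apply_of_eq (I := 𝓡 2) (φ.toDiffeo.symm q)
      (f.mdifferentiableAt (x := q))
      (φ.toDiffeo.contMDiff.mdifferentiable (by simp) (φ.toDiffeo.symm q)) e
      (X.1 (φ.toDiffeo.symm q))
    exact hc.symm.trans h⟩

/-- Pull-back of a `b`-form of degree two by a `b`-diffeomorphism. -/
noncomputable def BDiffeo.pull (φ : BDiffeo D) (η : BBilin D) (X Y : BField D) : SmoothFn S :=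
  (η (φ.push X) (φ.push Y)).comp ⟨φ.toDiffeo, φ.toDiffeo.contMDiff⟩

variable (D) in
/-- A smooth isotopy of `b`-diffeomorphisms starting at the identity. -/
structure BIsotopy where
  at_time : ℝ → BDiffeo D
  smooth : ContMDiff (𝓘(ℝ, ℝ).prod (𝓡 2)) (𝓡 2) ∞
    fun z : ℝ × S => (at_time z.1).toDiffeo z.2
  start : ∀ p, (at_time 0).toDiffeo p = p

/-- Two star log symplectic forms are `b`-symplectomorphic if the end of an isotopy of
`b`-diffeomorphisms, starting at the identity, pulls one back to the other. -/
def BSymplectomorphic (ω₀ ω₁ : LogSymplecticForm D) : Prop :=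
  ∃ γ : BIsotopy D, ∀ X Y, (γ.at_time 1).pull ω₁.form X Y = ω₀.form X Y

end BTangent
end StarLog

/-!
If `ω₁ - ω₀ = dα` and `ω₀ = f ω₁` with `f > 0`, all the forms `(1 - τ) ω₀ + τ ω₁` are nondegenerate,
and Moser's trick applies: the contraction equation `((1 - τ) ω₀ + τ ω₁)(V, ·) = -τ' α` is solved by
the multiple `-τ' / ((1 - τ) f + τ)` of the single `b`-field `v` with `ω₁(v, ·) = α`. Compactness of
the surface integrates `V` to an isotopy, which preserves the curves because `V` is tangent to them.

Conversely, the velocity `V` of an isotopy of `b`-diffeomorphisms is a `b`-field, and Cartan's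
formula exhibits `γ₁^* ω₁ - γ₀^* ω₁` as the differential of the time average of `γₜ^* (ω₁(V, ·))`.
That this average is a smooth `b`-form along the divisor is a matter of dividing by the equations
of the curves through a point, which is possible by Hadamard's lemma. The orientation cannot change
along the isotopy, because `γₜ^* ω₁` never degenerates.

Off the divisor, which is dense, all forms are ordinary differential forms; identities between
smooth functions are verified there.
-/

section PostComposition

universe u
variable {K : Type*} [TopologicalSpace K] [CompactSpace K]
variable {E F : Type u} [NormedAddCommGroup E] [NormedSpace ℝ E] [NormedAddCommGroup F]
  [NormedSpace ℝ F]

variable (K E F) in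
/-- Pointwise application of a continuous family of continuous linear maps to a continuous family
of vectors; it expresses the derivative of post-composition on `C(K, E)`. -/
noncomputable def pointwiseApplyCLM : C(K, E →L[ℝ] F) →L[ℝ] C(K, E) →L[ℝ] C(K, F) :=
  LinearMap.mkContinuous₂
    (LinearMap.mk₂ ℝ
      (fun (A : C(K, E →L[ℝ] F)) (h : C(K, E)) => (⟨fun k => A k (h k), by fun_prop⟩ : C(K, F)))
      (fun A B h => by ext; simp) (fun c A h => by ext; simp)
      (fun A h g => by ext; simp) (fun c A h => by ext; simp)) 1 fun A h => by
    refine (ContinuousMap.norm_le _ (by positivity)).2 fun k => ?_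
    rw [one_mul]
    exact (A k).le_of_opNorm_le_of_le (A.norm_coe_le_norm k) (h.norm_coe_le_norm k)

lemma hasFDerivAt_postcomp {f : C(E, F)} {f' : C(E, E →L[ℝ] F)}
    (hf : ∀ x, HasFDerivAt f (f' x) x) (y : C(K, E)) :
    HasFDerivAt (fun y : C(K, E) => f.comp y) (pointwiseApplyCLM K E F (f'.comp y)) y := by
  rw [hasFDerivAt_iff_isLittleO_nhds_zero, Asymptotics.isLittleO_iff]
  intro ε hε
  obtain ⟨δ, hδ, hf'⟩ := (Metric.continuous_iff (α := C(K, E)) (β := C(K, E →L[ℝ] F))).1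
    (ContinuousMap.continuous_postcomp f') y ε hε
  -- Uniformity in `k`: the constant perturbation `z - y k` of `y` is small in `C(K, E)`.
  have hf'_ball : ∀ k, ∀ z ∈ Metric.ball (y k) δ, ‖f' z - f' (y k)‖ ≤ ε := by
    intro k z hz
    have : Nonempty K := ⟨k⟩
    have hdist : dist (y + ContinuousMap.const K (z - y k)) y < δ := by
      rw [dist_eq_norm, add_sub_cancel_left]
      exact (ContinuousMap.norm_lt_iff _ hδ).2 fun _ => by simpa [dist_eq_norm] using hz
    simpa [dist_eq_norm] using (ContinuousMap.dist_apply_le_dist k).trans (hf' _ hdist).le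
  filter_upwards [Metric.ball_mem_nhds (0 : C(K, E)) hδ] with h hh
  rw [mem_ball_zero_iff] at hh
  refine (ContinuousMap.norm_le _ (by positivity)).2 fun k => ?_
  have hmean := (convex_ball (y k) δ).norm_image_sub_le_of_norm_hasFDerivWithin_le'
    (fun z _ => (hf z).hasFDerivWithinAt) (hf'_ball k) (Metric.mem_ball_self hδ) (y := y k + h k)
    (by simpa [dist_eq_norm] using (h.norm_coe_le_norm k).trans_lt hh)
  rw [add_sub_cancel_left] at hmean
  exact hmean.trans (mul_le_mul_of_nonneg_left (h.norm_coe_le_norm k) hε.le)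

lemma contDiff_postcomp_nat (n : ℕ) : ∀ {F : Type u} [NormedAddCommGroup F] [NormedSpace ℝ F]
    {f : C(E, F)}, ContDiff ℝ n f → ContDiff ℝ n fun y : C(K, E) => f.comp y := by
  induction n with
  | zero => exact fun _ => contDiff_zero.2 (ContinuousMap.continuous_postcomp _)
  | succ n ih =>
    intro F _ _ f hf
    push_cast at hf ⊢
    obtain ⟨hdiff, -, hf'⟩ := contDiff_succ_iff_fderiv.1 hf
    let f' : C(E, E →L[ℝ] F) := ⟨fderiv ℝ f, hf'.continuous⟩
    exact contDiff_succ_iff_hasFDerivAt.2 ⟨_,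
      (pointwiseApplyCLM K E F).contDiff.comp (ih (f := f') hf'),
      hasFDerivAt_postcomp fun x => (hdiff x).hasFDerivAt⟩

lemma contDiff_postcomp {n : ℕ∞} {f : C(E, F)} (hf : ContDiff ℝ n f) :
    ContDiff ℝ n fun y : C(K, E) => f.comp y :=
  contDiff_iff_forall_nat_le.2 fun m hm =>
    contDiff_postcomp_nat m (hf.of_le (by exact_mod_cast hm))

end PostComposition

section ParametricIntegral
open scoped unitInterval

/-- The operator sending a continuous path `y` on the unit interval to `s ↦ ∫ u in 0..s, y u`;
the integrand is extended to `ℝ` by the projection `Set.projIcc` onto the unit interval. -/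
noncomputable def primitiveCLM (E : Type*) [NormedAddCommGroup E] [NormedSpace ℝ E] :
    C(I, E) →L[ℝ] C(I, E) :=
  have hint (y : C(I, E)) (a b : ℝ) : IntervalIntegrable
      (fun u => y (Set.projIcc 0 1 zero_le_one u)) MeasureTheory.volume a b :=
    (y.continuous.comp continuous_projIcc).intervalIntegrable a b
  LinearMap.mkContinuous
    { toFun := fun y => ⟨fun s => ∫ u in (0 : ℝ)..s, y (Set.projIcc 0 1 zero_le_one u),
        (intervalIntegral.continuous_primitive (hint y) 0).comp continuous_subtype_val⟩
      map_add' := fun y z => by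
        ext s
        exact intervalIntegral.integral_add (hint y _ _) (hint z _ _)
      map_smul' := fun c y => by
        ext s
        exact intervalIntegral.integral_smul c _ } 1 fun y => by
    refine (ContinuousMap.norm_le _ (by positivity)).2 fun s => ?_
    refine (intervalIntegral.norm_integral_le_of_norm_le_const (C := ‖y‖)
      fun u _ => y.norm_coe_le_norm _).trans ?_
    rw [one_mul, sub_zero, abs_of_nonneg s.2.1]
    exact mul_le_of_le_one_right (norm_nonneg _) s.2.2

universe u
variable {E F : Type u} [NormedAddCommGroup E] [NormedSpace ℝ E] [NormedAddCommGroup F]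
  [NormedSpace ℝ F]

lemma primitiveCLM_one_eq_integral {y : C(I, E)} {z : ℝ → E} (h : ∀ s : I, y s = z s) :
    primitiveCLM E y 1 = ∫ u in (0 : ℝ)..1, z u := by
  refine intervalIntegral.integral_congr fun u hu => ?_
  rw [Set.Icc.coe_one, Set.uIcc_of_le zero_le_one] at hu
  rw [h, Set.projIcc_of_mem _ hu]

/-- The path `s ↦ (s, x)`; it turns a function of time and a parameter into a path depending on
the parameter. -/
def verticalSegment {X : Type*} [TopologicalSpace X] (x : X) : C(I, ℝ × X) :=
  ⟨fun s => (s, x), by fun_prop⟩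

lemma verticalSegment_eq_add : (verticalSegment (X := E)) = fun x => verticalSegment 0 +
    (ContinuousLinearMap.const ℝ I ∘L ContinuousLinearMap.inr ℝ ℝ E) x := by
  ext x s <;> simp [verticalSegment]

lemma contDiff_verticalSegment {n : WithTop ℕ∞} : ContDiff ℝ n (verticalSegment (X := E)) := by
  rw [verticalSegment_eq_add]
  exact contDiff_const.add (ContinuousLinearMap.contDiff _)

lemma hasFDerivAt_verticalSegment (x : E) : HasFDerivAt (verticalSegment (X := E))
    (ContinuousLinearMap.const ℝ I ∘L ContinuousLinearMap.inr ℝ ℝ E) x := by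
  rw [verticalSegment_eq_add]
  exact (ContinuousLinearMap.hasFDerivAt _).const_add _

lemma integral_eq_primitiveCLM_verticalSegment {X : Type*} [TopologicalSpace X]
    (g : C(ℝ × X, F)) (x : X) :
    ∫ t in (0 : ℝ)..1, g (t, x) =
      (ContinuousMap.evalCLM ℝ (1 : I) ∘L primitiveCLM F) (g.comp (verticalSegment x)) :=
  (primitiveCLM_one_eq_integral (z := fun t => g (t, x)) fun _ => rfl).symm

lemma contDiff_unitInterval_integral {n : ℕ∞} {g : ℝ × E → F} (hg : ContDiff ℝ n g) :
    ContDiff ℝ n fun x => ∫ t in (0 : ℝ)..1, g (t, x) := by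
  lift g to C(ℝ × E, F) using hg.continuous
  simp_rw [integral_eq_primitiveCLM_verticalSegment]
  exact (ContinuousLinearMap.contDiff _).comp
    ((contDiff_postcomp hg).comp contDiff_verticalSegment)

lemma fderiv_unitInterval_integral {g : ℝ × E → F} (hg : ContDiff ℝ 1 g) (x v : E) :
    fderiv ℝ (fun x => ∫ t in (0 : ℝ)..1, g (t, x)) x v =
      ∫ t in (0 : ℝ)..1, fderiv ℝ g (t, x) (0, v) := by
  lift g to C(ℝ × E, F) using hg.continuous
  let g' : C(ℝ × E, ℝ × E →L[ℝ] F) := ⟨fderiv ℝ g, hg.continuous_fderiv one_ne_zero⟩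
  have hg' : ∀ z, HasFDerivAt g (g' z) z := fun z => (hg.differentiable one_ne_zero z).hasFDerivAt
  simp_rw [integral_eq_primitiveCLM_verticalSegment]
  have hcomp := (ContinuousMap.evalCLM ℝ (1 : I) ∘L primitiveCLM F).hasFDerivAt.comp x
    ((hasFDerivAt_postcomp hg' (verticalSegment x)).comp x (hasFDerivAt_verticalSegment x))
  exact (congrArg (· v) hcomp.fderiv).trans
    (primitiveCLM_one_eq_integral (z := fun t => fderiv ℝ g (t, x) (0, v)) fun _ => rfl)

end ParametricIntegral

section Hadamard

variable {E : Type} [NormedAddCommGroup E] [NormedSpace ℝ E]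

lemma exists_apply_eq_one {l : E →L[ℝ] ℝ} (hl : l ≠ 0) : ∃ w, l w = 1 := by
  obtain ⟨w, hw⟩ := DFunLike.ne_iff.1 hl
  exact ⟨(l w)⁻¹ • w, by simpa using inv_mul_cancel₀ hw⟩

/-- Hadamard's lemma for a hyperplane. With `l w = 1` and `q t x = x - (1 - t) l(x) w`, the quotient
is `∫₀¹ ∂_w f (q t x) dt`, because `q` joins a point of the hyperplane to `x`. -/
lemma exists_contDiff_eq_mul_of_eq_zero {f : E → ℝ} (hf : ContDiff ℝ ∞ f) {l : E →L[ℝ] ℝ}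
    (hl : l ≠ 0) (h : ∀ x, l x = 0 → f x = 0) :
    ∃ g : E → ℝ, ContDiff ℝ ∞ g ∧ ∀ x, f x = l x * g x := by
  obtain ⟨w, hw⟩ := exists_apply_eq_one hl
  let q : ℝ × E → E := fun z => z.2 - ((1 - z.1) * l z.2) • w
  have hdf : ContDiff ℝ ∞ fun z : ℝ × E => fderiv ℝ f (q z) w :=
    ((hf.fderiv_right (m := ∞) (by simp)).comp (by fun_prop)).clm_apply contDiff_const
  refine ⟨fun x => ∫ t in (0 : ℝ)..1, fderiv ℝ f (q (t, x)) w,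
    contDiff_unitInterval_integral (n := ⊤) hdf, fun x => ?_⟩
  have hderiv (t : ℝ) :
      HasDerivAt (fun t => f (q (t, x))) (l x * fderiv ℝ f (q (t, x)) w) t := by
    have hq : HasDerivAt (fun t => q (t, x)) (l x • w) t := by
      simpa [q] using
        ((((hasDerivAt_id t).const_sub 1).mul_const (l x)).smul_const w).const_sub x
    have hcomp := (hf.differentiable (by simp) (q (t, x))).hasFDerivAt.comp_hasDerivAt t hq
    rwa [map_smul] at hcomp
  calc
    f x = f (q (1, x)) - f (q (0, x)) := by rw [h (q (0, x)) (by simp [q, hw])]; simp [q]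
    _ = ∫ t in (0 : ℝ)..1, l x * fderiv ℝ f (q (t, x)) w :=
      (intervalIntegral.integral_eq_sub_of_hasDerivAt (fun t _ => hderiv t)
        ((continuous_const.mul (hdf.continuous.comp
          (Continuous.prodMk_left x))).intervalIntegrable 0 1)).symm
    _ = l x * ∫ t in (0 : ℝ)..1, fderiv ℝ f (q (t, x)) w :=
      intervalIntegral.integral_const_mul _ _

lemma eq_zero_of_mul_eq_zero_on_ker {g : E → ℝ} (hg : Continuous g) {l m : E →L[ℝ] ℝ} {w : E}
    (hmw : m w = 0) (hlw : l w = 1) (h : ∀ x, m x = 0 → l x * g x = 0) {x : E} (hx : m x = 0) :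
    g x = 0 := by
  have hdense : Dense {ε : ℝ | ε ≠ -l x} := dense_compl_singleton _
  have hzero : Set.EqOn (fun ε : ℝ => g (x + ε • w)) (fun _ => 0) {ε | ε ≠ -l x} := fun ε hε =>
    (mul_eq_zero.1 (h (x + ε • w) (by simp [hx, hmw]))).resolve_left fun hl =>
      hε (by simpa [hlw] using (neg_eq_of_add_eq_zero_right (by simpa [hlw] using hl)).symm)
  simpa using congrFun (Continuous.ext_on hdense (by fun_prop) continuous_const hzero) 0

lemma exists_contDiff_eq_prod_mul_of_eq_zero {ι : Type*} (s : Finset ι) {l : ι → E →L[ℝ] ℝ}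
    (hl : ∀ i ∈ s, l i ≠ 0)
    (hind : (s : Set ι).Pairwise fun i j => ∃ w, l i w = 0 ∧ l j w = 1)
    {f : E → ℝ} (hf : ContDiff ℝ ∞ f) (h : ∀ i ∈ s, ∀ x, l i x = 0 → f x = 0) :
    ∃ g : E → ℝ, ContDiff ℝ ∞ g ∧ ∀ x, f x = (∏ i ∈ s, l i x) * g x := by
  classical
  induction s using Finset.induction_on generalizing f with
  | empty => exact ⟨f, hf, fun x => by simp⟩
  | insert i s hi ih =>
    rw [Finset.forall_mem_insert] at hl h
    obtain ⟨g, hg, hfg⟩ := exists_contDiff_eq_mul_of_eq_zero hf hl.1 h.1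
    have hg_zero : ∀ j ∈ s, ∀ x, l j x = 0 → g x = 0 := by
      intro j hj x hx
      obtain ⟨w, hjw, hiw⟩ := hind (Finset.mem_insert_of_mem hj) (Finset.mem_insert_self i s)
        (ne_of_mem_of_not_mem hj hi)
      exact eq_zero_of_mul_eq_zero_on_ker hg.continuous hjw hiw
        (fun x hx => (hfg x).symm.trans (h.2 j hj x hx)) hx
    obtain ⟨k, hk, hgk⟩ := ih hl.2 (hind.mono (Finset.coe_subset.2 (Finset.subset_insert i s)))
      hg hg_zero
    exact ⟨k, hk, fun x => by rw [hfg, hgk, Finset.prod_insert hi, mul_assoc]⟩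

end Hadamard

section LocalFlow
open scoped Topology unitInterval

universe u
variable {E : Type u} [NormedAddCommGroup E] [NormedSpace ℝ E]

/-- The equation `y s = x + t ∫₀ˢ f (y u) du` for the solution of `y' = t f(y)`, `y 0 = x` on the
unit interval, written as the vanishing of a map at `((t, x), y)`. Rescaling time by `t` puts the
solutions of all durations into the single Banach space `C(I, E)`. -/
noncomputable def flowDefect (f : C(E, E)) (z : (ℝ × E) × C(I, E)) : C(I, E) :=
  z.2 - ContinuousMap.const I z.1.2 - z.1.1 • primitiveCLM E (f.comp z.2)

lemma flowDefect_eq_zero_iff {f : C(E, E)} {t : ℝ} {x : E} {y : C(I, E)} :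
    flowDefect f ((t, x), y) = 0 ↔
      ∀ s : I, y s = x + t • ∫ u in (0 : ℝ)..s, f (y (Set.projIcc 0 1 zero_le_one u)) := by
  refine ContinuousMap.ext_iff.trans (forall_congr' fun s => ?_)
  change y s - x - t • (∫ u in (0 : ℝ)..s, f (y (Set.projIcc 0 1 zero_le_one u))) = 0 ↔ _
  rw [sub_sub, sub_eq_zero]

lemma flowDefect_zero_left (f : C(E, E)) (x : E) (y : C(I, E)) :
    flowDefect f ((0, x), y) = y - ContinuousMap.const I x := by
  simp [flowDefect]

lemma contDiff_flowDefect {n : ℕ∞} {f : C(E, E)} (hf : ContDiff ℝ n f) :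
    ContDiff ℝ n (flowDefect f) :=
  (contDiff_snd.sub ((ContinuousLinearMap.const ℝ I).contDiff.comp
    (contDiff_snd.comp contDiff_fst))).sub ((contDiff_fst.comp contDiff_fst).smul
      ((primitiveCLM E).contDiff.comp ((contDiff_postcomp hf).comp contDiff_snd)))

/-- Multiplication by `r`, as a self-map of the unit interval. -/
def unitIntervalScale (r : I) : C(I, I) := ⟨fun s => r * s, by fun_prop⟩

lemma flowDefect_scale {f : C(E, E)} {t : ℝ} {x : E} {y : C(I, E)}
    (h : flowDefect f ((t, x), y) = 0) (r : I) :
    flowDefect f ((r * t, x), y.comp (unitIntervalScale r)) = 0 := by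
  rw [flowDefect_eq_zero_iff] at h ⊢
  intro s
  have hsubst : (r : ℝ) • ∫ u in (0 : ℝ)..s, f (y (Set.projIcc 0 1 zero_le_one (r * u))) =
      ∫ u in (0 : ℝ)..(r * s : I), f (y (Set.projIcc 0 1 zero_le_one u)) := by
    simpa using intervalIntegral.smul_integral_comp_mul_left (a := 0) (b := s)
      (fun u => f (y (Set.projIcc 0 1 zero_le_one u))) (r : ℝ)
  change y (r * s) = _
  rw [h, mul_comm (r : ℝ) t, mul_smul, ← hsubst]
  congr 3
  refine intervalIntegral.integral_congr fun u hu => ?_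
  rw [Set.uIcc_of_le s.2.1] at hu
  have hu1 : u ∈ I := ⟨hu.1, hu.2.trans s.2.2⟩
  change _ = f (y (r * Set.projIcc 0 1 zero_le_one u))
  rw [Set.projIcc_of_mem _ hu1, Set.projIcc_of_mem _ (unitInterval.mul_mem r.2 hu1)]
  rfl

lemma isInvertible_fderiv_flowDefect {f : C(E, E)} (hf : ContDiff ℝ 1 f) (x₀ : E) :
    (fderiv ℝ (flowDefect f) ((0, x₀), ContinuousMap.const I x₀) ∘L
      .inr ℝ (ℝ × E) C(I, E)).IsInvertible := by
  set y₀ := ContinuousMap.const I x₀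
  have hpartial : HasFDerivAt (fun y : C(I, E) => flowDefect f ((0, x₀), y))
      (fderiv ℝ (flowDefect f) ((0, x₀), y₀) ∘L .inr ℝ (ℝ × E) C(I, E)) y₀ :=
    ((contDiff_flowDefect (n := 1) hf).differentiable one_ne_zero _).hasFDerivAt.comp y₀
      (hasFDerivAt_prodMk_right _ y₀)
  have hid : HasFDerivAt (fun y : C(I, E) => flowDefect f ((0, x₀), y))
      (ContinuousLinearMap.id ℝ C(I, E)) y₀ := by
    simp_rw [flowDefect_zero_left]
    exact (hasFDerivAt_id y₀).sub_const y₀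
  rw [hpartial.unique hid]
  exact ⟨ContinuousLinearEquiv.refl ℝ _, rfl⟩

lemma exists_contDiffAt_flowDefect_eq_zero [CompleteSpace E] {n : ℕ} (hn : n ≠ 0)
    {f : C(E, E)} (hf : ContDiff ℝ n f) (x₀ : E) :
    ∃ ψ : ℝ × E → C(I, E), ContDiffAt ℝ n ψ (0, x₀) ∧ ψ (0, x₀) = ContinuousMap.const I x₀ ∧
      (∀ᶠ z in 𝓝 (0, x₀), flowDefect f (z, ψ z) = 0) ∧
      ∀ᶠ v in 𝓝 ((0, x₀), ContinuousMap.const I x₀), flowDefect f v = 0 → ψ v.1 = v.2 := by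
  have hn' : (n : WithTop ℕ∞) ≠ 0 := by exact_mod_cast hn
  have hF := (contDiff_flowDefect (n := n) hf).contDiffAt (x := ((0, x₀), ContinuousMap.const I x₀))
  have hF0 : flowDefect f ((0, x₀), ContinuousMap.const I x₀) = 0 := by
    rw [flowDefect_zero_left, sub_self]
  have hinv := isInvertible_fderiv_flowDefect
    (hf.of_le (by exact_mod_cast Nat.one_le_iff_ne_zero.2 hn)) x₀
  refine ⟨hF.implicitFunction hn' hinv, hF.contDiffAt_implicitFunction hn' hinv,
    hF.implicitFunction_apply_self hn' hinv, ?_, ?_⟩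
  · simpa only [hF0] using hF.eventually_apply_implicitFunction hn' hinv
  · filter_upwards [hF.eventually_apply_eq_iff_implicitFunction hn' hinv] with v hv h
    exact hv.1 (h.trans hF0.symm)

lemma eventually_forall_unitIntervalScale {f : C(E, E)} {x₀ : E} {ψ : ℝ × E → C(I, E)}
    (hψ : ContinuousAt ψ (0, x₀)) (hψ₀ : ψ (0, x₀) = ContinuousMap.const I x₀)
    (hsol : ∀ᶠ z in 𝓝 (0, x₀), flowDefect f (z, ψ z) = 0)
    (huniq : ∀ᶠ v in 𝓝 ((0, x₀), ContinuousMap.const I x₀), flowDefect f v = 0 → ψ v.1 = v.2) :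
    ∀ᶠ z : ℝ × E in 𝓝 (0, x₀), ∀ r : I,
      ψ (r * z.1, z.2) = (ψ z).comp (unitIntervalScale r) := by
  obtain ⟨δ, hδ, huniq⟩ := Metric.eventually_nhds_iff.1 huniq
  have hnear : ∀ᶠ z in 𝓝 (0, x₀), dist (ψ z) (ContinuousMap.const I x₀) < δ :=
    (hψ₀ ▸ hψ.tendsto).eventually (Metric.ball_mem_nhds _ hδ)
  filter_upwards [hsol, hnear, Metric.ball_mem_nhds _ hδ] with z hz hz_near hz_ball r
  rw [Metric.mem_ball, Prod.dist_eq, max_lt_iff] at hz_ball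
  refine huniq (y := ((r * z.1, z.2), (ψ z).comp (unitIntervalScale r))) ?_ (flowDefect_scale hz r)
  simp only [Prod.dist_eq, max_lt_iff]
  refine ⟨⟨?_, hz_ball.2⟩, ?_⟩
  · have hz1 := hz_ball.1
    simp only [dist_zero_right, norm_mul, Real.norm_of_nonneg r.2.1] at hz1 ⊢
    exact (mul_le_of_le_one_left (norm_nonneg _) r.2.2).trans_lt hz1
  · refine lt_of_le_of_lt ((ContinuousMap.dist_le dist_nonneg).2 fun s => ?_) hz_near
    exact ContinuousMap.dist_apply_le_dist (g := ContinuousMap.const I x₀) (r * s)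

lemma apply_one_eq_add_integral {f : C(E, E)} {ψ : ℝ × E → C(I, E)} {t : ℝ} {x : E}
    (hsol : flowDefect f ((t, x), ψ (t, x)) = 0)
    (hscale : ∀ r : I, ψ (r * t, x) = (ψ (t, x)).comp (unitIntervalScale r)) :
    ψ (t, x) 1 = x + ∫ v in (0 : ℝ)..t, f (ψ (v, x) 1) := by
  have hsubst : t • ∫ u in (0 : ℝ)..1, f (ψ (u * t, x) 1) =
      ∫ v in (0 : ℝ)..t, f (ψ (v, x) 1) := by
    simpa using intervalIntegral.smul_integral_comp_mul_right (a := 0) (b := 1)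
      (fun v => f (ψ (v, x) 1)) t
  rw [flowDefect_eq_zero_iff.1 hsol 1, ← hsubst]
  congr 2
  refine intervalIntegral.integral_congr fun u hu => ?_
  rw [Set.Icc.coe_one, Set.uIcc_of_le zero_le_one] at hu
  have hu_scale := congrArg (· 1) (hscale ⟨u, hu⟩)
  simp only [ContinuousMap.comp_apply, unitIntervalScale, ContinuousMap.coe_mk, mul_one] at hu_scale
  simp only [Set.projIcc_of_mem _ hu, hu_scale]

lemma hasDerivAt_of_eq_add_integral [CompleteSpace E] {y g : ℝ → E} {x : E} {η : ℝ}
    (hg : ContinuousOn g (Metric.ball 0 η))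
    (hy : ∀ t ∈ Metric.ball (0 : ℝ) η, y t = x + ∫ v in (0 : ℝ)..t, g v)
    {t : ℝ} (ht : t ∈ Metric.ball (0 : ℝ) η) : HasDerivAt y (g t) t := by
  have hsub : Set.uIcc 0 t ⊆ Metric.ball (0 : ℝ) η :=
    (convex_ball (0 : ℝ) η).ordConnected.uIcc_subset
      (Metric.mem_ball_self (dist_nonneg.trans_lt ht)) ht
  have hderiv := intervalIntegral.integral_hasDerivAt_right (hg.mono hsub).intervalIntegrable
    (hg.stronglyMeasurableAtFilter Metric.isOpen_ball t ht)
    (hg.continuousAt (Metric.isOpen_ball.mem_nhds ht))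
  exact (hderiv.const_add x).congr_of_eventuallyEq
    (Filter.eventually_of_mem (Metric.isOpen_ball.mem_nhds ht) hy)

lemma exists_contDiffAt_localFlow_of_contDiff [CompleteSpace E] {n : ℕ} (hn : n ≠ 0)
    {f : E → E} (hf : ContDiff ℝ n f) (x₀ : E) :
    ∃ Φ : ℝ × E → E, ContDiffAt ℝ n Φ (0, x₀) ∧ (∀ᶠ x in 𝓝 x₀, Φ (0, x) = x) ∧
      ∀ᶠ z in 𝓝 ((0 : ℝ), x₀), HasDerivAt (fun t => Φ (t, z.2)) (f (Φ z)) z.1 := by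
  lift f to C(E, E) using hf.continuous
  obtain ⟨ψ, hψ, hψ₀, hsol, huniq⟩ := exists_contDiffAt_flowDefect_eq_zero hn hf x₀
  let Φ : ℝ × E → E := fun z => ψ z 1
  have hΦ : ContDiffAt ℝ n Φ (0, x₀) :=
    (ContinuousMap.evalCLM ℝ (1 : I) : C(I, E) →L[ℝ] E).contDiff.contDiffAt.comp (0, x₀) hψ
  have hcont : ∀ᶠ z in 𝓝 (0, x₀), ContinuousAt Φ z :=
    (hΦ.eventually (by simp)).mono fun z hz => hz.continuousAt
  have hint : ∀ᶠ z : ℝ × E in 𝓝 (0, x₀), Φ z = z.2 + ∫ v in (0 : ℝ)..z.1, f (Φ (v, z.2)) := by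
    filter_upwards [hsol, eventually_forall_unitIntervalScale hψ.continuousAt hψ₀ hsol huniq]
      with z hz hz_scale using apply_one_eq_add_integral hz hz_scale
  obtain ⟨η, hη, hball⟩ := Metric.eventually_nhds_iff_ball.1 (hint.and hcont)
  simp only [← ball_prod_same, Set.mem_prod, Prod.forall] at hball
  refine ⟨Φ, hΦ, ?_, ?_⟩
  · filter_upwards [Metric.ball_mem_nhds x₀ hη] with x hx
    simpa using (hball 0 x ⟨Metric.mem_ball_self hη, hx⟩).1
  · filter_upwards [Metric.ball_mem_nhds ((0 : ℝ), x₀) hη] with ⟨t, x⟩ hz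
    rw [← ball_prod_same] at hz
    have hΦ_cont : ContinuousOn (fun v => f (Φ (v, x))) (Metric.ball 0 η) := fun v hv =>
      (f.continuous.continuousAt.comp (ContinuousAt.comp (f := fun v : ℝ => (v, x))
        (hball v x ⟨hv, hz.2⟩).2 (by fun_prop))).continuousWithinAt
    exact hasDerivAt_of_eq_add_integral hΦ_cont (fun v hv => (hball v x ⟨hv, hz.2⟩).1) hz.1

lemma exists_contDiff_eventuallyEq [HasContDiffBump E] {n : ℕ} {f : E → E} {x₀ : E}
    (hf : ContDiffAt ℝ n f x₀) : ∃ g : E → E, ContDiff ℝ n g ∧ g =ᶠ[𝓝 x₀] f := by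
  obtain ⟨ε, hε, hball⟩ := Metric.eventually_nhds_iff_ball.1 (hf.eventually (by simp))
  let χ : ContDiffBump x₀ := ⟨ε / 3, ε / 2, by positivity, by linarith⟩
  refine ⟨fun x => χ x • f x, contDiff_iff_contDiffAt.2 fun x => ?_, ?_⟩
  · by_cases hx : x ∈ tsupport χ
    · rw [χ.tsupport_eq] at hx
      exact χ.contDiff.contDiffAt.smul
        (hball x (Metric.closedBall_subset_ball (half_lt_self hε) hx))
    · refine (contDiffAt_const (c := (0 : E))).congr_of_eventuallyEq ?_
      filter_upwards [notMem_tsupport_iff_eventuallyEq.1 hx] with z hz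
      simp [hz]
  · filter_upwards [χ.eventuallyEq_one] with x hx
    simp [hx]

lemma exists_contDiffAt_localFlow [HasContDiffBump E] [CompleteSpace E] {n : ℕ} (hn : n ≠ 0)
    {f : E → E} {x₀ : E} (hf : ContDiffAt ℝ n f x₀) :
    ∃ Φ : ℝ × E → E, ContDiffAt ℝ n Φ (0, x₀) ∧ (∀ᶠ x in 𝓝 x₀, Φ (0, x) = x) ∧
      ∀ᶠ z in 𝓝 ((0 : ℝ), x₀), HasDerivAt (fun t => Φ (t, z.2)) (f (Φ z)) z.1 := by
  obtain ⟨g, hg, hgf⟩ := exists_contDiff_eventuallyEq hf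
  obtain ⟨Φ, hΦ, hΦ₀, hflow⟩ := exists_contDiffAt_localFlow_of_contDiff hn hg x₀
  refine ⟨Φ, hΦ, hΦ₀, ?_⟩
  have htendsto : Filter.Tendsto Φ (𝓝 (0, x₀)) (𝓝 x₀) := by
    simpa only [hΦ₀.self_of_nhds] using hΦ.continuousAt.tendsto
  filter_upwards [hflow, htendsto.eventually hgf] with z hz hz_eq using hz_eq ▸ hz

end LocalFlow

section ManifoldFlow
open scoped Topology

variable {E : Type*} [NormedAddCommGroup E] [NormedSpace ℝ E]
  {H : Type*} [TopologicalSpace H] {I : ModelWithCorners ℝ E H}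
  {M : Type*} [TopologicalSpace M] [ChartedSpace H M]

lemma mfderiv_extChartAt_eq_tangentCoordChange [IsManifold I 1 M] {x y : M}
    (h : x ∈ (extChartAt I y).source) :
    mfderiv I 𝓘(ℝ, E) (extChartAt I y) x = tangentCoordChange I x y x :=
  (mdifferentiableAt_extChartAt (by simpa only [extChartAt_source] using h)).mfderiv

variable [I.Boundaryless]

lemma hasMFDerivAt_extChartAt_symm_comp [IsManifold I 1 M] {x₀ : M} {f : ℝ → E} {t : ℝ}
    (hmem : f t ∈ (extChartAt I x₀).target)
    {w : TangentSpace I ((extChartAt I x₀).symm (f t))}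
    (hf : HasDerivAt f (tangentCoordChange I ((extChartAt I x₀).symm (f t)) x₀
      ((extChartAt I x₀).symm (f t)) w) t) :
    HasMFDerivAt 𝓘(ℝ, ℝ) I (fun s => (extChartAt I x₀).symm (f s)) t
      ((1 : ℝ →L[ℝ] ℝ).smulRight w) := by
  have hsource := (extChartAt I x₀).map_target hmem
  have hsymm : HasMFDerivAt 𝓘(ℝ, E) I (extChartAt I x₀).symm (f t)
      (mfderiv 𝓘(ℝ, E) I (extChartAt I x₀).symm (f t)) :=
    (((contMDiffOn_extChartAt_symm x₀).contMDiffAt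
      ((isOpen_extChartAt_target x₀).mem_nhds hmem)).mdifferentiableAt one_ne_zero).hasMFDerivAt
  have hinv := congrArg (· w)
    (mfderivWithin_extChartAt_symm_comp_mfderiv_extChartAt (I := I) hmem)
  rw [I.range_eq_univ, mfderivWithin_univ, mfderiv_extChartAt_eq_tangentCoordChange hsource] at hinv
  refine (hsymm.comp t hf.hasFDerivAt.hasMFDerivAt).congr_mfderiv (ContinuousLinearMap.ext_ring ?_)
  exact (congrArg _ (one_smul ℝ _)).trans (hinv.trans (one_smul ℝ w).symm)

lemma contMDiffAt_extChartAt_symm_comp [IsManifold I ∞ M] {n : ℕ∞} {x₀ : M} {φ : ℝ × E → E}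
    (hφ : ContDiffAt ℝ n φ (0, extChartAt I x₀ x₀))
    (hφ₀ : φ (0, extChartAt I x₀ x₀) = extChartAt I x₀ x₀) :
    ContMDiffAt (𝓘(ℝ, ℝ).prod I) I n
      (fun z : ℝ × M => (extChartAt I x₀).symm (φ (z.1, extChartAt I x₀ z.2))) (0, x₀) := by
  have : IsManifold I n M := IsManifold.of_le (n := ∞) (by exact_mod_cast le_top)
  have hsymm : ContMDiffAt 𝓘(ℝ, E) I n (extChartAt I x₀).symm (φ (0, extChartAt I x₀ x₀)) := by
    rw [hφ₀]
    exact (contMDiffOn_extChartAt_symm x₀).contMDiffAt (extChartAt_target_mem_nhds x₀)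
  have hchart : ContMDiffAt (𝓘(ℝ, ℝ).prod I) 𝓘(ℝ, ℝ × E) n
      (fun z : ℝ × M => (z.1, extChartAt I x₀ z.2)) (0, x₀) :=
    contMDiffAt_fst.prodMk_space (contMDiffAt_extChartAt.comp (0, x₀) contMDiffAt_snd)
  exact ContMDiffAt.comp (0, x₀) hsymm
    (ContMDiffAt.comp (g := φ) (0, x₀) hφ.contMDiffAt hchart)

variable {v : (x : M) → TangentSpace I x}

lemma exists_contMDiffAt_localFlow [CompleteSpace E] [HasContDiffBump E] [IsManifold I ∞ M]
    {n : ℕ} (hn : n ≠ 0) {x₀ : M}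
    (hv : ContMDiffAt I I.tangent n (fun x => (⟨x, v x⟩ : TangentBundle I M)) x₀) :
    ∃ Φ : ℝ × M → M, ContMDiffAt (𝓘(ℝ, ℝ).prod I) I n Φ (0, x₀) ∧
      (∀ᶠ x in 𝓝 x₀, Φ (0, x) = x) ∧
      ∀ᶠ z in 𝓝 ((0 : ℝ), x₀), HasMFDerivAt 𝓘(ℝ, ℝ) I (fun t => Φ (t, z.2)) z.1
        ((1 : ℝ →L[ℝ] ℝ).smulRight (v (Φ z))) := by
  have : IsManifold I 1 M := IsManifold.of_le (n := ∞) (by simp)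
  set e := extChartAt I x₀
  obtain ⟨φ, hφ, hφ₀, hflow⟩ := exists_contDiffAt_localFlow hn
    ((contMDiffAt_iff.1 hv).2.contDiffAt
      (range_mem_nhds_isInteriorPoint BoundarylessManifold.isInteriorPoint)).snd
  have hmem : ∀ᶠ z in 𝓝 (0, e x₀), φ z ∈ e.target :=
    hφ.continuousAt.eventually (by
      rw [hφ₀.self_of_nhds]
      exact extChartAt_target_mem_nhds x₀)
  have hchart : Filter.Tendsto (fun z : ℝ × M => (z.1, e z.2)) (𝓝 (0, x₀)) (𝓝 (0, e x₀)) :=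
    continuousAt_fst.tendsto.prodMk_nhds
      ((continuousAt_extChartAt x₀).tendsto.comp continuousAt_snd)
  refine ⟨fun z => e.symm (φ (z.1, e z.2)),
    contMDiffAt_extChartAt_symm_comp (n := n) hφ hφ₀.self_of_nhds, ?_, ?_⟩
  · filter_upwards [(continuousAt_extChartAt x₀).eventually hφ₀,
      extChartAt_source_mem_nhds (I := I) x₀] with x hx hx_source
    exact (congrArg e.symm hx).trans (e.left_inv hx_source)
  · filter_upwards [hchart.eventually (hflow.and hmem)] with z hz
    exact hasMFDerivAt_extChartAt_symm_comp hz.2 hz.1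

lemma exists_localFlow_box [CompleteSpace E] [HasContDiffBump E] [IsManifold I ∞ M]
    {n : ℕ} (hn : n ≠ 0) (hv : ContMDiff I I.tangent n (fun x => (⟨x, v x⟩ : TangentBundle I M)))
    (x₀ : M) :
    ∃ Φ : ℝ × M → M, ∃ ε > 0, ∃ U ∈ 𝓝 x₀,
      (∀ s x, |s| < ε → x ∈ U → ContMDiffAt (𝓘(ℝ, ℝ).prod I) I n Φ (s, x)) ∧
      ∀ x ∈ U, Φ (0, x) = x ∧ IsMIntegralCurveOn (fun t => Φ (t, x)) v (Set.Ioo (-ε) ε) := by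
  have : IsManifold I n M := IsManifold.of_le (n := ∞) (by exact_mod_cast le_top)
  obtain ⟨Φ, hΦ, hΦ₀, hflow⟩ := exists_contMDiffAt_localFlow hn (hv x₀)
  have hsmooth : ∀ᶠ z in 𝓝 ((0 : ℝ), x₀), ContMDiffAt (𝓘(ℝ, ℝ).prod I) I n Φ z :=
    (contMDiffAt_iff_contMDiffAt_nhds (by simp)).1 hΦ
  obtain ⟨P, hP, Q, hQ, hPQ⟩ :=
    Filter.eventually_prod_iff.1 (nhds_prod_eq (X := ℝ) (Y := M) ▸ hflow.and hsmooth)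
  obtain ⟨ε, hε, hPε⟩ := Metric.eventually_nhds_iff.1 hP
  refine ⟨Φ, ε, hε, {x | Q x ∧ Φ (0, x) = x}, hQ.and hΦ₀,
    fun s x hs hx => (hPQ (hPε (by simpa using hs)) hx.1).2,
    fun x hx => ⟨hx.2, fun t ht => ?_⟩⟩
  exact (hPQ (hPε (by simpa [abs_lt] using ht)) hx.1).1.hasMFDerivWithinAt

lemma exists_isMIntegralCurveOn_Ioo_of_isCompact [CompleteSpace E] [HasContDiffBump E]
    [IsManifold I ∞ M] (hv : ContMDiff I I.tangent 1 (fun x => (⟨x, v x⟩ : TangentBundle I M)))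
    {K : Set M} (hK : IsCompact K) :
    ∃ ε > 0, ∀ x ∈ K, ∃ c : ℝ → M, c 0 = x ∧ IsMIntegralCurveOn c v (Set.Ioo (-ε) ε) := by
  suffices h : ∀ᶠ ε : ℝ in 𝓝[>] 0, ∀ x ∈ K, ∃ c : ℝ → M, c 0 = x ∧
      IsMIntegralCurveOn c v (Set.Ioo (-ε) ε) from
    (eventually_mem_nhdsWithin.and h).exists
  refine hK.induction_on (by simp) (fun s t hst h => h.mono fun ε hε x hx => hε x (hst hx))
    (fun s t hs ht => ?_) fun x _ => ?_
  · filter_upwards [hs, ht] with ε hεs hεt x hx using hx.elim (hεs x) (hεt x)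
  · obtain ⟨Φ, ε, hε, U, hU, -, hcurve⟩ := exists_localFlow_box (n := 1) one_ne_zero hv x
    refine ⟨U, nhdsWithin_le_nhds hU, ?_⟩
    filter_upwards [Ioo_mem_nhdsGT hε] with δ hδ y hy
    exact ⟨fun t => Φ (t, y), (hcurve y hy).1,
      (hcurve y hy).2.mono (Set.Ioo_subset_Ioo (neg_le_neg hδ.2.le) hδ.2.le)⟩

lemma apply_eq_of_isMIntegralCurveOn_Ioo [CompleteSpace E] [IsManifold I 1 M] [T2Space M]
    (hv : ContMDiff I I.tangent 1 (fun x => (⟨x, v x⟩ : TangentBundle I M)))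
    {γ φ : ℝ → M} {ε s t : ℝ} (hγ : IsMIntegralCurve γ v)
    (hφ : IsMIntegralCurveOn φ v (Set.Ioo (-ε) ε)) (h₀ : φ 0 = γ t) (hs : |s - t| < ε) :
    γ s = φ (s - t) := by
  have hε : 0 < ε := (abs_nonneg _).trans_lt hs
  simpa using isMIntegralCurveOn_Ioo_eqOn_of_contMDiff_boundaryless (t₀ := 0)
    ⟨by linarith, hε⟩ hv ((hγ.comp_add t).isMIntegralCurveOn _) hφ (by simp [h₀]) (abs_lt.1 hs)

lemma flow_add [CompleteSpace E] [IsManifold I 1 M] [T2Space M] {Γ : ℝ × M → M}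
    (hv : ContMDiff I I.tangent 1 (fun x => (⟨x, v x⟩ : TangentBundle I M)))
    (hΓ₀ : ∀ x, Γ (0, x) = x) (hΓ : ∀ x, IsMIntegralCurve (fun t => Γ (t, x)) v) (s t : ℝ) (x : M) :
    Γ (s + t, x) = Γ (s, Γ (t, x)) :=
  congrFun (isMIntegralCurve_Ioo_eq_of_contMDiff_boundaryless (t₀ := 0) hv ((hΓ x).comp_add t)
    (hΓ (Γ (t, x))) (by simp [hΓ₀])) s

section CompleteFlow

variable [CompleteSpace E] [HasContDiffBump E] [IsManifold I ∞ M] [T2Space M] {Γ : ℝ × M → M}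

lemma exists_forall_contMDiffAt_of_slice {n : ℕ} (hn : n ≠ 0)
    (hv : ContMDiff I I.tangent n (fun x => (⟨x, v x⟩ : TangentBundle I M)))
    (hΓ : ∀ x, IsMIntegralCurve (fun t => Γ (t, x)) v) (p : M) (t₀ : ℝ) :
    ∃ δ > 0, ∀ t ∈ Metric.ball t₀ δ, ContMDiffAt I I n (fun x => Γ (t, x)) p →
      ∀ t' ∈ Metric.ball t₀ δ, ContMDiffAt (𝓘(ℝ, ℝ).prod I) I n Γ (t', p) := by
  have : IsManifold I 1 M := IsManifold.of_le (n := ∞) (by simp)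
  obtain ⟨Φ, ε, hε, U, hU, hΦ, hcurve⟩ := exists_localFlow_box hn hv (Γ (t₀, p))
  obtain ⟨δ, hδ, hδU⟩ := Metric.eventually_nhds_iff_ball.1
    ((hΓ p).continuous.continuousAt.eventually (eventually_mem_nhds_iff.2 hU))
  refine ⟨min δ (ε / 2), by positivity, fun t ht hslice t' ht' => ?_⟩
  have htt' : |t' - t| < ε := by
    have hlt := (Metric.mem_ball.1 ht).trans_le (min_le_right _ _)
    have hlt' := (Metric.mem_ball.1 ht').trans_le (min_le_right _ _)
    rw [← Real.dist_eq]
    linarith [dist_triangle_right t' t t₀]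
  have hUt : U ∈ 𝓝 (Γ (t, p)) := hδU t (Metric.ball_subset_ball (min_le_left _ _) ht)
  have hslice' : ContMDiffAt (𝓘(ℝ, ℝ).prod I) I n (fun z : ℝ × M => Γ (t, z.2)) (t', p) :=
    ContMDiffAt.comp (g := fun x => Γ (t, x)) (t', p) hslice contMDiffAt_snd
  have heq : Γ =ᶠ[𝓝 (t', p)] fun z => Φ (z.1 - t, Γ (t, z.2)) := by
    have hclose : ∀ᶠ z : ℝ × M in 𝓝 (t', p), |z.1 - t| < ε :=
      (by fun_prop : Continuous fun z : ℝ × M => |z.1 - t|).continuousAt.eventually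
        (gt_mem_nhds htt')
    filter_upwards [hclose, hslice'.continuousAt.eventually hUt] with z hz hzU
    exact apply_eq_of_isMIntegralCurveOn_Ioo
      (hv.of_le (by exact_mod_cast Nat.one_le_iff_ne_zero.2 hn)) (hΓ z.2) (hcurve _ hzU).2
      (hcurve _ hzU).1 hz
  exact (ContMDiffAt.comp (t', p) (hΦ _ _ htt' (mem_of_mem_nhds hUt))
    ((contMDiffAt_fst.sub contMDiffAt_const).prodMk hslice')).congr_of_eventuallyEq heq

lemma contMDiff_flow_nat {n : ℕ} (hn : n ≠ 0)
    (hv : ContMDiff I I.tangent n (fun x => (⟨x, v x⟩ : TangentBundle I M)))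
    (hΓ₀ : ∀ x, Γ (0, x) = x) (hΓ : ∀ x, IsMIntegralCurve (fun t => Γ (t, x)) v) :
    ContMDiff (𝓘(ℝ, ℝ).prod I) I n Γ := by
  rintro ⟨t₁, p⟩
  choose δ hδ hstep using exists_forall_contMDiffAt_of_slice hn hv hΓ p
  have hslice : ∀ t, ContMDiffAt (𝓘(ℝ, ℝ).prod I) I n Γ (t, p) →
      ContMDiffAt I I n (fun x => Γ (t, x)) p := fun t h =>
    ContMDiffAt.comp (g := Γ) p h (contMDiffAt_const.prodMk contMDiffAt_id)
  have hclopen : IsClopen {t | ContMDiffAt I I n (fun x => Γ (t, x)) p} := by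
    refine ⟨⟨Metric.isOpen_iff.2 fun t₀ ht₀ => ?_⟩, Metric.isOpen_iff.2 fun t₀ ht₀ => ?_⟩
    · exact ⟨δ t₀, hδ t₀, fun t ht hmem => ht₀
        (hslice t₀ (hstep t₀ t ht hmem t₀ (Metric.mem_ball_self (hδ t₀))))⟩
    · exact ⟨δ t₀, hδ t₀, fun t ht =>
        hslice t (hstep t₀ t₀ (Metric.mem_ball_self (hδ t₀)) ht₀ t ht)⟩
  have huniv : {t | ContMDiffAt I I n (fun x => Γ (t, x)) p} = Set.univ :=
    hclopen.eq_univ ⟨0, show ContMDiffAt I I n (fun x => Γ (0, x)) p by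
      simp_rw [hΓ₀]
      exact contMDiffAt_id⟩
  have ht₁ := Metric.mem_ball_self (x := t₁) (hδ t₁)
  exact hstep t₁ t₁ ht₁ (huniv.ge (Set.mem_univ t₁)) t₁ ht₁

theorem contMDiff_flow (hv : ContMDiff I I.tangent ∞ (fun x => (⟨x, v x⟩ : TangentBundle I M)))
    (hΓ₀ : ∀ x, Γ (0, x) = x) (hΓ : ∀ x, IsMIntegralCurve (fun t => Γ (t, x)) v) :
    ContMDiff (𝓘(ℝ, ℝ).prod I) I ∞ Γ :=
  contMDiff_infty.2 fun n =>
    (contMDiff_flow_nat n.succ_ne_zero (hv.of_le (by exact_mod_cast le_top)) hΓ₀ hΓ).of_le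
      (by exact_mod_cast Nat.le_succ n)

end CompleteFlow

end ManifoldFlow

lemma contDiff_mul_of_tsupport_subset {E : Type*} [NormedAddCommGroup E] [NormedSpace ℝ E]
    {n : WithTop ℕ∞} {χ f : E → ℝ} {U : Set E} (hχ : ContDiff ℝ n χ) (hU : IsOpen U)
    (hsub : tsupport χ ⊆ U) (hf : ContDiffOn ℝ n f U) : ContDiff ℝ n fun x => χ x * f x :=
  (contMDiff_of_tsupport fun _ hx =>
    (hχ.contDiffAt.mul (hf.contDiffAt
      (hU.mem_nhds (hsub (tsupport_mul_subset_left hx))))).contMDiffAt).contDiff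

lemma exists_contDiff_cutoff {E : Type*} [NormedAddCommGroup E] [NormedSpace ℝ E]
    [HasContDiffBump E] {x : E} {U : Set E} (hU : U ∈ nhds x) :
    ∃ χ : E → ℝ, ContDiff ℝ ∞ χ ∧ χ =ᶠ[nhds x] 1 ∧ tsupport χ ⊆ U := by
  obtain ⟨ε, hε, hεU⟩ := Metric.nhds_basis_closedBall.mem_iff.1 hU
  let χ : ContDiffBump x := ⟨ε / 2, ε, by positivity, by linarith⟩
  exact ⟨χ, χ.contDiff, χ.eventuallyEq_one, by rwa [χ.tsupport_eq]⟩

namespace StarLog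
open scoped Topology

section Charts

variable {E : Type*} [NormedAddCommGroup E] [NormedSpace ℝ E]
  {M : Type*} [TopologicalSpace M] [ChartedSpace E M]
  {φ : OpenPartialHomeomorph M E}

lemma mdifferentiable_of_mem_maximalAtlas (hφ : φ ∈ IsManifold.maximalAtlas 𝓘(ℝ, E) ∞ M) :
    φ.MDifferentiable 𝓘(ℝ, E) 𝓘(ℝ, E) :=
  ⟨(contMDiffOn_of_mem_maximalAtlas hφ).mdifferentiableOn (by simp),
    (contMDiffOn_symm_of_mem_maximalAtlas hφ).mdifferentiableOn (by simp)⟩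

lemma mvfderiv_eq_fderiv_chart (hφ : φ ∈ IsManifold.maximalAtlas 𝓘(ℝ, E) ∞ M) {q : M}
    (hq : q ∈ φ.source) {f : M → ℝ} (hf : MDifferentiableAt 𝓘(ℝ, E) 𝓘(ℝ, ℝ) f q)
    (v : TangentSpace 𝓘(ℝ, E) q) :
    mvfderiv 𝓘(ℝ, E) f q v =
      fderiv ℝ (f ∘ φ.symm) (φ q) (mvfderiv 𝓘(ℝ, E) φ q v) := by
  have hmd := mdifferentiable_of_mem_maximalAtlas hφ
  have hread : MDifferentiableAt 𝓘(ℝ, E) 𝓘(ℝ, ℝ) (f ∘ φ.symm) (φ q) :=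
    MDifferentiableAt.comp (φ q) (by rwa [φ.left_inv hq])
      (hmd.mdifferentiableAt_symm (φ.map_source hq))
  have hcomp := hread.hasMFDerivAt.comp q (hmd.mdifferentiableAt hq).hasMFDerivAt
  have hderiv := (hcomp.congr_of_eventuallyEq (f₁ := f) (by
    filter_upwards [φ.open_source.mem_nhds hq] with r hr
    simp [φ.left_inv hr])).mfderiv
  change mfderiv 𝓘(ℝ, E) 𝓘(ℝ, ℝ) f q v = _
  rw [hderiv, mfderiv_eq_fderiv]
  rfl

lemma bijective_mvfderiv_chart (hφ : φ ∈ IsManifold.maximalAtlas 𝓘(ℝ, E) ∞ M) {q : M}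
    (hq : q ∈ φ.source) : Function.Bijective (mvfderiv 𝓘(ℝ, E) φ q) :=
  (mdifferentiable_of_mem_maximalAtlas hφ).mfderiv_bijective hq

lemma exists_vectorField_of_chart [CompleteSpace E] [IsManifold 𝓘(ℝ, E) ∞ M]
    (hφ : φ ∈ IsManifold.maximalAtlas 𝓘(ℝ, E) ∞ M) {w : E → E} (hw : ContDiff ℝ ∞ w) :
    ∃ Z : (q : M) → TangentSpace 𝓘(ℝ, E) q,
      ContMDiffOn 𝓘(ℝ, E) 𝓘(ℝ, E).tangent ∞
        (fun q => (⟨q, Z q⟩ : TangentBundle 𝓘(ℝ, E) M)) φ.source ∧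
      ∀ q ∈ φ.source, mvfderiv 𝓘(ℝ, E) φ q (Z q) = w (φ q) := by
  have hinv : ∀ q ∈ φ.source, (mfderiv 𝓘(ℝ, E) 𝓘(ℝ, E) φ q).IsInvertible := fun q hq =>
    ⟨(mdifferentiable_of_mem_maximalAtlas hφ).mfderiv hq, rfl⟩
  have hw' : ContMDiff 𝓘(ℝ, E) 𝓘(ℝ, E).tangent ∞
      fun x : E => (⟨x, w x⟩ : TangentBundle 𝓘(ℝ, E) E) :=
    contMDiff_vectorSpace_iff_contDiff.2 hw
  have : IsManifold 𝓘(ℝ, E) (∞ + 1) M := by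
    simpa using (inferInstance : IsManifold 𝓘(ℝ, E) ∞ M)
  refine ⟨mpullback 𝓘(ℝ, E) 𝓘(ℝ, E) φ w, fun q hq => ?_,
    fun q hq => (hinv q hq).self_apply_inverse _⟩
  exact (ContMDiffAt.mpullback_vectorField_preimage (n := ∞) hw'.contMDiffAt
    (contMDiffAt_of_mem_maximalAtlas hφ hq) (hinv q hq) (by simp)).contMDiffWithinAt

end Charts

section Cutoff

variable {E : Type*} [NormedAddCommGroup E] [NormedSpace ℝ E]
  {H : Type*} [TopologicalSpace H] {I : ModelWithCorners ℝ E H}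
  {M : Type*} [TopologicalSpace M] [ChartedSpace H M]

lemma exists_cutoff [FiniteDimensional ℝ E] [T2Space M] [IsManifold I ∞ M] {p : M} {U : Set M}
    (hU : U ∈ 𝓝 p) :
    ∃ χ : C^∞⟮I, M; 𝓘(ℝ, ℝ), ℝ⟯, (∀ᶠ q in 𝓝 p, χ q = 1) ∧ tsupport χ ⊆ U := by
  obtain ⟨f, -, hf⟩ := (SmoothBumpFunction.nhds_basis_tsupport (I := I) p).mem_iff.1 hU
  exact ⟨⟨f, f.contMDiff⟩, f.eventuallyEq_one, hf⟩

lemma exists_cutoff_mul (χ : C^∞⟮I, M; 𝓘(ℝ, ℝ), ℝ⟯) {U : Set M} (hU : IsOpen U)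
    (hχ : tsupport χ ⊆ U) {f : M → ℝ} (hf : ContMDiffOn I 𝓘(ℝ, ℝ) ∞ f U) :
    ∃ g : C^∞⟮I, M; 𝓘(ℝ, ℝ), ℝ⟯, ∀ q, g q = χ q * f q :=
  ⟨⟨fun q => χ q * f q, contMDiff_of_tsupport fun _ hq => χ.contMDiff.contMDiffAt.mul
    (hf.contMDiffAt (hU.mem_nhds (hχ (tsupport_mul_subset_left hq))))⟩, fun _ => rfl⟩

lemma contMDiff_mvfderiv_apply [IsManifold I ∞ M] {f : M → ℝ} (hf : ContMDiff I 𝓘(ℝ, ℝ) ∞ f)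
    {Z : (x : M) → TangentSpace I x}
    (hZ : ContMDiff I I.tangent ∞ fun x => (⟨x, Z x⟩ : TangentBundle I M)) :
    ContMDiff I 𝓘(ℝ, ℝ) ∞ fun x => mvfderiv I f x (Z x) :=
  ((contMDiff_snd_tangentBundle_modelSpace ℝ 𝓘(ℝ, ℝ)).comp
    (hf.contMDiff_tangentMap (by simp))).comp hZ

end Cutoff

variable {S : Type*} [TopologicalSpace S] [ChartedSpace Plane S]

lemma exists_cutoff_smul [IsManifold (𝓡 2) ∞ S] (χ : SmoothFn S) {U : Set S} (hU : IsOpen U)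
    (hχ : tsupport χ ⊆ U) {Z : (q : S) → TangentSpace (𝓡 2) q}
    (hZ : ContMDiffOn (𝓡 2) (𝓡 2).tangent ∞ (fun q => (⟨q, Z q⟩ : TangentBundle (𝓡 2) S)) U) :
    ∃ X : VField S, ∀ q, X q = χ q • Z q :=
  ⟨⟨fun q => χ q • Z q, ContMDiffOn.smul_section_of_tsupport χ.contMDiff.contMDiffOn hU hχ hZ⟩,
    fun _ => rfl⟩

section TimeDependent

variable (S) in
/-- Time-dependent smooth functions on the surface, smooth jointly in time and position. -/
abbrev TimeFn : Type _ := C^∞⟮𝓘(ℝ, ℝ).prod (𝓡 2), ℝ × S; 𝓘(ℝ, ℝ), ℝ⟯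

namespace TimeFn

/-- The value of a time-dependent function at a fixed time. -/
noncomputable def slice (B : TimeFn S) (t : ℝ) : SmoothFn S :=
  ⟨fun p => B (t, p), B.contMDiff.comp (contMDiff_const.prodMk contMDiff_id)⟩

@[simp] lemma slice_apply (B : TimeFn S) (t : ℝ) (p : S) : B.slice t p = B (t, p) := rfl

lemma mdifferentiableAt (B : TimeFn S) (z : ℝ × S) :
    MDifferentiableAt (𝓘(ℝ, ℝ).prod (𝓡 2)) 𝓘(ℝ, ℝ) B z :=
  B.contMDiff.mdifferentiable (by simp) z

/-- A time-dependent function read in a chart of the surface; it agrees with the function only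
over the target of the chart. -/
noncomputable def inChart (B : TimeFn S) (φ : OpenPartialHomeomorph S Plane) (z : ℝ × Plane) : ℝ :=
  B (z.1, φ.symm z.2)

section InChart

variable {φ : OpenPartialHomeomorph S Plane} (hφ : φ ∈ IsManifold.maximalAtlas (𝓡 2) ∞ S)
include hφ

lemma contDiffOn_inChart (B : TimeFn S) :
    ContDiffOn ℝ ∞ (B.inChart φ) (Set.univ ×ˢ φ.target) := by
  rw [← contMDiffOn_iff_contDiffOn]
  refine B.contMDiff.comp_contMDiffOn (ContMDiffOn.prodMk contDiff_fst.contMDiff.contMDiffOn ?_)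
  exact (contMDiffOn_symm_of_mem_maximalAtlas hφ).comp contDiff_snd.contMDiff.contMDiffOn
    fun z hz => hz.2

lemma contDiffAt_inChart (B : TimeFn S) {z : ℝ × Plane} (hz : z.2 ∈ φ.target) :
    ContDiffAt ℝ ∞ (B.inChart φ) z :=
  (B.contDiffOn_inChart hφ).contDiffAt
    ((isOpen_univ.prod φ.open_target).mem_nhds ⟨Set.mem_univ _, hz⟩)

lemma differentiableAt_inChart (B : TimeFn S) {z : ℝ × Plane} (hz : z.2 ∈ φ.target) :
    DifferentiableAt ℝ (B.inChart φ) z :=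
  (B.contDiffAt_inChart hφ hz).differentiableAt (by simp)

end InChart

variable [IsManifold (𝓡 2) ∞ S]

lemma exists_contDiff_eventuallyEq_inChart (B : TimeFn S) (p : S) :
    ∃ G : ℝ × Plane → ℝ, ContDiff ℝ ∞ G ∧
      ∀ᶠ x in 𝓝 (chartAt Plane p p), ∀ t, G (t, x) = B.inChart (chartAt Plane p) (t, x) := by
  set φ := chartAt Plane p
  obtain ⟨χ, hχ, hχ_one, hχ_supp⟩ := exists_contDiff_cutoff
    (φ.open_target.mem_nhds (φ.map_source (mem_chart_source Plane p)))
  refine ⟨fun z => χ z.2 * B.inChart φ z, ?_, ?_⟩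
  · exact contDiff_mul_of_tsupport_subset (hχ.comp contDiff_snd)
      (isOpen_univ.prod φ.open_target) (fun z hz => ⟨Set.mem_univ _,
        hχ_supp (tsupport_comp_subset_preimage χ continuous_snd hz)⟩)
      (B.contDiffOn_inChart (IsManifold.chart_mem_maximalAtlas p))
  · filter_upwards [hχ_one] with x hx t
    simp [hx]

end TimeFn

lemma contMDiff_prod_section [IsManifold (𝓡 2) ∞ S] (c : ℝ) (X : VField S) :
    ContMDiff (𝓘(ℝ, ℝ).prod (𝓡 2)) (𝓘(ℝ, ℝ).prod (𝓡 2)).tangent ∞ fun z : ℝ × S =>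
      (⟨z, (c, X z.2)⟩ : TangentBundle (𝓘(ℝ, ℝ).prod (𝓡 2)) (ℝ × S)) := by
  have hconst : ContMDiff 𝓘(ℝ, ℝ) (𝓘(ℝ, ℝ)).tangent ∞
      fun t : ℝ => (⟨t, c⟩ : TangentBundle 𝓘(ℝ, ℝ) ℝ) :=
    contMDiff_vectorSpace_iff_contDiff.2 contDiff_const
  exact contMDiff_equivTangentBundleProd_symm.comp
    ((hconst.comp contMDiff_fst).prodMk (X.contMDiff.comp contMDiff_snd))

lemma contMDiff_prod_section_smul [IsManifold (𝓡 2) ∞ S] {h : ℝ × S → ℝ}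
    (hh : ContMDiff (𝓘(ℝ, ℝ).prod (𝓡 2)) 𝓘(ℝ, ℝ) ∞ h) (X : VField S) :
    ContMDiff (𝓘(ℝ, ℝ).prod (𝓡 2)) (𝓘(ℝ, ℝ).prod (𝓡 2)).tangent ∞ fun z : ℝ × S =>
      (⟨z, ((1 : ℝ), h z • X z.2)⟩ : TangentBundle (𝓘(ℝ, ℝ).prod (𝓡 2)) (ℝ × S)) := by
  refine ((contMDiff_prod_section 1 (0 : VField S)).add_section
    (hh.smul_section (contMDiff_prod_section 0 X))).congr fun z => ?_
  refine congrArg (Bundle.TotalSpace.mk z) (Prod.ext ?_ ?_)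
  · change (1 : ℝ) = 1 + h z * 0
    simp
  · change h z • X z.2 = 0 + h z • X z.2
    rw [zero_add]

namespace TimeFn

variable [IsManifold (𝓡 2) ∞ S]

/-- The time derivative of a time-dependent function. -/
noncomputable def dot (B : TimeFn S) : TimeFn S :=
  ⟨fun z => mvfderiv (𝓘(ℝ, ℝ).prod (𝓡 2)) B z ((1 : ℝ), (0 : TangentSpace (𝓡 2) z.2)),
    contMDiff_mvfderiv_apply B.contMDiff (contMDiff_prod_section 1 (0 : VField S))⟩

/-- The derivative of a time-dependent function along a vector field of the surface, at each
fixed time. -/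
noncomputable def act (X : VField S) (B : TimeFn S) : TimeFn S :=
  ⟨fun z => mvfderiv (𝓘(ℝ, ℝ).prod (𝓡 2)) B z ((0 : ℝ), X z.2),
    contMDiff_mvfderiv_apply B.contMDiff (contMDiff_prod_section 0 X)⟩

lemma hasDerivAt_dot (B : TimeFn S) (t : ℝ) (p : S) :
    HasDerivAt (fun s => B (s, p)) (B.dot (t, p)) t := by
  have hslice : HasMFDerivAt 𝓘(ℝ, ℝ) (𝓘(ℝ, ℝ).prod (𝓡 2)) (fun s : ℝ => (s, p)) t
      ((ContinuousLinearMap.id ℝ (TangentSpace 𝓘(ℝ, ℝ) t)).prod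
        (0 : TangentSpace 𝓘(ℝ, ℝ) t →L[ℝ] TangentSpace (𝓡 2) p)) :=
    (hasMFDerivAt_id t).prodMk (hasMFDerivAt_const p t)
  have hderiv : HasFDerivAt (fun s : ℝ => B (s, p))
      (show ℝ →L[ℝ] ℝ from (mfderiv (𝓘(ℝ, ℝ).prod (𝓡 2)) 𝓘(ℝ, ℝ) B (t, p)).comp
        ((ContinuousLinearMap.id ℝ (TangentSpace 𝓘(ℝ, ℝ) t)).prod
          (0 : TangentSpace 𝓘(ℝ, ℝ) t →L[ℝ] TangentSpace (𝓡 2) p))) t :=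
    ((B.mdifferentiableAt (t, p)).hasMFDerivAt.comp t hslice).hasFDerivAt
  exact hderiv.hasDerivAt

lemma act_apply (X : VField S) (B : TimeFn S) (t : ℝ) (p : S) :
    act X B (t, p) = StarLog.act X (B.slice t) p := by
  have hslice : HasMFDerivAt (𝓡 2) (𝓘(ℝ, ℝ).prod (𝓡 2)) (fun q : S => (t, q)) p
      ((0 : TangentSpace (𝓡 2) p →L[ℝ] TangentSpace 𝓘(ℝ, ℝ) t).prod
        (ContinuousLinearMap.id ℝ (TangentSpace (𝓡 2) p))) :=
    (hasMFDerivAt_const t p).prodMk (hasMFDerivAt_id p)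
  have hcomp := ((B.mdifferentiableAt (t, p)).hasMFDerivAt.comp p hslice).mfderiv
  exact (congrArg (· (X p)) hcomp).symm

section InChart

variable {φ : OpenPartialHomeomorph S Plane} (hφ : φ ∈ IsManifold.maximalAtlas (𝓡 2) ∞ S)
include hφ

lemma act_eq_fderiv_inChart (X : VField S) (B : TimeFn S) (t : ℝ) {p : S} (hp : p ∈ φ.source) :
    act X B (t, p) = fderiv ℝ (B.inChart φ) (t, φ p) (0, mvfderiv (𝓡 2) φ p (X p)) := by
  rw [act_apply, StarLog.act_apply,
    mvfderiv_eq_fderiv_chart hφ hp (ContMDiffMap.mdifferentiableAt _)]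
  have hslice : HasFDerivAt (fun x : Plane => B.inChart φ (t, x))
      (fderiv ℝ (B.inChart φ) (t, φ p) ∘L .inr ℝ ℝ Plane) (φ p) :=
    (B.differentiableAt_inChart hφ (φ.map_source hp)).hasFDerivAt.comp _
      (hasFDerivAt_prodMk_right t (φ p))
  exact congrArg (fun L : Plane →L[ℝ] ℝ => L _) hslice.fderiv

lemma inChart_dot (B : TimeFn S) {z : ℝ × Plane} (hz : z.2 ∈ φ.target) :
    B.dot.inChart φ z = fderiv ℝ (B.inChart φ) z (1, 0) :=
  (B.hasDerivAt_dot z.1 (φ.symm z.2)).unique <|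
    (B.differentiableAt_inChart hφ hz).hasFDerivAt.comp_hasDerivAt z.1
      (f := fun s : ℝ => (s, z.2)) ((hasDerivAt_id z.1).prodMk (hasDerivAt_const z.1 z.2))

end InChart

/-- Symmetry of the second derivative, in a chart. -/
lemma dot_act (X : VField S) (B : TimeFn S) : (act X B).dot = act X B.dot := by
  ext ⟨t, p⟩
  set φ := chartAt Plane p
  have hφ : φ ∈ IsManifold.maximalAtlas (𝓡 2) ∞ S := IsManifold.chart_mem_maximalAtlas p
  have hp : p ∈ φ.source := mem_chart_source Plane p
  have hx : φ p ∈ φ.target := φ.map_source hp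
  set F := B.inChart φ
  set w : Plane := mvfderiv (𝓡 2) φ p (X p)
  have hF : ContDiffAt ℝ ∞ F (t, φ p) := B.contDiffAt_inChart hφ hx
  have hF' : HasFDerivAt (fderiv ℝ F) (fderiv ℝ (fderiv ℝ F) (t, φ p)) (t, φ p) :=
    ((hF.fderiv_right (m := ∞) (by simp)).differentiableAt (by simp)).hasFDerivAt
  have hdot_act : (act X B).dot (t, p) = fderiv ℝ (fderiv ℝ F) (t, φ p) (1, 0) (0, w) := by
    refine ((act X B).hasDerivAt_dot t p).unique ?_
    simp_rw [act_eq_fderiv_inChart hφ X B _ hp]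
    have hline : HasDerivAt (fun s => fderiv ℝ F (s, φ p))
        (fderiv ℝ (fderiv ℝ F) (t, φ p) (1, 0)) t :=
      hF'.comp_hasDerivAt t (f := fun s : ℝ => (s, φ p))
        ((hasDerivAt_id t).prodMk (hasDerivAt_const t (φ p)))
    simpa using hline.clm_apply (hasDerivAt_const t ((0 : ℝ), w))
  have hact_dot : act X B.dot (t, p) = fderiv ℝ (fderiv ℝ F) (t, φ p) (0, w) (1, 0) := by
    have hev : B.dot.inChart φ =ᶠ[𝓝 (t, φ p)] fun z => fderiv ℝ F z (1, 0) := by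
      filter_upwards [continuousAt_snd.preimage_mem_nhds (φ.open_target.mem_nhds hx)] with z hz
        using B.inChart_dot hφ hz
    rw [act_eq_fderiv_inChart hφ X B.dot t hp, hev.fderiv_eq,
      (hF'.clm_apply (hasFDerivAt_const ((1 : ℝ), (0 : Plane)) (t, φ p))).fderiv]
    simp [w]
  have hsymm : IsSymmSndFDerivAt ℝ F (t, φ p) := hF.isSymmSndFDerivAt (by
    rw [minSmoothness_of_isRCLikeNormedField]
    exact WithTop.coe_le_coe.mpr (le_top : (2 : ℕ∞) ≤ ⊤))
  rw [hdot_act, hact_dot]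
  exact hsymm.eq _ _

/-- The average of a time-dependent function over the unit interval. -/
noncomputable def avg (B : TimeFn S) : SmoothFn S :=
  ⟨fun p => ∫ t in (0 : ℝ)..1, B (t, p), fun p => by
    obtain ⟨G, hG, hGB⟩ := B.exists_contDiff_eventuallyEq_inChart p
    have hint : ContDiff ℝ ∞ fun x => ∫ t in (0 : ℝ)..1, G (t, x) :=
      contDiff_unitInterval_integral (n := ⊤) hG
    have hchart : ContMDiffAt (𝓡 2) (𝓡 2) ∞ (chartAt Plane p) p :=
      contMDiffAt_of_mem_maximalAtlas (IsManifold.chart_mem_maximalAtlas p)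
        (mem_chart_source Plane p)
    refine (hint.contMDiff.contMDiffAt.comp p hchart).congr_of_eventuallyEq ?_
    filter_upwards [hchart.continuousAt.eventually hGB,
      (chartAt Plane p).open_source.mem_nhds (mem_chart_source Plane p)] with q hq hq_source
    refine intervalIntegral.integral_congr fun t _ => ?_
    simp [hq t, inChart, (chartAt Plane p).left_inv hq_source]⟩

lemma act_avg (X : VField S) (B : TimeFn S) (p : S) :
    StarLog.act X B.avg p = ∫ t in (0 : ℝ)..1, act X B (t, p) := by
  obtain ⟨G, hG, hGB⟩ := B.exists_contDiff_eventuallyEq_inChart p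
  set φ := chartAt Plane p
  have hφ : φ ∈ IsManifold.maximalAtlas (𝓡 2) ∞ S := IsManifold.chart_mem_maximalAtlas p
  have hp : p ∈ φ.source := mem_chart_source Plane p
  have havg : ⇑B.avg ∘ φ.symm =ᶠ[𝓝 (φ p)] fun x => ∫ t in (0 : ℝ)..1, G (t, x) := by
    filter_upwards [hGB] with x hx
    exact intervalIntegral.integral_congr fun t _ => (hx t).symm
  have hG' : ∀ t, fderiv ℝ (B.inChart φ) (t, φ p) = fderiv ℝ G (t, φ p) := fun t =>
    Filter.EventuallyEq.fderiv_eq <| by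
      filter_upwards [continuousAt_snd.eventually hGB] with z hz using (hz z.1).symm
  rw [StarLog.act_apply, mvfderiv_eq_fderiv_chart hφ hp (ContMDiffMap.mdifferentiableAt _),
    havg.fderiv_eq, fderiv_unitInterval_integral (hG.of_le (by simp))]
  refine intervalIntegral.integral_congr fun t _ => ?_
  simp only [act_eq_fderiv_inChart hφ X B t hp, hG']

end TimeFn

end TimeDependent

section Coordinates

variable {S : Type*} [TopologicalSpace S] [ChartedSpace Plane S] [IsManifold (𝓡 2) ∞ S] [T2Space S]

lemma exists_chart_coord {φ : OpenPartialHomeomorph S Plane}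
    (hφ : φ ∈ IsManifold.maximalAtlas (𝓡 2) ∞ S) {p : S} (hp : p ∈ φ.source)
    (m : Plane →L[ℝ] ℝ) :
    ∃ b : SmoothFn S, (∀ᶠ q in 𝓝 p, q ∈ φ.source ∧ b q = m (φ q) ∧
      ∀ v : TangentSpace (𝓡 2) q, mvfderiv (𝓡 2) b q v = m (mvfderiv (𝓡 2) φ q v)) ∧
      ∀ q, (q ∈ φ.source → m (φ q) = 0) → b q = 0 := by
  obtain ⟨χ, hχ_one, hχ_supp⟩ := exists_cutoff (I := 𝓡 2) (φ.open_source.mem_nhds hp)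
  obtain ⟨b, hb⟩ := exists_cutoff_mul χ φ.open_source hχ_supp
    (m.contDiff.contMDiff.comp_contMDiffOn (contMDiffOn_of_mem_maximalAtlas hφ))
  refine ⟨b, ?_, fun q hq => ?_⟩
  · filter_upwards [φ.open_source.mem_nhds hp, hχ_one.eventually_nhds] with q hq hχq
    refine ⟨hq, by simp [hb, hχq.self_of_nhds], fun v => ?_⟩
    have hread : b ∘ φ.symm =ᶠ[𝓝 (φ q)] m := by
      have hsymm := φ.continuousAt_symm (φ.map_source hq)
      rw [ContinuousAt, φ.left_inv hq] at hsymm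
      filter_upwards [hsymm.eventually hχq, φ.open_target.mem_nhds (φ.map_source hq)]
        with x hx hx_target
      simp [hb, hx, φ.right_inv hx_target]
    rw [mvfderiv_eq_fderiv_chart hφ hq b.mdifferentiableAt, hread.fderiv_eq, m.fderiv]
  · by_cases hq_source : q ∈ φ.source
    · simp [hb, hq hq_source]
    · simp [hb, image_eq_zero_of_notMem_tsupport fun h => hq_source (hχ_supp h)]

lemma VField.ext_act {X Y : VField S}
    (h : ∀ (f : SmoothFn S) (p : S), act X f p = act Y f p) : X = Y := by
  ext p : 1
  have hφ : chartAt Plane p ∈ IsManifold.maximalAtlas (𝓡 2) ∞ S :=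
    IsManifold.chart_mem_maximalAtlas p
  have hp := mem_chart_source Plane p
  refine (bijective_mvfderiv_chart hφ hp).1 ?_
  ext i
  obtain ⟨b, hb, -⟩ := exists_chart_coord hφ hp (EuclideanSpace.proj i)
  have hact := h b p
  rwa [act_apply, act_apply, hb.self_of_nhds.2.2, hb.self_of_nhds.2.2] at hact

end Coordinates

section StarCharts

variable {S : Type*} [TopologicalSpace S] [ChartedSpace Plane S] {D : StarDivisor S} {p : S}

/-- A smooth chart centred at `p` in which the curves of the divisor through `p` are lines and
which meets no other curve. The linear form `l i` is meaningful only if `p` is on the `i`-th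
curve. -/
structure StarChart (D : StarDivisor S) (p : S) where
  φ : OpenPartialHomeomorph S Plane
  mem_maximalAtlas : φ ∈ IsManifold.maximalAtlas (𝓡 2) ∞ S
  mem_source : p ∈ φ.source
  map_self : φ p = 0
  l : Fin D.card → (Plane →L[ℝ] ℝ)
  l_ne_zero : ∀ i, p ∈ D.curve i → l i ≠ 0
  mem_curve_iff : ∀ i, p ∈ D.curve i → ∀ q ∈ φ.source, q ∈ D.curve i ↔ l i (φ q) = 0
  linearIndependent : ∀ i j, i ≠ j → p ∈ D.curve i → p ∈ D.curve j →
    LinearIndependent ℝ ![l i, l j]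
  mem_curve_of_mem : ∀ i, ∀ q ∈ φ.source, q ∈ D.curve i → p ∈ D.curve i

/-- The complement of the divisor. -/
def StarDivisor.compl (D : StarDivisor S) : Set S := {p | ∀ i, p ∉ D.curve i}

lemma exists_starChart (D : StarDivisor S) (p : S) : Nonempty (StarChart D p) := by
  obtain ⟨φ, hφ, hp, h0, l, hl, hind⟩ := D.star_chart p
  let V : Set S := ⋂ i : {i // p ∉ D.curve i}, (D.curve i.1)ᶜ
  have hV : IsOpen V := isOpen_iInter_of_finite fun i => (D.isClosed i.1).isOpen_compl
  have hsource : (φ.restr V).source = φ.source ∩ V := φ.restr_source' V hV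
  refine ⟨⟨φ.restr V, restr_mem_maximalAtlas _ hφ hV, ?_, h0, l, fun i hi => (hl i hi).1,
    fun i hi q hq => (hl i hi).2 q (hsource ▸ hq).1, hind, fun i q hq hqi => ?_⟩⟩
  · exact hsource ▸ ⟨hp, Set.mem_iInter.2 fun i => i.2⟩
  · by_contra hpi
    have hqV : q ∈ φ.source ∩ V := hsource ▸ hq
    exact Set.mem_iInter.1 hqV.2 ⟨i, hpi⟩ hqi

lemma StarDivisor.dense_compl_curve (D : StarDivisor S) (i : Fin D.card) :
    Dense (D.curve i)ᶜ := by
  intro p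
  by_cases hp : p ∈ D.curve i
  swap
  · exact subset_closure hp
  obtain ⟨C⟩ := exists_starChart D p
  obtain ⟨w, hw⟩ := DFunLike.ne_iff.1 (C.l_ne_zero i hp)
  have h0 : (0 : Plane) ∈ C.φ.target := C.map_self ▸ C.φ.map_source C.mem_source
  have hsymm : C.φ.symm 0 = p := by rw [← C.map_self, C.φ.left_inv C.mem_source]
  have hline : Filter.Tendsto (fun s : ℝ => s • w) (𝓝[≠] 0) (𝓝 (0 : Plane)) := by
    have hcont : Continuous fun s : ℝ => s • w := by fun_prop
    simpa using (hcont.tendsto 0).mono_left (nhdsWithin_le_nhds (s := {0}ᶜ))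
  refine mem_closure_of_tendsto (hsymm ▸ (C.φ.continuousAt_symm h0).tendsto.comp hline) ?_
  filter_upwards [self_mem_nhdsWithin, hline.eventually (C.φ.open_target.mem_nhds h0)]
    with s hs hs_target
  change C.φ.symm (s • w) ∉ D.curve i
  rw [C.mem_curve_iff i hp _ (C.φ.map_target hs_target), C.φ.right_inv hs_target, map_smul,
    smul_eq_zero, not_or]
  exact ⟨hs, hw⟩

lemma StarDivisor.dense_compl (D : StarDivisor S) : Dense D.compl := by
  have hcompl : D.compl = ⋂₀ Set.range fun i => (D.curve i)ᶜ := by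
    ext p
    simp [StarDivisor.compl]
  rw [hcompl]
  exact (Set.finite_range _).dense_sInter
    (Set.forall_mem_range.2 fun i => (D.isClosed i).isOpen_compl)
    (Set.forall_mem_range.2 D.dense_compl_curve)

variable [IsManifold (𝓡 2) ∞ S] [T2Space S]

lemma StarChart.mem_tangentAlong_iff (C : StarChart D p) {i : Fin D.card} {q : S}
    (hq : q ∈ C.φ.source) (hqi : q ∈ D.curve i) (v : TangentSpace (𝓡 2) q) :
    v ∈ tangentAlong (D.curve i) q ↔ C.l i (mvfderiv (𝓡 2) C.φ q v) = 0 := by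
  have hpi := C.mem_curve_of_mem i q hq hqi
  refine ⟨fun hv => ?_, fun hv f hf => ?_⟩
  · obtain ⟨b, hb, hb_zero⟩ := exists_chart_coord C.mem_maximalAtlas hq (C.l i)
    rw [← hb.self_of_nhds.2.2 v]
    exact hv b fun r hr => hb_zero r fun hrs => (C.mem_curve_iff i hpi r hrs).1 hr
  · set w := mvfderiv (𝓡 2) C.φ q v
    have hq_target : C.φ q ∈ C.φ.target := C.φ.map_source hq
    have hread : DifferentiableAt ℝ (f ∘ C.φ.symm) (C.φ q) :=
      (MDifferentiableAt.comp (C.φ q) f.mdifferentiableAt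
        ((mdifferentiable_of_mem_maximalAtlas C.mem_maximalAtlas).mdifferentiableAt_symm
          hq_target)).differentiableAt
    have hcont : ContinuousAt (fun s : ℝ => C.φ q + s • w) 0 := by fun_prop
    have hzero : ∀ᶠ s : ℝ in 𝓝 0, (f ∘ C.φ.symm) (C.φ q + s • w) = 0 := by
      filter_upwards [hcont.eventually (C.φ.open_target.mem_nhds (by simpa using hq_target))]
        with s hs
      refine hf _ ?_
      rw [C.mem_curve_iff i hpi _ (C.φ.map_target hs), C.φ.right_inv hs, map_add, map_smul, hv,
        (C.mem_curve_iff i hpi q hq).1 hqi, smul_zero, add_zero]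
    rw [mvfderiv_eq_fderiv_chart C.mem_maximalAtlas hq f.mdifferentiableAt]
    exact (hread.hasFDerivAt.hasLineDerivAt w).unique
      ((hasDerivAt_const (0 : ℝ) (0 : ℝ)).congr_of_eventuallyEq hzero)

lemma StarChart.exists_bfield (C : StarChart D p) {w : Plane → Plane} (hw : ContDiff ℝ ∞ w)
    (hl : ∀ i, p ∈ D.curve i → ∀ x, C.l i x = 0 → C.l i (w x) = 0) :
    ∃ X : BField D, ∀ᶠ q in 𝓝 p, q ∈ C.φ.source ∧ mvfderiv (𝓡 2) C.φ q (X.1 q) = w (C.φ q) := by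
  obtain ⟨χ, hχ_one, hχ_supp⟩ := exists_cutoff (I := 𝓡 2) (C.φ.open_source.mem_nhds C.mem_source)
  obtain ⟨Z, hZ, hZw⟩ := exists_vectorField_of_chart C.mem_maximalAtlas hw
  obtain ⟨X, hX⟩ := exists_cutoff_smul χ C.φ.open_source hχ_supp hZ
  refine ⟨⟨X, fun i q hqi => ?_⟩, ?_⟩
  · by_cases hq : q ∈ C.φ.source
    · have hpi := C.mem_curve_of_mem i q hq hqi
      rw [C.mem_tangentAlong_iff hq hqi, hX, map_smul, map_smul, hZw q hq,
        hl i hpi _ ((C.mem_curve_iff i hpi q hq).1 hqi), smul_zero]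
    · intro f _
      rw [hX, image_eq_zero_of_notMem_tsupport fun h => hq (hχ_supp h), zero_smul, map_zero]
  · filter_upwards [C.φ.open_source.mem_nhds C.mem_source, hχ_one] with q hq hχq
    exact ⟨hq, by rw [hX, hχq, one_smul, hZw q hq]⟩

end StarCharts

section Area

/-- The standard area form of the plane. -/
def area (v w : Plane) : ℝ := v 0 * w 1 - v 1 * w 0

lemma clm_plane_apply (m : Plane →L[ℝ] ℝ) (v : Plane) :
    m v = v 0 * m (EuclideanSpace.single 0 1) + v 1 * m (EuclideanSpace.single 1 1) := by
  have hv : v = v 0 • EuclideanSpace.single 0 (1 : ℝ) + v 1 • EuclideanSpace.single 1 (1 : ℝ) := by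
    ext i
    fin_cases i <;> simp
  conv_lhs => rw [hv]
  simp

lemma clm_plane_wedge (m n : Plane →L[ℝ] ℝ) (v w : Plane) :
    m v * n w - n v * m w =
      (m (EuclideanSpace.single 0 1) * n (EuclideanSpace.single 1 1) -
        n (EuclideanSpace.single 0 1) * m (EuclideanSpace.single 1 1)) * area v w := by
  rw [clm_plane_apply m v, clm_plane_apply m w, clm_plane_apply n v, clm_plane_apply n w, area]
  ring

lemma area_eq_zero_of_mem_ker {m : Plane →L[ℝ] ℝ} (hm : m ≠ 0) {v w : Plane} (hv : m v = 0)
    (hw : m w = 0) : area v w = 0 := by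
  by_contra harea
  refine hm (ContinuousLinearMap.ext fun x => ?_)
  have hcramer : area v w * m x = area x w * m v + area v x * m w := by
    rw [clm_plane_apply m x, clm_plane_apply m v, clm_plane_apply m w]
    simp only [area]
    ring
  simpa [hv, hw, harea] using hcramer

/-- If the form `l i₀` vanishes at `τ`, the Euler field and `τ`, scaled by the product of the
other forms, are both tangent to all the lines. -/
lemma exists_area_eq_prod {ι : Type*} (s : Finset ι) (l : ι → Plane →L[ℝ] ℝ) :
    ∃ e w : Plane → Plane, ContDiff ℝ ∞ e ∧ ContDiff ℝ ∞ w ∧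
      (∀ i ∈ s, ∀ x, l i x = 0 → l i (e x) = 0 ∧ l i (w x) = 0) ∧
      ∀ x, area (e x) (w x) = ∏ i ∈ s, l i x := by
  classical
  obtain rfl | ⟨i₀, hi₀⟩ := s.eq_empty_or_nonempty
  · exact ⟨fun _ => EuclideanSpace.single 0 1, fun _ => EuclideanSpace.single 1 1, contDiff_const,
      contDiff_const, by simp, by simp [area]⟩
  let τ : Plane := !₂[-l i₀ (EuclideanSpace.single 1 1), l i₀ (EuclideanSpace.single 0 1)]
  have hτ : l i₀ τ = 0 := by
    rw [clm_plane_apply]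
    simp only [Fin.isValue, τ, Matrix.cons_val_zero, Matrix.cons_val_one]
    ring
  refine ⟨id, fun x => (∏ j ∈ s.erase i₀, l j x) • τ, contDiff_id,
    (contDiff_prod fun j _ => (l j).contDiff).smul contDiff_const,
    fun i hi x hx => ⟨hx, ?_⟩, fun x => ?_⟩
  · obtain rfl | hne := eq_or_ne i i₀
    · rw [map_smul, hτ, smul_zero]
    · rw [map_smul, Finset.prod_eq_zero (Finset.mem_erase.2 ⟨hne, hi⟩) hx, zero_smul]
  · rw [← Finset.mul_prod_erase _ _ hi₀, clm_plane_apply (l i₀) x]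
    simp only [area, id_eq, PiLp.smul_apply, smul_eq_mul, Fin.isValue, τ,
      Matrix.cons_val_zero, Matrix.cons_val_one]
    ring

lemma eq_of_eventually_eq_of_dense {X Y : Type*} [TopologicalSpace X] [TopologicalSpace Y]
    [T2Space Y] {f g : X → Y} {s : Set X} (hs : Dense s) {p : X} (hf : ContinuousAt f p)
    (hg : ContinuousAt g p) (h : ∀ᶠ q in 𝓝 p, q ∈ s → f q = g q) : f p = g p := by
  have : (𝓝[s] p).NeBot := mem_closure_iff_nhdsWithin_neBot.1 (hs p)
  refine tendsto_nhds_unique (l := 𝓝[s] p) (hf.tendsto.mono_left nhdsWithin_le_nhds)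
    ((hg.tendsto.mono_left nhdsWithin_le_nhds).congr' ?_)
  filter_upwards [nhdsWithin_le_nhds h, self_mem_nhdsWithin] with q hq hqs using (hq hqs).symm

end Area

section Forms

variable {S : Type*} [TopologicalSpace S] [ChartedSpace Plane S] [IsManifold (𝓡 2) ∞ S]
  {D : StarDivisor S}

/-- The two-form `db ∧ dc`. -/
noncomputable def wedge (b c : SmoothFn S) (X Y : BField D) : SmoothFn S :=
  act X.1 b * act Y.1 c - act X.1 c * act Y.1 b

lemma wedge_apply (b c : SmoothFn S) (X Y : BField D) (p : S) : wedge b c X Y p =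
    mvfderiv (𝓡 2) b p (X.1 p) * mvfderiv (𝓡 2) c p (Y.1 p) -
      mvfderiv (𝓡 2) c p (X.1 p) * mvfderiv (𝓡 2) b p (Y.1 p) := rfl

/-- A pairing of sections of the `b`-tangent bundle which, off the divisor, is pointwise a multiple
of the area form. -/
def IsAreaLike (F : BField D → BField D → SmoothFn S) : Prop :=
  ∀ p ∈ D.compl, ∃ κ : ℝ, ∀ X Y : BField D, F X Y p = κ * area (X.1 p) (Y.1 p)

lemma isAreaLike_wedge (b c : SmoothFn S) : IsAreaLike (wedge b c : BField D → BField D → _) :=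
  fun p _ => ⟨_, fun _ _ => clm_plane_wedge (mvfderiv (𝓡 2) b p) (mvfderiv (𝓡 2) c p) _ _⟩

lemma IsAreaLike.mul_eq_mul {F G : BField D → BField D → SmoothFn S} (hF : IsAreaLike F)
    (hG : IsAreaLike G) (X Y E W : BField D) (p : S) :
    F X Y p * G E W p = F E W p * G X Y p := by
  suffices h : (fun p => F X Y p * G E W p) = fun p => F E W p * G X Y p from congrFun h p
  refine Continuous.ext_on D.dense_compl
    ((F X Y).contMDiff.continuous.mul (G E W).contMDiff.continuous)
    ((F E W).contMDiff.continuous.mul (G X Y).contMDiff.continuous) fun q hq => ?_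
  obtain ⟨κ, hκ⟩ := hF q hq
  obtain ⟨μ, hμ⟩ := hG q hq
  simp only [hκ, hμ]
  ring

lemma BField.coe_smul (f : SmoothFn S) (X : BField D) (p : S) : (f • X).1 p = f p • X.1 p := rfl

lemma BField.coe_sub (X Y : BField D) (p : S) : (X - Y).1 p = X.1 p - Y.1 p := rfl

lemma bilin_antisymm {η : BBilin D} (alt : ∀ X, η X X = 0) (X Y : BField D) :
    η X Y = -η Y X := by
  have h := alt (X + Y)
  simp only [map_add, LinearMap.add_apply, alt, zero_add, add_zero] at h
  exact eq_neg_of_add_eq_zero_right h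

/-- The differential of a function as a `b`-form of degree one. -/
noncomputable def dForm (b : SmoothFn S) : BOneForm D where
  toFun X := act X.1 b
  map_add' X Y := by
    ext p
    exact map_add (mvfderiv (𝓡 2) b p) (X.1 p) (Y.1 p)
  map_smul' f X := by
    ext p
    exact map_smul (mvfderiv (𝓡 2) b p) (f p) (X.1 p)

variable [T2Space S]

lemma oneForm_congr (α : BOneForm D) {X X' : BField D} {p : S}
    (h : ∀ᶠ q in 𝓝 p, X.1 q = X'.1 q) : α X p = α X' p := by
  obtain ⟨χ, hχ_one, hχ_supp⟩ := exists_cutoff (I := 𝓡 2) h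
  have hsmul : χ • (X - X') = 0 := by
    ext q : 2
    rw [BField.coe_smul, BField.coe_sub]
    by_cases hq : q ∈ tsupport χ
    · rw [show X.1 q = X'.1 q from hχ_supp hq, sub_self, smul_zero]
      rfl
    · rw [image_eq_zero_of_notMem_tsupport hq, zero_smul]
      rfl
  have hχα : χ p * (α X p - α X' p) = 0 := by
    simpa using congrArg (fun f : SmoothFn S => f p) (congrArg α hsmul)
  rw [hχ_one.self_of_nhds, one_mul] at hχα
  exact sub_eq_zero.1 hχα

lemma bilin_congr (η : BBilin D) {X X' Y Y' : BField D} {p : S}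
    (hX : ∀ᶠ q in 𝓝 p, X.1 q = X'.1 q) (hY : ∀ᶠ q in 𝓝 p, Y.1 q = Y'.1 q) :
    η X Y p = η X' Y' p :=
  (oneForm_congr (η X) hY).trans (oneForm_congr (η.flip Y') hX)

lemma exists_frame {p : S} (hp : p ∈ D.compl) :
    ∃ (b c : SmoothFn S) (e f : BField D), ∀ᶠ q in 𝓝 p,
      act e.1 b q = 1 ∧ ∀ X : BField D, X.1 q = act X.1 b q • e.1 q + act X.1 c q • f.1 q := by
  obtain ⟨C⟩ := exists_starChart D p
  obtain ⟨b, hb, -⟩ := exists_chart_coord C.mem_maximalAtlas C.mem_source (EuclideanSpace.proj 0)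
  obtain ⟨c, hc, -⟩ := exists_chart_coord C.mem_maximalAtlas C.mem_source (EuclideanSpace.proj 1)
  obtain ⟨e, he⟩ := C.exists_bfield (w := fun _ => EuclideanSpace.single 0 1) contDiff_const
    fun i hi => absurd hi (hp i)
  obtain ⟨f, hf⟩ := C.exists_bfield (w := fun _ => EuclideanSpace.single 1 1) contDiff_const
    fun i hi => absurd hi (hp i)
  refine ⟨b, c, e, f, ?_⟩
  filter_upwards [hb, hc, he, hf] with q hb hc he hf
  refine ⟨?_, fun X => (bijective_mvfderiv_chart C.mem_maximalAtlas hb.1).1 ?_⟩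
  · rw [act_apply, hb.2.2, he.2]
    simp
  · rw [map_add, map_smul, map_smul, he.2, hf.2, act_apply, act_apply, hb.2.2, hc.2.2]
    ext i
    fin_cases i <;> simp

lemma exists_eq_mul_wedge {η : BBilin D} (alt : ∀ X, η X X = 0) {p : S} (hp : p ∈ D.compl) :
    ∃ a b c : SmoothFn S, ∀ᶠ q in 𝓝 p, ∀ X Y, η X Y q = a q * wedge b c X Y q := by
  obtain ⟨b, c, e, f, h⟩ := exists_frame hp
  refine ⟨η e f, b, c, ?_⟩
  filter_upwards [h.eventually_nhds] with q hq X Y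
  have hframe : ∀ Z : BField D, ∀ᶠ r in 𝓝 q,
      Z.1 r = (act Z.1 b • e + act Z.1 c • f).1 r := fun Z => by
    filter_upwards [hq] with r hr using hr.2 Z
  rw [bilin_congr η (hframe X) (hframe Y)]
  simp only [map_add, map_smul, LinearMap.add_apply, LinearMap.smul_apply, alt, smul_zero,
    zero_add, add_zero]
  rw [bilin_antisymm alt f e]
  change act Y.1 b q * (act X.1 c q * -(η e f q)) + act Y.1 c q * (act X.1 b q * η e f q) =
    η e f q * (act X.1 b q * act Y.1 c q - act X.1 c q * act Y.1 b q)
  ring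

lemma isAreaLike_bilin {η : BBilin D} (alt : ∀ X, η X X = 0) :
    IsAreaLike fun X Y => η X Y := by
  intro p hp
  obtain ⟨a, b, c, h⟩ := exists_eq_mul_wedge alt hp
  obtain ⟨κ, hκ⟩ := isAreaLike_wedge (D := D) b c p hp
  exact ⟨a p * κ, fun X Y => by rw [h.self_of_nhds, hκ, mul_assoc]⟩

end Forms

section Nondegenerate

variable {S : Type*} [TopologicalSpace S] [ChartedSpace Plane S] {D : StarDivisor S} {p : S}

/-- `k` is the quotient of `f` by the equation of the `i`-th curve in a star chart, extended by
zero outside the chart. -/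
def StarChart.IsQuotient (C : StarChart D p) (i : Fin D.card) (f k : SmoothFn S) : Prop :=
  (∀ q ∈ C.φ.source, f q = C.l i (C.φ q) * k q) ∧ ∀ q ∉ C.φ.source, k q = 0

lemma StarChart.IsQuotient.add {C : StarChart D p} {i : Fin D.card} {f f' k k' : SmoothFn S}
    (h : C.IsQuotient i f k) (h' : C.IsQuotient i f' k') :
    C.IsQuotient i (f + f') (k + k') := by
  refine ⟨fun q hq => ?_, fun q hq => ?_⟩
  · simp only [ContMDiffMap.coe_add, Pi.add_apply, h.1 q hq, h'.1 q hq, mul_add]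
  · simp only [ContMDiffMap.coe_add, Pi.add_apply, h.2 q hq, h'.2 q hq, add_zero]

lemma StarChart.IsQuotient.mul_left {C : StarChart D p} {i : Fin D.card} {f k : SmoothFn S}
    (h : C.IsQuotient i f k) (g : SmoothFn S) : C.IsQuotient i (g * f) (g * k) := by
  refine ⟨fun q hq => ?_, fun q hq => ?_⟩
  · simp only [ContMDiffMap.coe_mul, Pi.mul_apply, h.1 q hq, mul_left_comm]
  · simp only [ContMDiffMap.coe_mul, Pi.mul_apply, h.2 q hq, mul_zero]

lemma StarChart.IsQuotient.unique {C : StarChart D p} {i : Fin D.card} (hi : p ∈ D.curve i)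
    {f k k' : SmoothFn S} (h : C.IsQuotient i f k) (h' : C.IsQuotient i f k') : k = k' := by
  refine DFunLike.coe_injective (Continuous.ext_on (D.dense_compl_curve i) k.contMDiff.continuous
    k'.contMDiff.continuous fun q hq => ?_)
  by_cases hq_source : q ∈ C.φ.source
  · exact mul_left_cancel₀ (fun h0 => hq ((C.mem_curve_iff i hi q hq_source).2 h0))
      ((h.1 q hq_source).symm.trans (h'.1 q hq_source))
  · rw [h.2 q hq_source, h'.2 q hq_source]

/-- The curves of the divisor through the centre of a star chart. -/
noncomputable def StarChart.curves (_ : StarChart D p) : Finset (Fin D.card) :=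
  open scoped Classical in Finset.univ.filter fun i => p ∈ D.curve i

lemma StarChart.mem_curves (C : StarChart D p) {i : Fin D.card} :
    i ∈ C.curves ↔ p ∈ D.curve i := by
  simp [StarChart.curves]

variable [IsManifold (𝓡 2) ∞ S] [T2Space S]

lemma StarChart.exists_isQuotient (C : StarChart D p) {i : Fin D.card} (hi : p ∈ D.curve i) :
    ∃ χ : SmoothFn S, (∀ᶠ q in 𝓝 p, χ q = 1) ∧
      ∀ f : SmoothFn S, (∀ q ∈ D.curve i, f q = 0) → ∃ k, C.IsQuotient i (χ * f) k := by
  obtain ⟨χ₀, hχ₀, hχ₀_one, hχ₀_supp⟩ := exists_contDiff_cutoff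
    (C.φ.open_target.mem_nhds (C.φ.map_source C.mem_source))
  obtain ⟨χ₁, hχ₁_one, hχ₁_supp⟩ :=
    exists_cutoff (I := 𝓡 2) (C.φ.open_source.mem_nhds C.mem_source)
  have hφ := contMDiffOn_of_mem_maximalAtlas C.mem_maximalAtlas
  obtain ⟨χ, hχ⟩ := exists_cutoff_mul χ₁ C.φ.open_source hχ₁_supp
    (hχ₀.contMDiff.comp_contMDiffOn hφ)
  refine ⟨χ, ?_, fun f hf => ?_⟩
  · filter_upwards [hχ₁_one, (C.φ.continuousAt C.mem_source).eventually hχ₀_one] with q h₁ h₀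
    simp [hχ, h₁, h₀]
  have hread : ContDiff ℝ ∞ fun x => χ₀ x * f (C.φ.symm x) := by
    refine contDiff_mul_of_tsupport_subset hχ₀ C.φ.open_target hχ₀_supp ?_
    rw [← contMDiffOn_iff_contDiffOn]
    exact f.contMDiff.comp_contMDiffOn (contMDiffOn_symm_of_mem_maximalAtlas C.mem_maximalAtlas)
  have hread_zero : ∀ x, C.l i x = 0 → χ₀ x * f (C.φ.symm x) = 0 := fun x hx => by
    by_cases hx_target : x ∈ C.φ.target
    · rw [hf _ ((C.mem_curve_iff i hi _ (C.φ.map_target hx_target)).2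
        (by rwa [C.φ.right_inv hx_target])), mul_zero]
    · rw [image_eq_zero_of_notMem_tsupport fun h => hx_target (hχ₀_supp h), zero_mul]
  obtain ⟨k₀, hk₀, hdiv⟩ :=
    exists_contDiff_eq_mul_of_eq_zero hread (C.l_ne_zero i hi) hread_zero
  obtain ⟨k, hk⟩ := exists_cutoff_mul χ₁ C.φ.open_source hχ₁_supp
    (hk₀.contMDiff.comp_contMDiffOn hφ)
  refine ⟨k, fun q hq => ?_, fun q hq => ?_⟩
  · have hdiv_q := hdiv (C.φ q)
    rw [C.φ.left_inv hq] at hdiv_q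
    simp only [ContMDiffMap.coe_mul, Pi.mul_apply, hχ, hk, Function.comp_apply]
    linear_combination χ₁ q * hdiv_q
  · rw [hk, image_eq_zero_of_notMem_tsupport fun h => hq (hχ₁_supp h), zero_mul]

/-- The form is `du / u`, cut off, where `u` is the equation of the curve; it takes the value `1`
on the Euler vector field. -/
lemma StarChart.exists_dlog (C : StarChart D p) {i : Fin D.card} (hi : p ∈ D.curve i) :
    ∃ β : BOneForm D, ∃ E : BField D, β E p = 1 := by
  obtain ⟨χ, hχ_one, hdiv⟩ := C.exists_isQuotient hi
  obtain ⟨u, hu, hu_zero⟩ := exists_chart_coord C.mem_maximalAtlas C.mem_source (C.l i)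
  have hu_curve : ∀ q ∈ D.curve i, u q = 0 := fun q hq =>
    hu_zero q fun hqs => (C.mem_curve_iff i hi q hqs).1 hq
  have hex : ∀ X : BField D, ∃ k, C.IsQuotient i (χ * dForm u X) k := fun X =>
    hdiv _ fun q hq => X.2 i q hq u hu_curve
  choose k hk using hex
  let β : BOneForm D :=
    { toFun := k
      map_add' := fun X Y => (hk (X + Y)).unique hi <| by
        simpa only [map_add, mul_add] using (hk X).add (hk Y)
      map_smul' := fun f X => (hk (f • X)).unique hi <| by
        simpa only [map_smul, smul_eq_mul, mul_left_comm, RingHom.id_apply]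
          using (hk X).mul_left f }
  obtain ⟨E, hE⟩ := C.exists_bfield (w := id) contDiff_id fun _ _ _ h => h
  refine ⟨β, E, eq_of_eventually_eq_of_dense (f := β E) (g := fun _ => 1) (D.dense_compl_curve i)
    (β E).contMDiff.continuous.continuousAt continuousAt_const ?_⟩
  filter_upwards [hχ_one, hu, hE] with q hχq huq hEq hq
  have hquot : χ q * act E.1 u q = C.l i (C.φ q) * k E q := (hk E).1 q huq.1
  rw [hχq, one_mul, act_apply, huq.2.2, hEq.2] at hquot
  exact (mul_left_cancel₀ (fun h0 => hq ((C.mem_curve_iff i hi q huq.1).2 h0))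
    (hquot.symm.trans (mul_one _).symm))

lemma LogSymplecticForm.exists_ne_zero (η : LogSymplecticForm D) (p : S) :
    ∃ E W : BField D, η.form E W p ≠ 0 := by
  suffices h : ∃ β : BOneForm D, ∃ W : BField D, β W p = 1 by
    obtain ⟨β, W, hβ⟩ := h
    obtain ⟨E, hE⟩ := η.nondegenerate.2 β
    exact ⟨E, W, by rw [hE, hβ]; exact one_ne_zero⟩
  by_cases hp : p ∈ D.compl
  · obtain ⟨b, c, e, f, h⟩ := exists_frame hp
    exact ⟨dForm b, e, h.self_of_nhds.1⟩
  · obtain ⟨i, hi⟩ : ∃ i, p ∈ D.curve i := by simpa [StarDivisor.compl] using hp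
    obtain ⟨C⟩ := exists_starChart D p
    exact C.exists_dlog hi

lemma StarChart.exists_frame (C : StarChart D p) :
    ∃ (b c : SmoothFn S) (E W : BField D), ∀ᶠ q in 𝓝 p, q ∈ C.φ.source ∧
      (∀ v w : TangentSpace (𝓡 2) q, mvfderiv (𝓡 2) b q v * mvfderiv (𝓡 2) c q w -
        mvfderiv (𝓡 2) c q v * mvfderiv (𝓡 2) b q w =
          area (mvfderiv (𝓡 2) C.φ q v) (mvfderiv (𝓡 2) C.φ q w)) ∧
      wedge b c E W q = ∏ i ∈ C.curves, C.l i (C.φ q) := by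
  obtain ⟨b, hb, -⟩ := exists_chart_coord C.mem_maximalAtlas C.mem_source (EuclideanSpace.proj 0)
  obtain ⟨c, hc, -⟩ := exists_chart_coord C.mem_maximalAtlas C.mem_source (EuclideanSpace.proj 1)
  obtain ⟨e, w, he, hw, htangent, harea⟩ := exists_area_eq_prod C.curves C.l
  obtain ⟨E, hE⟩ := C.exists_bfield he fun i hi x hx => (htangent i (C.mem_curves.2 hi) x hx).1
  obtain ⟨W, hW⟩ := C.exists_bfield hw fun i hi x hx => (htangent i (C.mem_curves.2 hi) x hx).2
  refine ⟨b, c, E, W, ?_⟩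
  filter_upwards [hb, hc, hE, hW] with q hb hc hE hW
  refine ⟨hb.1, fun v w => ?_, ?_⟩
  · rw [hb.2.2, hb.2.2, hc.2.2, hc.2.2]
    rfl
  · rw [wedge_apply, hb.2.2, hb.2.2, hc.2.2, hc.2.2, hE.2, hW.2, ← harea]
    rfl

end Nondegenerate

section Pull

variable {S : Type*} [TopologicalSpace S] [ChartedSpace Plane S] {D : StarDivisor S}

lemma BDiffeo.mem_curve_iff (ψ : BDiffeo D) (i : Fin D.card) (p : S) :
    ψ.toDiffeo p ∈ D.curve i ↔ p ∈ D.curve i := by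
  have h := ψ.toDiffeo.injective.mem_set_image (s := D.curve i) (a := p)
  exact ⟨fun hp => h.1 ((ψ.image_curve i).symm ▸ hp), fun hp => ψ.image_curve i ▸ h.2 hp⟩

lemma BDiffeo.mem_compl (ψ : BDiffeo D) {p : S} (hp : p ∈ D.compl) :
    ψ.toDiffeo p ∈ D.compl := fun i h => hp i ((ψ.mem_curve_iff i p).1 h)

lemma hasDerivAt_comp_curve (f : SmoothFn S) {q : ℝ → S} {t : ℝ} {v : TangentSpace (𝓡 2) (q t)}
    (hq : HasMFDerivAt 𝓘(ℝ, ℝ) (𝓡 2) q t ((1 : ℝ →L[ℝ] ℝ).smulRight v)) :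
    HasDerivAt (fun s => f (q s)) (mvfderiv (𝓡 2) f (q t) v) t := by
  have hcomp : HasFDerivAt (fun s : ℝ => f (q s))
      (show ℝ →L[ℝ] ℝ from (mfderiv (𝓡 2) 𝓘(ℝ, ℝ) f (q t)).comp
        ((1 : ℝ →L[ℝ] ℝ).smulRight v)) t :=
    ((f.mdifferentiableAt (x := q t)).hasMFDerivAt.comp t hq).hasFDerivAt
  refine hcomp.hasDerivAt.congr_deriv ?_
  change mfderiv (𝓡 2) 𝓘(ℝ, ℝ) f (q t) ((1 : ℝ) • v) = _
  rw [one_smul]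
  rfl

variable [IsManifold (𝓡 2) ∞ S]

lemma act_congr (X : VField S) {f g : SmoothFn S} {p : S} (h : ∀ᶠ q in 𝓝 p, f q = g q) :
    act X f p = act X g p := by
  have hfg : ⇑f =ᶠ[𝓝 p] g := h
  change mfderiv (𝓡 2) 𝓘(ℝ, ℝ) f p (X p) = mfderiv (𝓡 2) 𝓘(ℝ, ℝ) g p (X p)
  rw [hfg.mfderiv_eq]
  rfl

lemma act_mul (X : VField S) (f g : SmoothFn S) (p : S) :
    act X (f * g) p = f p * act X g p + g p * act X f p := by
  rw [act_apply, ContMDiffMap.coe_mul, mvfderiv_mul f.mdifferentiableAt g.mdifferentiableAt]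
  rfl

lemma act_sub (X : VField S) (f g : SmoothFn S) (p : S) :
    act X (f - g) p = act X f p - act X g p := by
  rw [act_apply, ContMDiffMap.coe_sub, mvfderiv_sub f.mdifferentiableAt g.mdifferentiableAt]
  rfl

namespace BDiffeo

/-- A `b`-diffeomorphism as a smooth map. -/
noncomputable abbrev map (ψ : BDiffeo D) : C^∞⟮𝓡 2, S; 𝓡 2, S⟯ :=
  ⟨ψ.toDiffeo, ψ.toDiffeo.contMDiff⟩

lemma act_push (ψ : BDiffeo D) (X : BField D) (f : SmoothFn S) (p : S) :
    act (ψ.push X).1 f (ψ.toDiffeo p) = act X.1 (f.comp ψ.map) p := by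
  have hsymm : ∀ q, act (ψ.push X).1 f q = act X.1 (f.comp ψ.map) (ψ.toDiffeo.symm q) := fun q =>
    (mvfderiv_comp_apply_of_eq (I := 𝓡 2) (ψ.toDiffeo.symm q) (f.mdifferentiableAt (x := q))
      (ψ.toDiffeo.contMDiff.mdifferentiable (by simp) (ψ.toDiffeo.symm q))
      (ψ.toDiffeo.apply_symm_apply q) (X.1 (ψ.toDiffeo.symm q))).symm
  rw [hsymm, ψ.toDiffeo.symm_apply_apply]

lemma act_push_comp (ψ : BDiffeo D) (X : BField D) (f : SmoothFn S) :
    (act (ψ.push X).1 f).comp ψ.map = act X.1 (f.comp ψ.map) :=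
  ContMDiffMap.ext (ψ.act_push X f)

lemma wedge_push (ψ : BDiffeo D) (b c : SmoothFn S) (X Y : BField D) (p : S) :
    wedge b c (ψ.push X) (ψ.push Y) (ψ.toDiffeo p) =
      wedge (b.comp ψ.map) (c.comp ψ.map) X Y p :=
  congrArg₂ (· - ·) (congrArg₂ (· * ·) (ψ.act_push X b p) (ψ.act_push Y c p))
    (congrArg₂ (· * ·) (ψ.act_push X c p) (ψ.act_push Y b p))

lemma push_add (ψ : BDiffeo D) (X Y : BField D) :
    ψ.push (X + Y) = ψ.push X + ψ.push Y := by
  ext q : 2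
  exact map_add (mfderiv (𝓡 2) (𝓡 2) ψ.toDiffeo (ψ.toDiffeo.symm q)) _ _

lemma push_smul (ψ : BDiffeo D) (f : SmoothFn S) (X : BField D) :
    ψ.push (f • X) = (f.comp ⟨ψ.toDiffeo.symm, ψ.toDiffeo.symm.contMDiff⟩ : SmoothFn S) •
      ψ.push X := by
  ext q : 2
  exact map_smul (mfderiv (𝓡 2) (𝓡 2) ψ.toDiffeo (ψ.toDiffeo.symm q)) _ _

lemma push_bbracket [T2Space S] (ψ : BDiffeo D) (X Y : BField D) :
    ψ.push (bbracket X Y) = bbracket (ψ.push X) (ψ.push Y) := by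
  refine Subtype.ext (VField.ext_act fun f q => ?_)
  obtain ⟨p, rfl⟩ : ∃ p, ψ.toDiffeo p = q :=
    ⟨ψ.toDiffeo.symm q, ψ.toDiffeo.apply_symm_apply q⟩
  rw [ψ.act_push]
  change act (vbracket X.1 Y.1) (f.comp ψ.map) p =
    act (vbracket (ψ.push X).1 (ψ.push Y).1) f (ψ.toDiffeo p)
  rw [act_vbracket, act_vbracket, ψ.act_push, ψ.act_push, ψ.act_push_comp, ψ.act_push_comp]

/-- Pull-back of a `b`-form of degree one by a `b`-diffeomorphism. -/
noncomputable def pullOne (ψ : BDiffeo D) (α : BOneForm D) : BOneForm D where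
  toFun X := (α (ψ.push X)).comp ψ.map
  map_add' X Y := by
    rw [ψ.push_add, map_add]
    rfl
  map_smul' f X := by
    rw [ψ.push_smul, map_smul]
    ext p
    change f (ψ.toDiffeo.symm (ψ.toDiffeo p)) * _ = _
    rw [ψ.toDiffeo.symm_apply_apply]
    rfl

lemma pullOne_apply (ψ : BDiffeo D) (α : BOneForm D) (X : BField D) (p : S) :
    ψ.pullOne α X p = α (ψ.push X) (ψ.toDiffeo p) := rfl

lemma bdOne_pullOne [T2Space S] (ψ : BDiffeo D) (α : BOneForm D) (X Y : BField D) (p : S) :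
    bdOne (ψ.pullOne α) X Y p = bdOne α (ψ.push X) (ψ.push Y) (ψ.toDiffeo p) := by
  change act X.1 ((α (ψ.push Y)).comp ψ.map) p - act Y.1 ((α (ψ.push X)).comp ψ.map) p -
      α (ψ.push (bbracket X Y)) (ψ.toDiffeo p) =
    act (ψ.push X).1 (α (ψ.push Y)) (ψ.toDiffeo p) - act (ψ.push Y).1 (α (ψ.push X)) (ψ.toDiffeo p)
      - α (bbracket (ψ.push X) (ψ.push Y)) (ψ.toDiffeo p)
  rw [ψ.push_bbracket, ψ.act_push, ψ.act_push]

end BDiffeo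

namespace BIsotopy

/-- A function pulled back by an isotopy. -/
noncomputable def pullFn (γ : BIsotopy D) (a : SmoothFn S) : TimeFn S :=
  ⟨fun z => a ((γ.at_time z.1).toDiffeo z.2), a.contMDiff.comp γ.smooth⟩

lemma act_pullFn (γ : BIsotopy D) (a : SmoothFn S) (X : BField D) (t : ℝ) (p : S) :
    TimeFn.act X.1 (γ.pullFn a) (t, p) =
      act ((γ.at_time t).push X).1 a ((γ.at_time t).toDiffeo p) := by
  rw [TimeFn.act_apply, BDiffeo.act_push]
  rfl

/-- `V` is the velocity field of the isotopy at time `t`. -/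
def IsVelocity (γ : BIsotopy D) (t : ℝ) (V : BField D) : Prop :=
  ∀ p, HasMFDerivAt 𝓘(ℝ, ℝ) (𝓡 2) (fun s => (γ.at_time s).toDiffeo p) t
    ((1 : ℝ →L[ℝ] ℝ).smulRight (V.1 ((γ.at_time t).toDiffeo p)))

lemma IsVelocity.dot_pullFn {γ : BIsotopy D} {t : ℝ} {V : BField D}
    (hV : γ.IsVelocity t V) (a : SmoothFn S) (p : S) :
    (γ.pullFn a).dot (t, p) = act V.1 a ((γ.at_time t).toDiffeo p) :=
  ((γ.pullFn a).hasDerivAt_dot t p).unique (hasDerivAt_comp_curve a (hV p))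

end BIsotopy

/-- The one-form `A (Ḃ dC - Ċ dB)` at time `t`: the contraction of the two-form `A dB ∧ dC` on the
product of the time axis with the surface by the time direction. -/
noncomputable def TimeFn.contraction (A B C : TimeFn S) (t : ℝ) (Z : VField S) : SmoothFn S :=
  A.slice t * (B.dot.slice t * StarLog.act Z (C.slice t) -
    C.dot.slice t * StarLog.act Z (B.slice t))

/-- Cartan's formula for `A dB ∧ dC` along the time direction. The left side of `hdet` is the
value of `dA ∧ dB ∧ dC` on the time direction, `X` and `Y`. -/
lemma TimeFn.hasDerivAt_mul_wedge (A B C : TimeFn S) (X Y : BField D) (t : ℝ) (p : S)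
    (hdet : A.dot (t, p) * (act X.1 B (t, p) * act Y.1 C (t, p) -
        act X.1 C (t, p) * act Y.1 B (t, p)) -
      act X.1 A (t, p) * (B.dot (t, p) * act Y.1 C (t, p) - C.dot (t, p) * act Y.1 B (t, p)) +
      act Y.1 A (t, p) * (B.dot (t, p) * act X.1 C (t, p) - C.dot (t, p) * act X.1 B (t, p)) = 0) :
    HasDerivAt (fun s => A (s, p) * wedge (B.slice s) (C.slice s) X Y p)
      (StarLog.act X.1 (contraction A B C t Y.1) p - StarLog.act Y.1 (contraction A B C t X.1) p -
        contraction A B C t (vbracket X.1 Y.1) p) t := by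
  have hderiv : HasDerivAt (fun s => A (s, p) *
      (act X.1 B (s, p) * act Y.1 C (s, p) - act X.1 C (s, p) * act Y.1 B (s, p))) _ t :=
    (A.hasDerivAt_dot t p).mul
      ((((act X.1 B).hasDerivAt_dot t p).mul ((act Y.1 C).hasDerivAt_dot t p)).sub
      (((act X.1 C).hasDerivAt_dot t p).mul ((act Y.1 B).hasDerivAt_dot t p)))
  simp only [act_apply] at hderiv
  refine hderiv.congr_deriv ?_
  simp only [contraction, ContMDiffMap.coe_mul, ContMDiffMap.coe_sub, Pi.mul_apply, Pi.sub_apply,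
    act_mul, act_sub, act_vbracket]
  simp only [dot_act, act_apply] at hdet ⊢
  simp only [slice_apply]
  linear_combination hdet

lemma det_plane_eq_zero (l m n : Plane →L[ℝ] ℝ) (u v w : Plane) :
    l u * (m v * n w - n v * m w) - l v * (m u * n w - n u * m w) +
      l w * (m u * n v - n u * m v) = 0 := by
  rw [clm_plane_apply l u, clm_plane_apply l v, clm_plane_apply l w, clm_plane_apply m u,
    clm_plane_apply m v, clm_plane_apply m w, clm_plane_apply n u, clm_plane_apply n v,
    clm_plane_apply n w]
  ring

/-- Cartan's formula. Off the divisor the form is locally `a db ∧ dc`, and `da ∧ db ∧ dc`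
vanishes on a surface. -/
theorem BIsotopy.hasDerivAt_pull [T2Space S] (γ : BIsotopy D) {t : ℝ} {V : BField D}
    (hV : γ.IsVelocity t V) {η : BBilin D} (alt : ∀ X, η X X = 0) {p : S} (hp : p ∈ D.compl)
    (X Y : BField D) :
    HasDerivAt (fun s => (γ.at_time s).pull η X Y p)
      (bdOne ((γ.at_time t).pullOne (η V)) X Y p) t := by
  obtain ⟨a, b, c, h⟩ := exists_eq_mul_wedge alt ((γ.at_time t).mem_compl hp)
  set A := γ.pullFn a
  set B := γ.pullFn b
  set C := γ.pullFn c
  have hcont : Continuous fun z : ℝ × S => (γ.at_time z.1).toDiffeo z.2 := γ.smooth.continuous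
  have hpull : ∀ᶠ s in 𝓝 t, (γ.at_time s).pull η X Y p =
      A (s, p) * wedge (B.slice s) (C.slice s) X Y p := by
    filter_upwards [(hcont.comp (Continuous.prodMk_left p)).continuousAt.eventually h] with s hs
    exact (hs _ _).trans (congrArg _ ((γ.at_time s).wedge_push b c X Y p))
  have hpullOne : ∀ Z : BField D, ∀ᶠ q in 𝓝 p, (γ.at_time t).pullOne (η V) Z q =
      TimeFn.contraction A B C t Z.1 q := fun Z => by
    filter_upwards [(hcont.comp (Continuous.prodMk_right t)).continuousAt.eventually h] with q hq
    change η V ((γ.at_time t).push Z) ((γ.at_time t).toDiffeo q) = A (t, q) *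
      (B.dot (t, q) * act Z.1 (C.slice t) q - C.dot (t, q) * act Z.1 (B.slice t) q)
    rw [hV.dot_pullFn, hV.dot_pullFn, ← TimeFn.act_apply, ← TimeFn.act_apply, γ.act_pullFn,
      γ.act_pullFn]
    exact hq _ _
  have hbdOne : bdOne ((γ.at_time t).pullOne (η V)) X Y p =
      act X.1 (TimeFn.contraction A B C t Y.1) p - act Y.1 (TimeFn.contraction A B C t X.1) p -
        TimeFn.contraction A B C t (vbracket X.1 Y.1) p :=
    congrArg₂ (· - ·) (congrArg₂ (· - ·) (act_congr X.1 (hpullOne Y)) (act_congr Y.1 (hpullOne X)))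
      (hpullOne (bbracket X Y)).self_of_nhds
  rw [hbdOne]
  refine (TimeFn.hasDerivAt_mul_wedge A B C X Y t p ?_).congr_of_eventuallyEq hpull
  simp only [A, B, C, γ.act_pullFn, hV.dot_pullFn]
  exact det_plane_eq_zero (mvfderiv (𝓡 2) a ((γ.at_time t).toDiffeo p))
    (mvfderiv (𝓡 2) b ((γ.at_time t).toDiffeo p)) (mvfderiv (𝓡 2) c ((γ.at_time t).toDiffeo p))
    (V.1 _) (((γ.at_time t).push X).1 _) (((γ.at_time t).push Y).1 _)

end Pull

lemma eventually_eq_zero_of_hasDerivAt_mul {y m : ℝ → ℝ} {t : ℝ} (hm : ContinuousAt m t)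
    (hy : ∀ᶠ s in 𝓝 t, HasDerivAt y (m s * y s) s) (h₀ : y t = 0) : ∀ᶠ s in 𝓝 t, y s = 0 := by
  have hbound : ∀ᶠ s in 𝓝 t, ‖m s‖₊ < ‖m t‖₊ + 1 :=
    hm.nnnorm.eventually_lt continuousAt_const (lt_add_one _)
  refine ODE_solution_unique_of_eventually (v := fun s x => m s * x) (s := fun _ => Set.univ)
    (K := ‖m t‖₊ + 1) (g := fun _ => 0) ?_ (hy.mono fun s hs => ⟨hs, trivial⟩)
    (Filter.Eventually.of_forall fun s => ⟨by simpa using hasDerivAt_const s (0 : ℝ), trivial⟩) h₀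
  filter_upwards [hbound] with s hs
  refine LipschitzWith.lipschitzOnWith (LipschitzWith.of_dist_le_mul fun a b => ?_)
  rw [Real.dist_eq, Real.dist_eq, ← mul_sub, abs_mul]
  gcongr
  exact_mod_cast hs.le

section Flow

variable {S : Type*} [TopologicalSpace S] [ChartedSpace Plane S]

variable [IsManifold (𝓡 2) ∞ S] {D : StarDivisor S}

/-- The tangency condition makes `u ∘ q`, for a local equation `u` of the curve, the solution of a
linear differential equation. -/
lemma mem_curve_of_mem_curve [T2Space S] (v : BField D) (i : Fin D.card) {q : ℝ → S} {a : ℝ → ℝ}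
    (ha : Continuous a) (hq : ∀ t, HasMFDerivAt 𝓘(ℝ, ℝ) (𝓡 2) q t
      ((1 : ℝ →L[ℝ] ℝ).smulRight (a t • v.1 (q t)))) {s : ℝ} (hs : q s ∈ D.curve i) (t : ℝ) :
    q t ∈ D.curve i := by
  have hcont : Continuous q := continuous_iff_continuousAt.2 fun t => (hq t).continuousAt
  suffices h : IsClopen (q ⁻¹' D.curve i) from
    h.eq_univ ⟨s, hs⟩ |>.ge (Set.mem_univ t)
  refine ⟨(D.isClosed i).preimage hcont, isOpen_iff_mem_nhds.2 fun t ht => ?_⟩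
  obtain ⟨C⟩ := exists_starChart D (q t)
  obtain ⟨u, hu, hu_zero⟩ := exists_chart_coord C.mem_maximalAtlas C.mem_source (C.l i)
  have hu_curve : ∀ r ∈ D.curve i, u r = 0 := fun r hr =>
    hu_zero r fun hrs => (C.mem_curve_iff i ht r hrs).1 hr
  obtain ⟨χ, hχ, hdiv⟩ := C.exists_isQuotient ht
  obtain ⟨k, hk, -⟩ := hdiv (act v.1 u) fun r hr => v.2 i r hr u hu_curve
  have hnear := hcont.continuousAt.eventually (hu.and hχ)
  have hode : ∀ᶠ s in 𝓝 t, HasDerivAt (fun s => u (q s)) ((a s * k (q s)) * u (q s)) s := by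
    filter_upwards [hnear] with s ⟨⟨hs_source, hus, _⟩, hχs⟩
    refine (hasDerivAt_comp_curve u (hq s)).congr_deriv ?_
    have hks : (χ * act v.1 u) (q s) = C.l i (C.φ (q s)) * k (q s) := hk (q s) hs_source
    rw [ContMDiffMap.coe_mul, Pi.mul_apply, hχs, one_mul, act_apply, ← hus] at hks
    rw [map_smul, hks, smul_eq_mul]
    ring
  filter_upwards [hnear, eventually_eq_zero_of_hasDerivAt_mul
    (ha.mul (k.contMDiff.continuous.comp hcont)).continuousAt hode (hu_curve _ ht)]
    with s ⟨⟨hs_source, hus, _⟩, _⟩ hs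
  exact (C.mem_curve_iff i ht _ hs_source).2 (hus ▸ hs)

/-- The vector field `∂_t + h X` on the product of the time axis with the surface. Its flow is the
way to integrate the time-dependent vector field `h X`. -/
noncomputable def TimeFn.suspension (h : TimeFn S) (X : VField S) (z : ℝ × S) :
    TangentSpace (𝓘(ℝ, ℝ).prod (𝓡 2)) z :=
  ((1 : ℝ), h z • X z.2)

lemma TimeFn.contMDiff_suspension (h : TimeFn S) (X : VField S) :
    ContMDiff (𝓘(ℝ, ℝ).prod (𝓡 2)) (𝓘(ℝ, ℝ).prod (𝓡 2)).tangent ∞ fun z : ℝ × S =>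
      (⟨z, h.suspension X z⟩ : TangentBundle (𝓘(ℝ, ℝ).prod (𝓡 2)) (ℝ × S)) :=
  contMDiff_prod_section_smul h.contMDiff X

lemma TimeFn.isMIntegralCurveOn_suspension_of_eq_zero {h : TimeFn S} (X : VField S) {t : ℝ} {p : S}
    {s : Set ℝ} (hs : ∀ r ∈ s, h (t + r, p) = 0) :
    IsMIntegralCurveOn (fun r => (t + r, p)) (h.suspension X) s := by
  intro r hr
  have htime : HasMFDerivAt 𝓘(ℝ, ℝ) 𝓘(ℝ, ℝ) (fun r : ℝ => t + r) r
      (ContinuousLinearMap.id ℝ ℝ) :=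
    ((hasFDerivAt_id r).const_add t).hasMFDerivAt
  refine ((htime.prodMk (hasMFDerivAt_const p r)).congr_mfderiv
    (ContinuousLinearMap.ext_ring (Prod.ext ?_ ?_))).hasMFDerivWithinAt
  · exact (one_smul ℝ (1 : ℝ)).symm
  · change (0 : TangentSpace (𝓡 2) p) = (1 : ℝ) • (h (t + r, p) • X p)
    rw [hs r hr, zero_smul, smul_zero]

/-- By compactness the flow exists for a uniform time near the interval where `h` is supported, and
elsewhere the curves are stationary in the surface. -/
lemma TimeFn.exists_flow [T2Space S] [CompactSpace S] (h : TimeFn S) (X : VField S)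
    (h₀ : ∀ t p, t ≤ 0 ∨ 1 ≤ t → h (t, p) = 0) :
    ∃ Γ : ℝ × (ℝ × S) → ℝ × S, (∀ z, Γ (0, z) = z) ∧
      ∀ z, IsMIntegralCurve (fun t => Γ (t, z)) (h.suspension X) := by
  have hsmooth := (h.contMDiff_suspension X).of_le (show 1 ≤ ∞ by simp)
  obtain ⟨ε, hε, hlocal⟩ := exists_isMIntegralCurveOn_Ioo_of_isCompact hsmooth
    ((isCompact_Icc (a := (-1 : ℝ)) (b := 2)).prod (isCompact_univ (X := S)))
  have huniform : ∀ z : ℝ × S, ∃ c : ℝ → ℝ × S, c 0 = z ∧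
      IsMIntegralCurveOn c (h.suspension X) (Set.Ioo (-(min ε 1)) (min ε 1)) := by
    rintro ⟨t, p⟩
    by_cases ht : t ∈ Set.Icc (-1 : ℝ) 2
    · obtain ⟨c, hc₀, hc⟩ := hlocal (t, p) ⟨ht, Set.mem_univ p⟩
      exact ⟨c, hc₀, hc.mono
        (Set.Ioo_subset_Ioo (neg_le_neg (min_le_left _ _)) (min_le_left _ _))⟩
    · refine ⟨fun r => (t + r, p), by simp,
        isMIntegralCurveOn_suspension_of_eq_zero X fun r hr => h₀ _ _ ?_⟩
      have hr' := abs_lt.1 ((abs_lt.2 hr).trans_le (min_le_right ε 1))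
      rw [Set.mem_Icc, not_and_or, not_le, not_le] at ht
      exact ht.imp (fun ht => by linarith) fun ht => by linarith
  choose Γ hΓ₀ hΓ using exists_isMIntegralCurve_of_isMIntegralCurveOn hsmooth
    (lt_min hε one_pos) huniform
  exact ⟨fun z => Γ z.2 z.1, hΓ₀, hΓ⟩

section Suspension

variable {h : TimeFn S} {X : VField S} {c : ℝ → ℝ × S}

lemma TimeFn.fst_of_isMIntegralCurve_suspension (hc : IsMIntegralCurve c (h.suspension X)) (s : ℝ) :
    (c s).1 = (c 0).1 + s := by
  have hderiv : ∀ s, HasDerivAt (fun s => (c s).1 - s) 0 s := fun s => by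
    have hfst : HasFDerivAt (fun s => (c s).1) (ContinuousLinearMap.id ℝ ℝ) s :=
      HasMFDerivAt.hasFDerivAt <|
        ((hasMFDerivAt_fst (I := 𝓘(ℝ, ℝ)) (I' := 𝓡 2) (c s)).comp s (hc s)).congr_mfderiv
          (ContinuousLinearMap.ext_ring (one_smul ℝ (1 : ℝ)))
    exact (hfst.hasDerivAt.sub (hasDerivAt_id s)).congr_deriv (sub_self 1)
  have hconst := is_const_of_deriv_eq_zero (fun s => (hderiv s).differentiableAt)
    (fun s => (hderiv s).deriv) s 0
  linarith

lemma TimeFn.hasMFDerivAt_snd_of_isMIntegralCurve_suspension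
    (hc : IsMIntegralCurve c (h.suspension X)) (hc₀ : (c 0).1 = 0) (t : ℝ) :
    HasMFDerivAt 𝓘(ℝ, ℝ) (𝓡 2) (fun s => (c s).2) t
      ((1 : ℝ →L[ℝ] ℝ).smulRight (h (t, (c t).2) • X (c t).2)) := by
  have htime : (t, (c t).2) = c t :=
    Prod.ext (by rw [fst_of_isMIntegralCurve_suspension hc, hc₀, zero_add]) rfl
  rw [htime]
  exact ((hasMFDerivAt_snd (I := 𝓘(ℝ, ℝ)) (I' := 𝓡 2) (c t)).comp t (hc t)).congr_mfderiv
    (ContinuousLinearMap.ext_ring rfl)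

end Suspension

/-- The diffeomorphism of the surface that a complete flow of `∂_t + h X` induces between the
times `0` and `t`. -/
noncomputable def TimeFn.flowDiffeo {h : TimeFn S} {X : VField S} {Γ : ℝ × (ℝ × S) → ℝ × S}
    [T2Space S] (hΓ₀ : ∀ z, Γ (0, z) = z)
    (hΓ : ∀ z, IsMIntegralCurve (fun t => Γ (t, z)) (h.suspension X)) (t : ℝ) :
    S ≃ₘ⟮𝓡 2, 𝓡 2⟯ S :=
  have hsmooth := contMDiff_flow (h.contMDiff_suspension X) hΓ₀ hΓ
  have hgroup := flow_add ((h.contMDiff_suspension X).of_le (show 1 ≤ ∞ by simp)) hΓ₀ hΓ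
  have hsnd : ∀ s r p, (r + s, (Γ (s, (r, p))).2) = Γ (s, (r, p)) := fun s r p =>
    Prod.ext (by simp [fst_of_isMIntegralCurve_suspension (hΓ (r, p)) s, hΓ₀]) rfl
  { toFun := fun p => (Γ (t, (0, p))).2
    invFun := fun q => (Γ (-t, (t, q))).2
    left_inv := fun p => by
      have hcancel := hsnd t 0 p
      rw [zero_add] at hcancel
      beta_reduce
      rw [hcancel, ← hgroup, neg_add_cancel, hΓ₀]
    right_inv := fun q => by
      have hcancel := hsnd (-t) t q
      rw [add_neg_cancel] at hcancel
      beta_reduce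
      rw [hcancel, ← hgroup, add_neg_cancel, hΓ₀]
    contMDiff_toFun := contMDiff_snd.comp
      (hsmooth.comp (contMDiff_const.prodMk (contMDiff_const.prodMk contMDiff_id)))
    contMDiff_invFun := contMDiff_snd.comp
      (hsmooth.comp (contMDiff_const.prodMk (contMDiff_const.prodMk contMDiff_id))) }

theorem exists_bIsotopy_isVelocity_smul [T2Space S] [CompactSpace S] (v : BField D) (h : TimeFn S)
    (h₀ : ∀ t p, t ≤ 0 ∨ 1 ≤ t → h (t, p) = 0) :
    ∃ γ : BIsotopy D, ∀ t, γ.IsVelocity t (h.slice t • v) := by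
  obtain ⟨Γ, hΓ₀, hΓ⟩ := h.exists_flow v.1 h₀
  have hvel : ∀ p t, HasMFDerivAt 𝓘(ℝ, ℝ) (𝓡 2) (fun s => (Γ (s, (0, p))).2) t
      ((1 : ℝ →L[ℝ] ℝ).smulRight (h (t, (Γ (t, (0, p))).2) • v.1 (Γ (t, (0, p))).2)) := fun p =>
    TimeFn.hasMFDerivAt_snd_of_isMIntegralCurve_suspension (hΓ (0, p)) (by rw [hΓ₀])
  have hmem : ∀ i p s t, (Γ (s, (0, p))).2 ∈ D.curve i → (Γ (t, (0, p))).2 ∈ D.curve i :=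
    fun i p s t hs =>
      have hcont : Continuous fun s => (Γ (s, (0, p))).2 :=
        continuous_iff_continuousAt.2 fun s => (hvel p s).continuousAt
      mem_curve_of_mem_curve v i (h.contMDiff.continuous.comp (continuous_id.prodMk hcont))
        (hvel p) hs t
  have himage : ∀ t i, TimeFn.flowDiffeo hΓ₀ hΓ t '' D.curve i = D.curve i := fun t i => by
    refine (Set.image_subset_iff.2 fun p hp => ?_).antisymm fun q hq => ?_
    · exact hmem i p 0 t (by simpa only [hΓ₀] using hp)
    · obtain ⟨p, rfl⟩ : ∃ p, TimeFn.flowDiffeo hΓ₀ hΓ t p = q :=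
        ⟨_, (TimeFn.flowDiffeo hΓ₀ hΓ t).apply_symm_apply q⟩
      exact ⟨p, by simpa only [hΓ₀] using hmem i p t 0 hq, rfl⟩
  refine ⟨⟨fun t => ⟨TimeFn.flowDiffeo hΓ₀ hΓ t, himage t⟩, ?_, fun p => ?_⟩, fun t p => hvel p t⟩
  · exact contMDiff_snd.comp ((contMDiff_flow (h.contMDiff_suspension v.1) hΓ₀ hΓ).comp
      (contMDiff_fst.prodMk (contMDiff_const.prodMk contMDiff_snd)))
  · exact congrArg Prod.snd (hΓ₀ (0, p))

end Flow

lemma deriv_smoothTransition_eq_zero {t : ℝ} (ht : t ≤ 0 ∨ 1 ≤ t) :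
    deriv Real.smoothTransition t = 0 := by
  rcases ht with ht | ht
  · refine IsLocalMin.deriv_eq_zero (Filter.Eventually.of_forall fun s => ?_)
    rw [Real.smoothTransition.zero_of_nonpos ht]
    exact Real.smoothTransition.nonneg s
  · refine IsLocalMax.deriv_eq_zero (Filter.Eventually.of_forall fun s => ?_)
    rw [Real.smoothTransition.one_of_one_le ht]
    exact Real.smoothTransition.le_one s

lemma moserDensity_pos {a : ℝ} (ha : 0 < a) (t : ℝ) :
    0 < (1 - Real.smoothTransition t) * a + Real.smoothTransition t := by
  have hpos := Real.smoothTransition.nonneg t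
  rcases (Real.smoothTransition.le_one t).eq_or_lt with h | h
  · rw [h]
    norm_num
  · have := mul_pos (sub_pos.2 h) ha
    linarith

section Moser

variable {S : Type*} [TopologicalSpace S] [ChartedSpace Plane S] {D : StarDivisor S}

open Real (smoothTransition)

/-- The speed `-τ' / ((1 - τ) f + τ)` of Moser's isotopy, where `τ` is a smooth step from `0` to
`1`. If `ω₀ = f ω₁`, the forms `(1 - τ) ω₀ + τ ω₁` on the path from `ω₀` to `ω₁` are the multiples
of `ω₁` by the denominator. -/
noncomputable def moserSpeed (f : SmoothFn S) (hf : ∀ p, 0 < f p) : TimeFn S :=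
  ⟨fun z => -deriv smoothTransition z.1 /
    ((1 - smoothTransition z.1) * f z.2 + smoothTransition z.1), by
    have hτ : ContDiff ℝ ∞ smoothTransition := smoothTransition.contDiff (n := ⊤)
    have hstep : ContMDiff (𝓘(ℝ, ℝ).prod (𝓡 2)) 𝓘(ℝ, ℝ) ∞
        fun z : ℝ × S => smoothTransition z.1 := hτ.contMDiff.comp contMDiff_fst
    have hderiv : ContMDiff (𝓘(ℝ, ℝ).prod (𝓡 2)) 𝓘(ℝ, ℝ) ∞
        fun z : ℝ × S => -deriv smoothTransition z.1 :=
      (contDiff_infty_iff_deriv.1 hτ).2.neg.contMDiff.comp contMDiff_fst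
    exact hderiv.div₀
      (((contMDiff_const.sub hstep).mul (f.contMDiff.comp contMDiff_snd)).add hstep)
      fun z => (moserDensity_pos (hf z.2) z.1).ne'⟩

lemma moserSpeed_mul (f : SmoothFn S) (hf : ∀ p, 0 < f p) (t : ℝ) (p : S) :
    ((1 - smoothTransition t) * f p + smoothTransition t) * moserSpeed f hf (t, p) =
      -deriv smoothTransition t :=
  mul_div_cancel₀ _ (moserDensity_pos (hf p) t).ne'

lemma moserSpeed_eq_zero (f : SmoothFn S) (hf : ∀ p, 0 < f p) {t : ℝ} (ht : t ≤ 0 ∨ 1 ≤ t) (p : S) :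
    moserSpeed f hf (t, p) = 0 := by
  change -deriv smoothTransition t / _ = 0
  rw [deriv_smoothTransition_eq_zero ht, neg_zero, zero_div]

lemma eq_of_forall_mem_compl_eq (D : StarDivisor S) {f g : SmoothFn S}
    (h : ∀ p ∈ D.compl, f p = g p) : f = g :=
  DFunLike.coe_injective (Continuous.ext_on D.dense_compl f.contMDiff.continuous
    g.contMDiff.continuous h)

variable [IsManifold (𝓡 2) ∞ S]

lemma act_add (X : VField S) (f g : SmoothFn S) (p : S) :
    act X (f + g) p = act X f p + act X g p := by
  rw [act_apply, ContMDiffMap.coe_add, mvfderiv_add f.mdifferentiableAt g.mdifferentiableAt]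
  rfl

lemma act_smul (X : VField S) (c : ℝ) (f : SmoothFn S) (p : S) :
    act X (c • f) p = c * act X f p := by
  rw [act_apply, ContMDiffMap.coe_smul]
  exact DFunLike.congr_fun (const_smul_mfderiv f.mdifferentiableAt c) (X p)

/-- The differential of one-forms, evaluated at two sections and a point, as a real linear form. -/
noncomputable def bdOneAt (X Y : BField D) (p : S) : BOneForm D →ₗ[ℝ] ℝ where
  toFun α := bdOne α X Y p
  map_add' α β := by
    change act X.1 (α Y + β Y) p - act Y.1 (α X + β X) p -
      (α (bbracket X Y) p + β (bbracket X Y) p) =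
        (act X.1 (α Y) p - act Y.1 (α X) p - α (bbracket X Y) p) +
          (act X.1 (β Y) p - act Y.1 (β X) p - β (bbracket X Y) p)
    rw [act_add, act_add]
    ring
  map_smul' c α := by
    change act X.1 (c • α Y) p - act Y.1 (c • α X) p - c * α (bbracket X Y) p =
      c * (act X.1 (α Y) p - act Y.1 (α X) p - α (bbracket X Y) p)
    rw [act_smul, act_smul]
    ring

lemma moserSpeed_contraction {ω₀ ω₁ : LogSymplecticForm D} {f : SmoothFn S} (hf : ∀ p, 0 < f p)
    (hform : ω₀.form = f • ω₁.form) (v : BField D) (t : ℝ) :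
    (1 - smoothTransition t) • ω₀.form ((moserSpeed f hf).slice t • v) +
      smoothTransition t • ω₁.form ((moserSpeed f hf).slice t • v) +
        deriv smoothTransition t • ω₁.form v = 0 := by
  ext Z q
  rw [hform, LinearMap.smul_apply, map_smul]
  change (1 - smoothTransition t) * (f q * (moserSpeed f hf (t, q) * ω₁.form v Z q)) +
    smoothTransition t * (moserSpeed f hf (t, q) * ω₁.form v Z q) +
      deriv smoothTransition t * ω₁.form v Z q = 0
  linear_combination ω₁.form v Z q * moserSpeed_mul f hf t q

variable [T2Space S]

/-- By Cartan's formula the derivative is the pull-back of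
`d ((1 - τ) ω₀ + τ ω₁)(V) + τ' (ω₁ - ω₀)`. -/
lemma BIsotopy.hasDerivAt_pull_segment (γ : BIsotopy D) {ω₀ ω₁ : LogSymplecticForm D}
    {α : BOneForm D} (hα : ∀ X Y, ω₁.form X Y - ω₀.form X Y = bdOne α X Y) {V : BField D}
    {τ : ℝ → ℝ} {τ' t : ℝ} (hτ : HasDerivAt τ τ' t) (hV : γ.IsVelocity t V)
    (hαV : (1 - τ t) • ω₀.form V + τ t • ω₁.form V + τ' • α = 0) {p : S} (hp : p ∈ D.compl)
    (X Y : BField D) :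
    HasDerivAt (fun s => (γ.at_time s).pull ω₀.form X Y p +
      τ s * ((γ.at_time s).pull ω₁.form X Y p - (γ.at_time s).pull ω₀.form X Y p)) 0 t := by
  have hderiv₀ := γ.hasDerivAt_pull hV ω₀.alt hp X Y
  have hderiv₁ := γ.hasDerivAt_pull hV ω₁.alt hp X Y
  refine (hderiv₀.add (hτ.mul (hderiv₁.sub hderiv₀))).congr_deriv ?_
  set ψ := γ.at_time t
  set d := bdOneAt (ψ.push X) (ψ.push Y) (ψ.toDiffeo p)
  have hdα : ψ.pull ω₁.form X Y p - ψ.pull ω₀.form X Y p = d α :=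
    DFunLike.congr_fun (hα (ψ.push X) (ψ.push Y)) (ψ.toDiffeo p)
  have hdV : (1 - τ t) * d (ω₀.form V) + τ t * d (ω₁.form V) + τ' * d α = 0 := by
    simpa only [map_add, map_smul, smul_eq_mul, map_zero] using congrArg d hαV
  rw [ψ.bdOne_pullOne, ψ.bdOne_pullOne]
  change d (ω₀.form V) + (τ' * (ψ.pull ω₁.form X Y p - ψ.pull ω₀.form X Y p) +
    τ t * (d (ω₁.form V) - d (ω₀.form V))) = 0
  rw [hdα]
  linear_combination hdV

lemma BDiffeo.push_eq_self (ψ : BDiffeo D) (h : ∀ p, ψ.toDiffeo p = p) (X : BField D) :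
    ψ.push X = X := by
  refine Subtype.ext (VField.ext_act fun f p => ?_)
  have hcomp : f.comp ψ.map = f := ContMDiffMap.ext fun q => congrArg f (h q)
  have hact := ψ.act_push X f p
  rwa [h p, hcomp] at hact

lemma BDiffeo.pull_eq_self (ψ : BDiffeo D) (h : ∀ p, ψ.toDiffeo p = p)
    (η : BBilin D) (X Y : BField D) (p : S) : ψ.pull η X Y p = η X Y p := by
  change η (ψ.push X) (ψ.push Y) (ψ.toDiffeo p) = η X Y p
  rw [ψ.push_eq_self h, ψ.push_eq_self h, h]

theorem bSymplectomorphic_of_cohomologous [CompactSpace S] {ω₀ ω₁ : LogSymplecticForm D}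
    (hc : Cohomologous ω₀ ω₁) (ho : SameOrientation ω₀ ω₁) : BSymplectomorphic ω₀ ω₁ := by
  obtain ⟨α, hα⟩ := hc
  obtain ⟨f, hf, hform⟩ := ho
  obtain ⟨v, rfl⟩ := ω₁.nondegenerate.surjective α
  obtain ⟨γ, hγ⟩ := exists_bIsotopy_isVelocity_smul v (moserSpeed f hf)
    fun t p ht => moserSpeed_eq_zero f hf ht p
  refine ⟨γ, fun X Y => eq_of_forall_mem_compl_eq D fun p hp => ?_⟩
  have hτ : Differentiable ℝ smoothTransition :=
    (smoothTransition.contDiff (n := 1)).differentiable one_ne_zero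
  have hderiv := fun t => γ.hasDerivAt_pull_segment hα (hτ t).hasDerivAt (hγ t)
    (moserSpeed_contraction hf hform v t) hp X Y
  have hconst := is_const_of_deriv_eq_zero (fun s => (hderiv s).differentiableAt)
    (fun s => (hderiv s).deriv) 1 0
  rw [smoothTransition.one, smoothTransition.zero, one_mul, zero_mul, add_zero,
    add_sub_cancel] at hconst
  exact hconst.trans ((γ.at_time 0).pull_eq_self γ.start ω₀.form X Y p)

end Moser

section Velocity

variable {S : Type*} [TopologicalSpace S] [ChartedSpace Plane S] {D : StarDivisor S}

/-- The velocity at time `t` of the isotopy, along the image of `p`. -/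
noncomputable def BIsotopy.velocity (γ : BIsotopy D) (t : ℝ) (p : S) :
    TangentSpace (𝓡 2) ((γ.at_time t).toDiffeo p) :=
  mfderiv (𝓘(ℝ, ℝ).prod (𝓡 2)) (𝓡 2) (fun z : ℝ × S => (γ.at_time z.1).toDiffeo z.2) (t, p)
    ((1 : ℝ), (0 : TangentSpace (𝓡 2) p))

lemma BIsotopy.hasMFDerivAt_velocity (γ : BIsotopy D) (t : ℝ) (p : S) :
    HasMFDerivAt 𝓘(ℝ, ℝ) (𝓡 2) (fun s => (γ.at_time s).toDiffeo p) t
      ((1 : ℝ →L[ℝ] ℝ).smulRight (γ.velocity t p)) := by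
  have hslice : HasMFDerivAt 𝓘(ℝ, ℝ) (𝓘(ℝ, ℝ).prod (𝓡 2)) (fun s : ℝ => (s, p)) t
      ((ContinuousLinearMap.id ℝ (TangentSpace 𝓘(ℝ, ℝ) t)).prod
        (0 : TangentSpace 𝓘(ℝ, ℝ) t →L[ℝ] TangentSpace (𝓡 2) p)) :=
    (hasMFDerivAt_id t).prodMk (hasMFDerivAt_const p t)
  refine ((γ.smooth.mdifferentiable (by simp) (t, p)).hasMFDerivAt.comp t hslice).congr_mfderiv
    (ContinuousLinearMap.ext_ring ?_)
  change γ.velocity t p = (1 : ℝ) • γ.velocity t p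
  rw [one_smul]

lemma BIsotopy.mvfderiv_velocity_eq_zero (γ : BIsotopy D) (t : ℝ) {i : Fin D.card} {p : S}
    (hp : p ∈ D.curve i) {f : SmoothFn S} (hf : ∀ q ∈ D.curve i, f q = 0) :
    mvfderiv (𝓡 2) f ((γ.at_time t).toDiffeo p) (γ.velocity t p) = 0 := by
  have hzero : (fun s => f ((γ.at_time s).toDiffeo p)) = fun _ => 0 :=
    funext fun s => hf _ (((γ.at_time s).mem_curve_iff i p).2 hp)
  have hderiv := hasDerivAt_comp_curve f (γ.hasMFDerivAt_velocity t p)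
  rw [hzero] at hderiv
  exact hderiv.unique (hasDerivAt_const t 0)

variable [IsManifold (𝓡 2) ∞ S]

theorem BIsotopy.exists_isVelocity (γ : BIsotopy D) (t : ℝ) : ∃ V : BField D, γ.IsVelocity t V := by
  set ψ := (γ.at_time t).toDiffeo
  have hsmooth : ContMDiff (𝓡 2) (𝓡 2).tangent ∞
      fun q => (⟨q, γ.velocity t (ψ.symm q)⟩ : TangentBundle (𝓡 2) S) := by
    have hmap := γ.smooth.contMDiff_tangentMap (m := ∞) (by simp)
    have hsymm : ContMDiff (𝓡 2) (𝓘(ℝ, ℝ).prod (𝓡 2)) ∞ fun q : S => (t, ψ.symm q) :=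
      contMDiff_const.prodMk ψ.symm.contMDiff
    exact ((hmap.comp (contMDiff_prod_section 1 (0 : VField S))).comp hsymm).congr fun q =>
      Bundle.TotalSpace.ext (ψ.apply_symm_apply q).symm HEq.rfl
  have hψ : ∀ p, (γ.velocity t (ψ.symm (ψ p)) : Plane) = γ.velocity t p := fun p => by
    rw [ψ.symm_apply_apply]
  refine ⟨⟨⟨fun q => γ.velocity t (ψ.symm q), hsmooth⟩, fun i q hq f hf => ?_⟩, fun p => ?_⟩
  · obtain ⟨p, rfl⟩ : ∃ p, ψ p = q := ⟨ψ.symm q, ψ.apply_symm_apply q⟩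
    exact (congrArg (mvfderiv (𝓡 2) f (ψ p)) (hψ p)).trans
      (γ.mvfderiv_velocity_eq_zero t (((γ.at_time t).mem_curve_iff i p).1 hq) hf)
  · exact (γ.hasMFDerivAt_velocity t p).congr_mfderiv
      (congrArg (fun w : Plane => (1 : ℝ →L[ℝ] ℝ).smulRight w) (hψ p).symm)

end Velocity

lemma exists_apply_eq_zero_and_eq_one {E : Type*} [TopologicalSpace E] [AddCommGroup E]
    [Module ℝ E] [IsTopologicalAddGroup E] [ContinuousSMul ℝ E] {l m : E →L[ℝ] ℝ}
    (h : LinearIndependent ℝ ![l, m]) : ∃ w, l w = 0 ∧ m w = 1 := by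
  obtain ⟨w, hl, hm⟩ : ∃ w, l w = 0 ∧ m w ≠ 0 := by
    by_contra! hker
    have hspan : (m : E →ₗ[ℝ] ℝ) ∈ Submodule.span ℝ (Set.range fun _ : Unit => (l : E →ₗ[ℝ] ℝ)) :=
      mem_span_of_iInf_ker_le_ker fun w hw => hker w (by simpa using hw)
    rw [Set.range_const, Submodule.mem_span_singleton] at hspan
    obtain ⟨c, hc⟩ := hspan
    exact (LinearIndependent.pair_iff' (h.ne_zero 0)).1 h c
      (ContinuousLinearMap.ext fun w => LinearMap.congr_fun hc w)
  exact ⟨(m w)⁻¹ • w, by rw [map_smul, hl, smul_zero], by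
    rw [map_smul, smul_eq_mul, inv_mul_cancel₀ hm]⟩

section Division

variable {S : Type*} [TopologicalSpace S] [ChartedSpace Plane S] {D : StarDivisor S} {p : S}

lemma StarChart.exists_contDiff_eq_prod_mul (C : StarChart D p) {s : Finset (Fin D.card)}
    (hs : ∀ i ∈ s, p ∈ D.curve i) (B : TimeFn S) {t : ℝ}
    (hB : ∀ᶠ z in 𝓝 (t, p), ∀ i ∈ s, z.2 ∈ D.curve i → B z = 0) :
    ∃ M : ℝ × Plane → ℝ, ContDiff ℝ ∞ M ∧ ∀ᶠ z in 𝓝 (t, p),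
      B z = (∏ i ∈ s, C.l i (C.φ z.2)) * M (z.1, C.φ z.2) := by
  have htarget : C.φ p ∈ C.φ.target := C.φ.map_source C.mem_source
  have hsymm : Filter.Tendsto (fun z : ℝ × Plane => (z.1, C.φ.symm z.2)) (𝓝 (t, C.φ p))
      (𝓝 (t, p)) :=
    continuousAt_fst.tendsto.prodMk_nhds
      ((C.φ.tendsto_symm C.mem_source).comp continuousAt_snd.tendsto)
  obtain ⟨χ, hχ, hχ_one, hχ_supp⟩ := exists_contDiff_cutoff
    ((continuousAt_snd.eventually (C.φ.open_target.mem_nhds htarget)).and (hsymm.eventually hB))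
  have hread : ContDiff ℝ ∞ fun z : ℝ × Plane => χ z * B.inChart C.φ z :=
    contDiff_mul_of_tsupport_subset hχ (isOpen_univ.prod C.φ.open_target)
      (fun z hz => ⟨trivial, (hχ_supp hz).1⟩) (B.contDiffOn_inChart C.mem_maximalAtlas)
  obtain ⟨M, hM, hdiv⟩ := exists_contDiff_eq_prod_mul_of_eq_zero s
    (l := fun i => (C.l i).comp (ContinuousLinearMap.snd ℝ ℝ Plane))
    (fun i hi h => C.l_ne_zero i (hs i hi) <| ContinuousLinearMap.ext fun x =>
      DFunLike.congr_fun h ((0 : ℝ), x))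
    (fun i hi j hj hij => by
      obtain ⟨w, hiw, hjw⟩ := exists_apply_eq_zero_and_eq_one
        (C.linearIndependent i j hij (hs i hi) (hs j hj))
      exact ⟨(0, w), hiw, hjw⟩)
    hread fun i hi z hz => by
      by_cases hzχ : z ∈ tsupport χ
      · obtain ⟨hz_target, hzB⟩ := hχ_supp hzχ
        have hcurve : C.φ.symm z.2 ∈ D.curve i := by
          rw [C.mem_curve_iff i (hs i hi) _ (C.φ.map_target hz_target), C.φ.right_inv hz_target]
          exact hz
        exact mul_eq_zero_of_right _ (hzB i hi hcurve)
      · rw [image_eq_zero_of_notMem_tsupport hzχ, zero_mul]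
  refine ⟨M, hM, ?_⟩
  have hchart : ContinuousAt (fun z : ℝ × S => (z.1, C.φ z.2)) (t, p) :=
    continuousAt_id.prodMap (C.φ.continuousAt C.mem_source)
  filter_upwards [hchart.eventually hχ_one,
    continuousAt_snd.eventually (C.φ.open_source.mem_nhds C.mem_source)] with z hz_one hz_source
  have hdiv_z := hdiv (z.1, C.φ z.2)
  simp only [hz_one, Pi.one_apply, one_mul, TimeFn.inChart, C.φ.left_inv hz_source] at hdiv_z
  exact hdiv_z

lemma StarChart.ne_zero_of_mvfderiv_ne_zero (C : StarChart D p) {i : Fin D.card} {f : SmoothFn S}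
    {M : Plane → ℝ} (hM : Differentiable ℝ M)
    (h : ∀ᶠ q in 𝓝 p, f q = C.l i (C.φ q) * M (C.φ q))
    {v : TangentSpace (𝓡 2) p} (hv : mvfderiv (𝓡 2) f p v ≠ 0) : M (C.φ p) ≠ 0 := by
  intro hM_zero
  refine hv ?_
  have hread : ⇑f ∘ C.φ.symm =ᶠ[𝓝 (C.φ p)] ⇑(C.l i) * M := by
    filter_upwards [(C.φ.tendsto_symm C.mem_source).eventually h,
      C.φ.open_target.mem_nhds (C.φ.map_source C.mem_source)] with x hx hx_target
    rwa [C.φ.right_inv hx_target] at hx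
  rw [mvfderiv_eq_fderiv_chart C.mem_maximalAtlas C.mem_source f.mdifferentiableAt,
    hread.fderiv_eq, ((C.l i).hasFDerivAt.mul (hM (C.φ p)).hasFDerivAt).fderiv, hM_zero, C.map_self,
    map_zero, zero_smul, zero_smul, add_zero, zero_apply]

lemma StarChart.contMDiffAt_comp_chart (C : StarChart D p) {g : ℝ × Plane → ℝ}
    (hg : ContDiff ℝ ∞ g) (t : ℝ) :
    ContMDiffAt (𝓘(ℝ, ℝ).prod (𝓡 2)) 𝓘(ℝ, ℝ) ∞ (fun z : ℝ × S => g (z.1, C.φ z.2)) (t, p) :=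
  hg.contMDiff.contMDiffAt.comp (t, p) (contMDiffAt_fst.prodMk_space
    ((contMDiffAt_of_mem_maximalAtlas C.mem_maximalAtlas C.mem_source).comp (t, p)
      contMDiffAt_snd))

lemma StarChart.wedge_eq_zero_of_mem_curve [IsManifold (𝓡 2) ∞ S] [T2Space S] (C : StarChart D p)
    {b c : SmoothFn S} {q : S} (hq : q ∈ C.φ.source)
    (harea : ∀ v w : TangentSpace (𝓡 2) q, mvfderiv (𝓡 2) b q v * mvfderiv (𝓡 2) c q w -
      mvfderiv (𝓡 2) c q v * mvfderiv (𝓡 2) b q w =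
        area (mvfderiv (𝓡 2) C.φ q v) (mvfderiv (𝓡 2) C.φ q w))
    {i : Fin D.card} (hqi : q ∈ D.curve i) (X Y : BField D) : wedge b c X Y q = 0 := by
  rw [wedge_apply, harea]
  exact area_eq_zero_of_mem_ker (C.l_ne_zero i (C.mem_curve_of_mem i q hq hqi))
    ((C.mem_tangentAlong_iff hq hqi _).1 (X.2 i q hqi))
    ((C.mem_tangentAlong_iff hq hqi _).1 (Y.2 i q hqi))

lemma contMDiffAt_of_eventually_eq_of_mem_compl [IsManifold (𝓡 2) ∞ S] {F R : ℝ × S → ℝ}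
    {z₀ : ℝ × S} (hF : ∀ t, Continuous fun q => F (t, q))
    (hR : ContMDiffAt (𝓘(ℝ, ℝ).prod (𝓡 2)) 𝓘(ℝ, ℝ) ∞ R z₀)
    (h : ∀ᶠ z in 𝓝 z₀, z.2 ∈ D.compl → F z = R z) :
    ContMDiffAt (𝓘(ℝ, ℝ).prod (𝓡 2)) 𝓘(ℝ, ℝ) ∞ F z₀ := by
  refine hR.congr_of_eventuallyEq ?_
  filter_upwards [h.eventually_nhds,
    (contMDiffAt_iff_contMDiffAt_nhds (by simp)).1 (hR.of_le zero_le)] with z hz hRz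
  have hslice : Filter.Tendsto (fun q => (z.1, q)) (𝓝 z.2) (𝓝 z) :=
    (Continuous.prodMk_right z.1).tendsto z.2
  exact eq_of_eventually_eq_of_dense D.dense_compl (f := fun q => F (z.1, q))
    (g := fun q => R (z.1, q)) (hF z.1).continuousAt (hRz.continuousAt.tendsto.comp hslice)
    (hslice.eventually hz)

end Division

section Contraction

variable {S : Type*} [TopologicalSpace S] [ChartedSpace Plane S] {D : StarDivisor S}

lemma BDiffeo.exists_mvfderiv_comp_ne_zero (ψ : BDiffeo D) {p : S} {f : SmoothFn S}
    {w : TangentSpace (𝓡 2) (ψ.toDiffeo p)} (hw : mvfderiv (𝓡 2) f (ψ.toDiffeo p) w ≠ 0) :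
    ∃ v : TangentSpace (𝓡 2) p, mvfderiv (𝓡 2) (f.comp ψ.map) p v ≠ 0 := by
  obtain ⟨v, rfl⟩ := (ψ.toDiffeo.mfderivToContinuousLinearEquiv (by simp) p).surjective w
  refine ⟨v, ne_of_eq_of_ne ?_ hw⟩
  exact mvfderiv_comp_apply_of_eq (I := 𝓡 2) p (f.mdifferentiableAt (x := ψ.toDiffeo p))
    (ψ.toDiffeo.contMDiff.mdifferentiable (by simp) p) rfl v

variable [IsManifold (𝓡 2) ∞ S]

namespace BIsotopy

variable {t : ℝ} {p : S} (γ : BIsotopy D)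

/-- The value of the pull-back of `db ∧ dc` to the product of the time axis with the surface on the
direction of time and `X`. -/
noncomputable def timeWedge (b c : SmoothFn S) (X : BField D) : TimeFn S :=
  (γ.pullFn b).dot * TimeFn.act X.1 (γ.pullFn c) - (γ.pullFn c).dot * TimeFn.act X.1 (γ.pullFn b)

lemma timeWedge_apply {V : BField D} (hV : γ.IsVelocity t V) (b c : SmoothFn S) (X : BField D)
    (p : S) : γ.timeWedge b c X (t, p) =
      wedge b c V ((γ.at_time t).push X) ((γ.at_time t).toDiffeo p) := by
  change (γ.pullFn b).dot (t, p) * TimeFn.act X.1 (γ.pullFn c) (t, p) -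
    (γ.pullFn c).dot (t, p) * TimeFn.act X.1 (γ.pullFn b) (t, p) = _
  rw [hV.dot_pullFn, hV.dot_pullFn, γ.act_pullFn, γ.act_pullFn]
  rfl

variable [T2Space S]

lemma exists_chart_apply_eq_mul (C' : StarChart D p)
    (C : StarChart D ((γ.at_time t).toDiffeo p)) {i : Fin D.card} (hi : p ∈ D.curve i) :
    ∃ m : ℝ × Plane → ℝ, ContDiff ℝ ∞ m ∧ m (t, C'.φ p) ≠ 0 ∧ ∀ᶠ z in 𝓝 (t, p),
      C.l i (C.φ ((γ.at_time z.1).toDiffeo z.2)) = C'.l i (C'.φ z.2) * m (z.1, C'.φ z.2) := by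
  have hi' := ((γ.at_time t).mem_curve_iff i p).2 hi
  obtain ⟨u, hu, hu_zero⟩ := exists_chart_coord C.mem_maximalAtlas C.mem_source (C.l i)
  have hu_curve : ∀ z : ℝ × S, z.2 ∈ D.curve i → γ.pullFn u z = 0 := fun z hz =>
    hu_zero _ fun hs => (C.mem_curve_iff i hi' _ hs).1 (((γ.at_time z.1).mem_curve_iff i z.2).2 hz)
  obtain ⟨m, hm, hdiv⟩ := C'.exists_contDiff_eq_prod_mul (s := {i}) (by simpa using hi)
    (γ.pullFn u) (t := t) (Filter.Eventually.of_forall fun z j hj => by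
      rw [Finset.mem_singleton] at hj
      exact hj ▸ hu_curve z)
  simp only [Finset.prod_singleton] at hdiv
  refine ⟨m, hm, ?_, ?_⟩
  · obtain ⟨x, hx⟩ := exists_apply_eq_one (C.l_ne_zero i hi')
    obtain ⟨w, hw⟩ := (bijective_mvfderiv_chart C.mem_maximalAtlas C.mem_source).2 x
    obtain ⟨v, hv⟩ := (γ.at_time t).exists_mvfderiv_comp_ne_zero (f := u) (w := w) (by
      rw [hu.self_of_nhds.2.2, hw, hx]
      exact one_ne_zero)
    exact C'.ne_zero_of_mvfderiv_ne_zero (M := fun x => m (t, x))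
      ((hm.comp (contDiff_prodMk_right t)).differentiable (by simp))
      ((Continuous.prodMk_right t).continuousAt.eventually hdiv) hv
  · filter_upwards [hdiv, γ.smooth.continuous.continuousAt.eventually hu] with z hz huz
    exact huz.2.1.symm.trans hz

lemma exists_prod_chart_apply_eq_mul (C' : StarChart D p)
    (C : StarChart D ((γ.at_time t).toDiffeo p)) :
    ∃ P : ℝ × Plane → ℝ, ContDiff ℝ ∞ P ∧ P (t, C'.φ p) ≠ 0 ∧ ∀ᶠ z in 𝓝 (t, p),
      ∏ i ∈ C'.curves, C.l i (C.φ ((γ.at_time z.1).toDiffeo z.2)) =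
        (∏ i ∈ C'.curves, C'.l i (C'.φ z.2)) * P (z.1, C'.φ z.2) := by
  choose! m hm hm_ne hdiv using fun i (hi : i ∈ C'.curves) =>
    γ.exists_chart_apply_eq_mul C' C (C'.mem_curves.1 hi)
  refine ⟨fun x => ∏ i ∈ C'.curves, m i x, contDiff_prod hm, Finset.prod_ne_zero_iff.2 hm_ne, ?_⟩
  filter_upwards [(Finset.eventually_all _).2 hdiv] with z hz
  rw [Finset.prod_congr rfl hz, Finset.prod_mul_distrib]

/-- In a frame `E`, `W` of the `b`-tangent bundle, `η(V, X)` is `η(E, W)` times the quotient of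
`db ∧ dc (V, X)` by `db ∧ dc (E, W)`, and both of these are smooth multiples of the equation of the
divisor. -/
theorem contMDiff_pullOne_velocity {V : ℝ → BField D}
    (hV : ∀ t, γ.IsVelocity t (V t)) {η : BBilin D} (alt : ∀ X, η X X = 0) (X : BField D) :
    ContMDiff (𝓘(ℝ, ℝ).prod (𝓡 2)) 𝓘(ℝ, ℝ) ∞
      fun z : ℝ × S => (γ.at_time z.1).pullOne (η (V z.1)) X z.2 := by
  rintro ⟨t, p⟩
  obtain ⟨C'⟩ := exists_starChart D p
  obtain ⟨C⟩ := exists_starChart D ((γ.at_time t).toDiffeo p)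
  obtain ⟨b, c, E, W, hframe⟩ := C.exists_frame
  have hframe' := (γ.smooth.continuous.continuousAt (x := (t, p))).eventually hframe
  have hcurves : C.curves = C'.curves := Finset.ext fun i => by
    rw [C.mem_curves, C'.mem_curves, (γ.at_time t).mem_curve_iff]
  have htime : ∀ z : ℝ × S, γ.timeWedge b c X z = _ := fun z => γ.timeWedge_apply (hV z.1) b c X z.2
  obtain ⟨M, hM, hdivM⟩ := C'.exists_contDiff_eq_prod_mul (fun i hi => C'.mem_curves.1 hi)
    (γ.timeWedge b c X) (t := t) (by
      filter_upwards [hframe'] with z ⟨hsource, harea, _⟩ i _ hzi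
      rw [htime]
      exact C.wedge_eq_zero_of_mem_curve hsource harea (((γ.at_time z.1).mem_curve_iff i z.2).2 hzi)
        _ _)
  obtain ⟨P, hP, hP_ne, hdivP⟩ := γ.exists_prod_chart_apply_eq_mul C' C
  have hsmooth := (((η E W).contMDiff.comp γ.smooth).contMDiffAt.mul
    (C'.contMDiffAt_comp_chart hM t)).div₀ (C'.contMDiffAt_comp_chart hP t) hP_ne
  refine contMDiffAt_of_eventually_eq_of_mem_compl (D := D)
    (fun s => ((γ.at_time s).pullOne (η (V s)) X).contMDiff.continuous) hsmooth ?_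
  filter_upwards [continuousAt_snd.eventually (C'.φ.open_source.mem_nhds C'.mem_source),
    (C'.contMDiffAt_comp_chart hP t).continuousAt.eventually_ne hP_ne, hdivP, hdivM, hframe']
    with z hz_source hz_ne hzP hzM ⟨_, _, hzEW⟩ hz
  have hprod_ne : ∏ i ∈ C'.curves, C'.l i (C'.φ z.2) ≠ 0 := Finset.prod_ne_zero_iff.2
    fun i hi h => hz i ((C'.mem_curve_iff i (C'.mem_curves.1 hi) _ hz_source).2 h)
  have hratio := (isAreaLike_bilin alt).mul_eq_mul (isAreaLike_wedge b c) (V z.1)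
    ((γ.at_time z.1).push X) E W ((γ.at_time z.1).toDiffeo z.2)
  rw [hzEW, ← htime, hzM, hcurves, hzP] at hratio
  rw [BDiffeo.pullOne_apply]
  refine (eq_div_iff hz_ne).2 (mul_left_cancel₀ hprod_ne ?_)
  change _ = _ * (η E W ((γ.at_time z.1).toDiffeo z.2) * M (z.1, C'.φ z.2))
  linear_combination hratio

end BIsotopy

end Contraction

section Homotopy

variable {S : Type*} [TopologicalSpace S] [ChartedSpace Plane S]

namespace TimeFn

lemma intervalIntegrable (B : TimeFn S) (p : S) (a b : ℝ) :
    IntervalIntegrable (fun t => B (t, p)) MeasureTheory.volume a b :=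
  (B.contMDiff.continuous.comp (Continuous.prodMk_left p)).intervalIntegrable a b

variable [IsManifold (𝓡 2) ∞ S]

lemma avg_add (A B : TimeFn S) : (A + B).avg = A.avg + B.avg :=
  ContMDiffMap.ext fun p =>
    intervalIntegral.integral_add (A.intervalIntegrable p 0 1) (B.intervalIntegrable p 0 1)

lemma avg_sub (A B : TimeFn S) : (A - B).avg = A.avg - B.avg :=
  ContMDiffMap.ext fun p =>
    intervalIntegral.integral_sub (A.intervalIntegrable p 0 1) (B.intervalIntegrable p 0 1)

end TimeFn

namespace BIsotopy

variable [IsManifold (𝓡 2) ∞ S] [T2Space S] {D : StarDivisor S} (γ : BIsotopy D)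
  {V : ℝ → BField D} (hV : ∀ t, γ.IsVelocity t (V t)) {η : BBilin D} (alt : ∀ X, η X X = 0)

/-- The pull-back by the isotopy of the contraction of `η` with the velocity, paired with `X`, as a
function of time and position. -/
noncomputable def contraction (X : BField D) : TimeFn S :=
  ⟨_, γ.contMDiff_pullOne_velocity hV alt X⟩

/-- The homotopy operator of the isotopy applied to `η`: the average over the unit interval of the
pull-backs of the contraction of `η` with the velocity. -/
noncomputable def homotopyForm : BOneForm D where
  toFun X := (γ.contraction hV alt X).avg
  map_add' X Y := by
    rw [← TimeFn.avg_add]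
    congr 1
    ext ⟨t, p⟩
    exact DFunLike.congr_fun (map_add ((γ.at_time t).pullOne (η (V t))) X Y) p
  map_smul' f X := by
    ext p
    refine Eq.trans ?_ (intervalIntegral.integral_const_mul (f p) _)
    exact intervalIntegral.integral_congr fun t _ =>
      DFunLike.congr_fun (map_smul ((γ.at_time t).pullOne (η (V t))) f X) p

lemma act_homotopyForm (X Y : BField D) :
    act X.1 (γ.homotopyForm hV alt Y) = (TimeFn.act X.1 (γ.contraction hV alt Y)).avg :=
  ContMDiffMap.ext (TimeFn.act_avg X.1 (γ.contraction hV alt Y))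

/-- The fundamental theorem of calculus, applied to the pull-backs of `η`. -/
lemma bdOne_homotopyForm {p : S} (hp : p ∈ D.compl) (X Y : BField D) :
    bdOne (γ.homotopyForm hV alt) X Y p =
      (γ.at_time 1).pull η X Y p - (γ.at_time 0).pull η X Y p := by
  let B : TimeFn S := TimeFn.act X.1 (γ.contraction hV alt Y) -
    TimeFn.act Y.1 (γ.contraction hV alt X) - γ.contraction hV alt (bbracket X Y)
  have hB : ∀ t, B (t, p) = bdOne ((γ.at_time t).pullOne (η (V t))) X Y p := fun t => by
    change TimeFn.act X.1 _ (t, p) - TimeFn.act Y.1 _ (t, p) - _ = _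
    rw [TimeFn.act_apply, TimeFn.act_apply]
    rfl
  have havg : bdOne (γ.homotopyForm hV alt) X Y = B.avg := by
    rw [bdOne, act_homotopyForm, act_homotopyForm, TimeFn.avg_sub, TimeFn.avg_sub]
    rfl
  rw [havg]
  refine intervalIntegral.integral_eq_sub_of_hasDerivAt
    (f := fun t => (γ.at_time t).pull η X Y p) (fun t _ => ?_) (B.intervalIntegrable p 0 1)
  rw [hB]
  exact γ.hasDerivAt_pull (hV t) alt hp X Y

end BIsotopy

theorem cohomologous_of_bSymplectomorphic [IsManifold (𝓡 2) ∞ S] [T2Space S] {D : StarDivisor S}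
    {ω₀ ω₁ : LogSymplecticForm D} (h : BSymplectomorphic ω₀ ω₁) : Cohomologous ω₀ ω₁ := by
  obtain ⟨γ, hγ⟩ := h
  choose V hV using γ.exists_isVelocity
  refine ⟨-γ.homotopyForm hV ω₁.alt, fun X Y => eq_of_forall_mem_compl_eq D fun p hp => ?_⟩
  change _ = bdOneAt X Y p (-γ.homotopyForm hV ω₁.alt)
  rw [map_neg]
  change _ = -bdOne (γ.homotopyForm hV ω₁.alt) X Y p
  rw [γ.bdOne_homotopyForm hV ω₁.alt hp, hγ, (γ.at_time 0).pull_eq_self γ.start, neg_sub]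
  rfl

end Homotopy

section Orientation

variable {S : Type*} [TopologicalSpace S] [ChartedSpace Plane S] [IsManifold (𝓡 2) ∞ S]
  {D : StarDivisor S} {p : S} {E W : BField D}

lemma IsAreaLike.ne_zero {F G : BField D → BField D → SmoothFn S} (hF : IsAreaLike F)
    (hG : IsAreaLike G) {X Y : BField D} (hXY : F X Y p ≠ 0) (hEW : G E W p ≠ 0) :
    F E W p ≠ 0 := fun h =>
  mul_ne_zero hXY hEW (by rw [hF.mul_eq_mul hG X Y E W, h, zero_mul])

/-- The inverse of a `b`-diffeomorphism. -/
noncomputable def BDiffeo.symm (ψ : BDiffeo D) : BDiffeo D where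
  toDiffeo := ψ.toDiffeo.symm
  image_curve i := by
    conv_lhs => rw [← ψ.image_curve i]
    exact ψ.toDiffeo.symm_image_image _

variable [T2Space S]

lemma BDiffeo.push_surjective (ψ : BDiffeo D) : Function.Surjective ψ.push := by
  refine fun X => ⟨ψ.symm.push X, Subtype.ext (VField.ext_act fun f q => ?_)⟩
  obtain ⟨p, rfl⟩ : ∃ p, ψ.toDiffeo p = q :=
    ⟨ψ.toDiffeo.symm q, ψ.toDiffeo.apply_symm_apply q⟩
  have hinv : ψ.symm.toDiffeo (ψ.toDiffeo p) = p := ψ.toDiffeo.symm_apply_apply p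
  have hcomp : (f.comp ψ.map).comp ψ.symm.map = f :=
    ContMDiffMap.ext fun r => congrArg f (ψ.toDiffeo.apply_symm_apply r)
  have hact := ψ.symm.act_push X (f.comp ψ.map) (ψ.toDiffeo p)
  rw [hinv, hcomp] at hact
  exact (ψ.act_push _ f p).trans hact

lemma isAreaLike_pull (ψ : BDiffeo D) {η : BBilin D} (alt : ∀ X, η X X = 0) :
    IsAreaLike (ψ.pull η) := by
  intro p hp
  obtain ⟨a, b, c, habc⟩ := exists_eq_mul_wedge alt (ψ.mem_compl hp)
  obtain ⟨κ, hκ⟩ := isAreaLike_wedge (b.comp ψ.map) (c.comp ψ.map) p hp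
  refine ⟨a (ψ.toDiffeo p) * κ, fun X Y => ?_⟩
  refine (habc.self_of_nhds (ψ.push X) (ψ.push Y)).trans ?_
  rw [ψ.wedge_push, hκ, mul_assoc]

namespace LogSymplecticForm

lemma pull_ne_zero (η : LogSymplecticForm D) (ψ : BDiffeo D) (h : η.form E W p ≠ 0) :
    ψ.pull η.form E W p ≠ 0 := by
  obtain ⟨X', Y', hXY⟩ := η.exists_ne_zero (ψ.toDiffeo p)
  obtain ⟨X, rfl⟩ := ψ.push_surjective X'
  obtain ⟨Y, rfl⟩ := ψ.push_surjective Y'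
  exact (isAreaLike_pull ψ η.alt).ne_zero (isAreaLike_bilin η.alt) (X := X) (Y := Y) hXY h

lemma exists_eq_smul (η : LogSymplecticForm D) {β : BBilin D} (alt : ∀ X, β X X = 0) :
    ∃ f : SmoothFn S, β = f • η.form := by
  have hratio : ∀ {E W : BField D} {q : S}, η.form E W q ≠ 0 → ∀ X Y : BField D,
      β X Y q = β E W q / η.form E W q * η.form X Y q := fun {E W q} h X Y => by
    rw [div_mul_eq_mul_div, eq_div_iff h]
    exact (isAreaLike_bilin alt).mul_eq_mul (isAreaLike_bilin η.alt) X Y E W q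
  choose E W hEW using η.exists_ne_zero
  refine ⟨⟨fun q => β (E q) (W q) q / η.form (E q) (W q) q, fun p => ?_⟩, ?_⟩
  · refine ((β (E p) (W p)).contMDiff.contMDiffAt.div₀
      (η.form (E p) (W p)).contMDiff.contMDiffAt (hEW p)).congr_of_eventuallyEq ?_
    filter_upwards [(η.form (E p) (W p)).contMDiff.continuous.continuousAt.eventually_ne (hEW p)]
      with q hq
    rw [div_eq_iff (hEW q)]
    exact hratio hq (E q) (W q)
  · ext X Y q
    exact hratio (hEW q) X Y

lemma pull_mul_self_pos (η : LogSymplecticForm D) (γ : BIsotopy D) (hp : p ∈ D.compl)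
    (h : η.form E W p ≠ 0) (t : ℝ) :
    0 < (γ.at_time t).pull η.form E W p * η.form E W p := by
  have hcont : Continuous fun s => (γ.at_time s).pull η.form E W p * η.form E W p := by
    refine continuous_iff_continuousAt.2 fun s => ?_
    obtain ⟨V, hV⟩ := γ.exists_isVelocity s
    exact (γ.hasDerivAt_pull hV η.alt hp E W).continuousAt.mul continuousAt_const
  have hstart : 0 ≤ (γ.at_time 0).pull η.form E W p * η.form E W p := by
    rw [(γ.at_time 0).pull_eq_self γ.start]
    exact mul_self_nonneg _
  by_contra! hneg
  obtain ⟨s, hs⟩ := mem_range_of_exists_le_of_exists_ge hcont ⟨t, hneg⟩ ⟨0, hstart⟩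
  exact mul_ne_zero (η.pull_ne_zero _ h) h hs

end LogSymplecticForm

theorem sameOrientation_of_bSymplectomorphic {ω₀ ω₁ : LogSymplecticForm D}
    (h : BSymplectomorphic ω₀ ω₁) : SameOrientation ω₀ ω₁ := by
  obtain ⟨γ, hγ⟩ := h
  obtain ⟨f, hf⟩ := ω₁.exists_eq_smul ω₀.alt
  have hfp : ∀ (X Y : BField D) (p : S), ω₀.form X Y p = f p * ω₁.form X Y p := fun X Y p => by
    rw [hf]
    rfl
  have hpos : ∀ p ∈ D.compl, 0 < f p := fun p hp => by
    obtain ⟨E, W, hEW⟩ := ω₁.exists_ne_zero p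
    have hmul := ω₁.pull_mul_self_pos γ hp hEW 1
    rw [hγ, hfp, mul_assoc] at hmul
    exact pos_of_mul_pos_left hmul (mul_self_nonneg _)
  have hnonneg : ∀ p, 0 ≤ f p := fun p =>
    closure_minimal (fun q hq => (hpos q hq).le)
      (isClosed_le continuous_const f.contMDiff.continuous) (D.dense_compl p)
  refine ⟨f, fun p => (hnonneg p).lt_of_ne' fun hzero => ?_, hf⟩
  obtain ⟨X, Y, hXY⟩ := ω₀.exists_ne_zero p
  exact hXY (by rw [hfp, hzero, zero_mul])

end Orientation

end StarLog

theorem theorem1p1_general {S : Type*} [TopologicalSpace S] [T2Space S] [CompactSpace S]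
    [ChartedSpace StarLog.Plane S] [IsManifold (𝓡 2) ∞ S]
    (D : StarLog.StarDivisor S) (ω₀ ω₁ : StarLog.LogSymplecticForm D) :
    StarLog.BSymplectomorphic ω₀ ω₁ ↔
      StarLog.Cohomologous ω₀ ω₁ ∧ StarLog.SameOrientation ω₀ ω₁ :=
  ⟨fun h => ⟨StarLog.cohomologous_of_bSymplectomorphic h,
      StarLog.sameOrientation_of_bSymplectomorphic h⟩,
    fun h => StarLog.bSymplectomorphic_of_cohomologous h.1 h.2⟩

theorem theorem1p1 {S : Type*} [TopologicalSpace S] [T2Space S] [CompactSpace S]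
    [ConnectedSpace S] [ChartedSpace StarLog.Plane S] [IsManifold (𝓡 2) ∞ S]
    (D : StarLog.StarDivisor S) (ω₀ ω₁ : StarLog.LogSymplecticForm D) :
    StarLog.BSymplectomorphic ω₀ ω₁ ↔
      StarLog.Cohomologous ω₀ ω₁ ∧ StarLog.SameOrientation ω₀ ω₁ := by
  exact theorem1p1_general D ω₀ ω₁
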